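/- Let $d\ge 1$ and $p\in\mathbb N_0$. For a stationary random signed measure $\Psi$ on $\mathbb R^d$ with $E[|\Psi|(B_1)^2]<\infty$ (called locally square-integrable; $B_\varepsilon$ is the open ball of radius $\varepsilon$ around $0$) and intensity $\gamma=E[\Psi([0,1)^d)]$, let $\beta_\Psi=\alpha_\Psi-\gamma^2\lambda_d$ be its covariance measure, where $\lambda_d$ is the Lebesgue measure and $\alpha_\Psi(B)=E\big[\iint 1\{x\in[0,1)^d,\ x-y\in B\}\,\Psi(dx)\,\Psi(dy)\big]$. The Bartlett spectral measure $\hat\beta_\Psi$ is the Fourier transform of $\beta_\Psi$, i.e. the locally finite measure with $\int f\star g\,d\beta_\Psi=\int \hat f\,\overline{\hat g}\,d\hat\beta_\Psi$ for all bounded measurable $f,g:\mathbb R^d\to\mathbb C$ with bounded support, where $(f\star g)(y)=\int f(x)\overline{g(x-y)}\,dx$ and $\hat f(k)=\int e^{-i\langle k,x\rangle}f(x)\,dx$. For real $q\ge -d$, $\Psi$ is called $q$-uniform if $\hat\beta_\Psi(B_\varepsilon)/\varepsilon^d=O(\varepsilon^q)$ as $\varepsilon\to0$, and solely $q$-uniform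 if it is $q$-uniform and $\hat\beta_\Psi(B_\varepsilon)/\varepsilon^d\neq o(\varepsilon^q)$. **Theorem.** Let $\mu$ be a random finite signed measure on $\mathbb R^d$. Let $\Phi$ be a locally square-integrable stationary point process on $\mathbb R^d$ which is not almost surely the zero measure and which is $2p$-uniform. Let $K$ be a random kernel from $\mathbb R^d$ to $\mathbb R^d$ with values in the finite signed measures such that, conditionally on $\Phi$, the shifted measures $K^*_x=K(x,\cdot+x)$, with $x$ running through the (distinct) points of $\Phi$, are independent and distributed like $\mu$. Assume that $$E\Big[\Big(\int (\|x\|^p+1)\,|\mu|(dx)\Big)^2\Big]<\infty,$$ that $\int x^{\otimes q}\,\mu(dx)$ is almost surely deterministic for every $q\in\mathbb N_0$ with $q<p$, and that $\int x^{\otimes p}\,\mu(dx)$ is not almost surely deterministic. Then $|K|\Phi=\int |K(x,\cdot)|\,\Phi(dx)$ is almost surely locally finite, and the cluster measure $K\Phi=\int K(x,\cdot)\,\Phi(dx)$ is a stationary, locally square-integrable random signed measure which is solely $2p$-uniform. Moreover, for any family of transformations $(T_x)_{x\in\mathbb R^d}$ of the probability space, if $\Phi$ and $K$ are invariant, i.e.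 $\Phi(T_x\omega,B+x)=\Phi(\omega,B)$ and $K(T_x\omega,y+x,B+x)=K(\omega,y,B)$, then so is $K\Phi$, i.e. $K\Phi(T_x\omega,B+x)=K\Phi(\omega,B)$ for all bounded Borel sets $B$. -/

import Mathlib

open MeasureTheory ProbabilityTheory Filter Topology Asymptotics
open scoped ENNReal

/-- Euclidean space of dimension `d`. -/
abbrev Rd (d : ℕ) : Type := EuclideanSpace ℝ (Fin d)

/-- The half-open unit cube `[0,1)^d`. -/
def unitCube (d : ℕ) : Set (Rd d) := {x | ∀ i, x i ∈ Set.Ico (0 : ℝ) 1}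

/-- The translate `B + x` of a set `B`. -/
def shiftSet {d : ℕ} (x : Rd d) (B : Set (Rd d)) : Set (Rd d) := (fun y => y - x) ⁻¹' B

/-! ### Locally finite signed measures and random signed measures

A locally finite signed measure is the restriction to the bounded Borel sets of a difference of two
locally finite measures. It is represented by its values `m B` on the bounded Borel sets `B`;
the values of `m` on other sets are never used. -/

/-- A Borel measure which is finite on all bounded sets. -/
def FiniteOnBounded {d : ℕ} (ν : Measure (Rd d)) : Prop :=
  ∀ B : Set (Rd d), Bornology.IsBounded B → ν B < ∞

/-- `m = m₁ - m₂` on the bounded Borel sets, with locally finite measures `m₁`, `m₂`. -/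
def IsDifference {d : ℕ} (m : Set (Rd d) → ℝ) (m₁ m₂ : Measure (Rd d)) : Prop :=
  FiniteOnBounded m₁ ∧ FiniteOnBounded m₂ ∧
    ∀ B : Set (Rd d), Bornology.IsBounded B → MeasurableSet B → m B = m₁.real B - m₂.real B

/-- `m` is a locally finite signed measure. -/
def IsLocallyFiniteSigned {d : ℕ} (m : Set (Rd d) → ℝ) : Prop :=
  ∃ m₁ m₂ : Measure (Rd d), IsDifference m m₁ m₂

open Classical in
/-- The integral `m(f) = ∫ f dm` of `f` against a locally finite signed measure `m = m₁ - m₂`, that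
is `∫ f dm₁ - ∫ f dm₂`. For bounded measurable `f` with bounded support the choice of `m₁`, `m₂`
is irrelevant, see `signedIntegral_eq`. -/
noncomputable def signedIntegral {d : ℕ} (m : Set (Rd d) → ℝ) (f : Rd d → ℂ) : ℂ :=
  if h : IsLocallyFiniteSigned m then
    (∫ x, f x ∂h.choose) - ∫ x, f x ∂h.choose_spec.choose
  else 0

/-- Bounded measurable functions with bounded support. -/
structure IsTestFunction {d : ℕ} (f : Rd d → ℂ) : Prop where
  measurable : Measurable f
  bounded : ∃ c : ℝ, ∀ x, ‖f x‖ ≤ c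
  support : Bornology.IsBounded (Function.support f)

theorem IsTestFunction.integrable {d : ℕ} {f : Rd d → ℂ} (hf : IsTestFunction f)
    {ν : Measure (Rd d)} (hν : FiniteOnBounded ν) : Integrable f ν := by
  obtain ⟨c, hc⟩ := hf.bounded
  have hS : MeasurableSet (Function.support f) := measurableSet_support hf.measurable
  rw [← integrableOn_iff_integrable_of_support_subset (Set.Subset.refl (Function.support f))]
  exact Measure.integrableOn_of_bounded (hν _ hf.support).ne hf.measurable.aestronglyMeasurable
    (M := c) (Eventually.of_forall hc)

theorem FiniteOnBounded.ext {d : ℕ} {ν ρ : Measure (Rd d)}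
    (h : ∀ B : Set (Rd d), Bornology.IsBounded B → MeasurableSet B → ν B = ρ B) : ν = ρ := by
  ext A hA
  have hU : A = ⋃ n : ℕ, A ∩ Metric.ball (0 : Rd d) n := by
    rw [← Set.inter_iUnion, Metric.iUnion_ball_nat, Set.inter_univ]
  have hm : Monotone fun n : ℕ => A ∩ Metric.ball (0 : Rd d) n := fun a b hab =>
    Set.inter_subset_inter_right _ (Metric.ball_subset_ball (by exact_mod_cast hab))
  rw [hU, hm.measure_iUnion, hm.measure_iUnion]
  refine iSup_congr fun n => h _ ?_ (hA.inter Metric.isOpen_ball.measurableSet)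
  exact Metric.isBounded_ball.subset Set.inter_subset_right

/-- The integral does not depend on the representation of `m` as a difference. -/
theorem signedIntegral_eq {d : ℕ} {m : Set (Rd d) → ℝ} {m₁ m₂ : Measure (Rd d)}
    (hm : IsDifference m m₁ m₂) {f : Rd d → ℂ} (hf : IsTestFunction f) :
    signedIntegral m f = (∫ x, f x ∂m₁) - ∫ x, f x ∂m₂ := by
  have h : IsLocallyFiniteSigned m := ⟨m₁, m₂, hm⟩
  rw [signedIntegral, dif_pos h]
  have hc := h.choose_spec.choose_spec
  generalize h.choose_spec.choose = c₂ at hc ⊢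
  generalize h.choose = c₁ at hc ⊢
  obtain ⟨h1, h2, h3⟩ := hm
  obtain ⟨k1, k2, k3⟩ := hc
  have key : c₁ + m₂ = m₁ + c₂ := by
    refine FiniteOnBounded.ext fun B hB hBm => ?_
    have e := (k3 B hB hBm).symm.trans (h3 B hB hBm)
    have e' : c₁.real B + m₂.real B = m₁.real B + c₂.real B := by linarith
    rw [Measure.add_apply, Measure.add_apply,
      ← ENNReal.toReal_eq_toReal_iff' (ENNReal.add_ne_top.2 ⟨(k1 B hB).ne, (h2 B hB).ne⟩)
        (ENNReal.add_ne_top.2 ⟨(h1 B hB).ne, (k2 B hB).ne⟩),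
      ENNReal.toReal_add (k1 B hB).ne (h2 B hB).ne, ENNReal.toReal_add (h1 B hB).ne (k2 B hB).ne]
    exact e'
  have e : (∫ x, f x ∂c₁) + ∫ x, f x ∂m₂ = (∫ x, f x ∂m₁) + ∫ x, f x ∂c₂ := by
    rw [← integral_add_measure (hf.integrable k1) (hf.integrable h2),
      ← integral_add_measure (hf.integrable h1) (hf.integrable k2), key]
  linear_combination e

/-- The total variation `|m|(A)` of a locally finite signed measure on a bounded set `A`. -/
noncomputable def absVariation {d : ℕ} (m : Set (Rd d) → ℝ) (A : Set (Rd d)) : ℝ≥0∞ :=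
  ⨆ (n : ℕ) (B : Fin n → Set (Rd d)) (_ : ∀ i, MeasurableSet (B i) ∧ B i ⊆ A)
    (_ : Pairwise fun i j => Disjoint (B i) (B j)), ∑ i, ENNReal.ofReal |m (B i)|

section RandomMeasures

variable {d : ℕ} {Ω : Type*} [MeasurableSpace Ω]

/-- A random (locally finite) signed measure `Ψ`, with `Ψ ω B` the value of `Ψ(ω)` on the bounded
Borel set `B`. -/
def IsRandomSignedMeasure (P : Measure Ω) (Ψ : Ω → Set (Rd d) → ℝ) : Prop :=
  (∀ B : Set (Rd d), Bornology.IsBounded B → MeasurableSet B → Measurable fun ω => Ψ ω B) ∧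
    ∀ᵐ ω ∂P, IsLocallyFiniteSigned (Ψ ω)

/-- Stationarity: for all `x`, the random signed measure `B ↦ Ψ (B + x)` has the same law as `Ψ`,
i.e. the same finite-dimensional distributions. -/
def IsStationaryRandom (P : Measure Ω) (Ψ : Ω → Set (Rd d) → ℝ) : Prop :=
  ∀ (x : Rd d) (n : ℕ) (B : Fin n → Set (Rd d)),
    (∀ i, Bornology.IsBounded (B i) ∧ MeasurableSet (B i)) →
      P.map (fun ω i => Ψ ω (shiftSet x (B i))) = P.map (fun ω i => Ψ ω (B i))

/-- Invariance of a random signed measure with respect to transformations `T x`, `x ∈ ℝ^d`, of the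
probability space: `Ψ(T_x ω, B + x) = Ψ(ω, B)`. -/
def IsInvariantRandom (T : Rd d → Ω → Ω) (Ψ : Ω → Set (Rd d) → ℝ) : Prop :=
  ∀ (x : Rd d) (ω : Ω) (B : Set (Rd d)), Bornology.IsBounded B → MeasurableSet B →
    Ψ (T x ω) (shiftSet x B) = Ψ ω B

/-- Local (absolute) square integrability: `E[|Ψ|(B_1)^2] < ∞`, where `B_1` is the open unit ball. -/
def IsLocallySquareIntegrable (P : Measure Ω) (Ψ : Ω → Set (Rd d) → ℝ) : Prop :=
  ∫⁻ ω, absVariation (Ψ ω) (Metric.ball 0 1) ^ 2 ∂P < ∞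

/-! ### Second-order quantities, Bartlett spectral measure, `p`-uniformity -/

/-- The intensity `γ = E[Ψ([0,1)^d)]` of a stationary random signed measure. -/
noncomputable def intensity (P : Measure Ω) (Ψ : Ω → Set (Rd d) → ℝ) : ℝ :=
  ∫ ω, Ψ ω (unitCube d) ∂P

/-- The integral `α_Ψ(h) = E[∬ 1{x ∈ [0,1)^d} h(x - y) Ψ(dx) Ψ(dy)]` of `h` against the reduced
second moment measure `α_Ψ` of `Ψ`. -/
noncomputable def secondMoment (P : Measure Ω) (Ψ : Ω → Set (Rd d) → ℝ) (h : Rd d → ℂ) : ℂ :=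
  ∫ ω, signedIntegral (Ψ ω) (fun x => signedIntegral (Ψ ω) fun y =>
    (unitCube d).indicator (fun x => h (x - y)) x) ∂P

/-- The integral `β_Ψ(h)` of `h` against the covariance measure `β_Ψ = α_Ψ - γ^2 λ_d`. -/
noncomputable def covMeasure (P : Measure Ω) (Ψ : Ω → Set (Rd d) → ℝ) (h : Rd d → ℂ) : ℂ :=
  secondMoment P Ψ h - ((intensity P Ψ : ℝ) : ℂ) ^ 2 * ∫ x, h x

/-- The tilted convolution `(f ⋆ g)(y) = ∫ f(x) conj (g(x - y)) dx`. -/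
noncomputable def tiltedConv (f g : Rd d → ℂ) (y : Rd d) : ℂ :=
  ∫ x, f x * (starRingEnd ℂ) (g (x - y))

/-- The Fourier transform `k ↦ ∫ exp(-i⟨k,x⟩) f(x) dx`. -/
noncomputable def fourierHat (f : Rd d → ℂ) (k : Rd d) : ℂ :=
  ∫ x, Complex.exp (-Complex.I * ((inner ℝ k x : ℝ) : ℂ)) * f x

/-- `ν` is the Bartlett spectral measure of `Ψ`: the locally finite measure which is the Fourier
transform of the covariance measure `β_Ψ`, i.e. `β_Ψ(f ⋆ g) = ν(f̂ conj(ĝ))` for all bounded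
functions `f`, `g` with bounded support. -/
def IsBartlettMeasure (P : Measure Ω) (Ψ : Ω → Set (Rd d) → ℝ) (ν : Measure (Rd d)) : Prop :=
  FiniteOnBounded ν ∧ ∀ f g : Rd d → ℂ, IsTestFunction f → IsTestFunction g →
    Integrable (fun k => fourierHat f k * (starRingEnd ℂ) (fourierHat g k)) ν ∧
    covMeasure P Ψ (tiltedConv f g) =
      ∫ k, fourierHat f k * (starRingEnd ℂ) (fourierHat g k) ∂ν

/-- `q`-uniformity: the Bartlett spectral measure `ν` satisfies `ν(B_ε) / ε^d = O(ε^q)` as `ε → 0`. -/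
def IsUniform (P : Measure Ω) (Ψ : Ω → Set (Rd d) → ℝ) (q : ℝ) : Prop :=
  ∃ ν : Measure (Rd d), IsBartlettMeasure P Ψ ν ∧
    (fun ε : ℝ => ν.real (Metric.ball 0 ε) / ε ^ d) =O[𝓝[>] 0] fun ε : ℝ => ε ^ q

/-- Beyond `q`-uniformity: the Bartlett spectral measure `ν` satisfies `ν(B_ε) / ε^d = o(ε^q)`. -/
def IsBeyondUniform (P : Measure Ω) (Ψ : Ω → Set (Rd d) → ℝ) (q : ℝ) : Prop :=
  ∃ ν : Measure (Rd d), IsBartlettMeasure P Ψ ν ∧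
    (fun ε : ℝ => ν.real (Metric.ball 0 ε) / ε ^ d) =o[𝓝[>] 0] fun ε : ℝ => ε ^ q

/-- Sole `q`-uniformity: `q`-uniform but not beyond `q`-uniform. -/
def IsSolelyUniform (P : Measure Ω) (Ψ : Ω → Set (Rd d) → ℝ) (q : ℝ) : Prop :=
  IsUniform P Ψ q ∧ ¬ IsBeyondUniform P Ψ q

/-! ### Point processes, random finite signed measures and transport kernels -/

/-- A point process: a random locally finite measure with values in `ℕ` on bounded Borel sets. -/
def IsPointProcess (Φ : Ω → Measure (Rd d)) : Prop :=
  Measurable Φ ∧ ∀ (ω : Ω) (B : Set (Rd d)), Bornology.IsBounded B → MeasurableSet B →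
    ∃ n : ℕ, Φ ω B = n

/-- A random measure, considered as a random signed measure. -/
def toSigned (Φ : Ω → Measure (Rd d)) : Ω → Set (Rd d) → ℝ := fun ω B => (Φ ω).real B

/-- The sigma-algebra on the space of finite signed measures generated by the evaluations. -/
instance signedMeasureSpace : MeasurableSpace (SignedMeasure (Rd d)) :=
  ⨆ B : Set (Rd d), MeasurableSpace.comap (fun m : SignedMeasure (Rd d) => m B) inferInstance

/-- The kernel `K^*` relative to the position, `K^*(ω, x, B) = K(ω, x, B + x)`. -/
noncomputable def relKernel (K : Ω → Rd d → SignedMeasure (Rd d)) (ω : Ω) (x : Rd d) :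
    SignedMeasure (Rd d) :=
  (K ω x).map fun y => y - x

/-- The destination `KΦ(ω, B) = ∫ K(ω, x, B) Φ(ω, dx)` of the transport of `Φ` by `K`. -/
noncomputable def destination (K : Ω → Rd d → SignedMeasure (Rd d)) (Φ : Ω → Measure (Rd d)) :
    Ω → Set (Rd d) → ℝ :=
  fun ω B => ∫ x, K ω x B ∂Φ ω

/-- Invariance of a kernel: `K(T_x ω, y + x, B + x) = K(ω, y, B)`. -/
def IsInvariantKernel (T : Rd d → Ω → Ω) (K : Ω → Rd d → SignedMeasure (Rd d)) : Prop :=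
  ∀ (x : Rd d) (ω : Ω) (y : Rd d) (B : Set (Rd d)), MeasurableSet B →
    K (T x ω) (y + x) (shiftSet x B) = K ω y B

/-- Conditionally on `Φ`, the finite signed measures `K^*_x`, where `x` runs through the points of
`Φ`, are independent with law `L`: whenever `X_1, …, X_n` are determined by `Φ` and are pairwise
distinct points of `Φ` on an event `S` determined by `Φ`, then, conditionally on `Φ` and on the
event `S`, the signed measures `K^*_{X_1}, …, K^*_{X_n}` are independent with law `L`. -/
def HasIndependentClusters (P : Measure Ω) (Φ : Ω → Measure (Rd d))
    (K : Ω → Rd d → SignedMeasure (Rd d)) (L : Measure (SignedMeasure (Rd d))) : Prop :=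
  ∀ (n : ℕ) (X : Fin n → Ω → Rd d) (S : Set Ω) (A : Fin n → Set (SignedMeasure (Rd d))),
    (∀ i, Measurable[MeasurableSpace.comap Φ inferInstance] (X i)) →
    MeasurableSet[MeasurableSpace.comap Φ inferInstance] S →
    (∀ ω ∈ S, (∀ i, Φ ω {X i ω} ≠ 0) ∧ Function.Injective fun i => X i ω) →
    (∀ i, MeasurableSet (A i)) →
    P (S ∩ {ω | ∀ i, relKernel K ω (X i ω) ∈ A i}) = P S * ∏ i, L (A i)

/-- The tensor `∫ x^{⊗q} dm` of moments of order `q` of a finite signed measure `m`, given by its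
components `∫ x_{j_1} ⋯ x_{j_q} dm`. -/
noncomputable def momentTensor (q : ℕ) (m : SignedMeasure (Rd d)) (j : Fin q → Fin d) : ℝ :=
  ∫ᵛ x, (∏ i, x (j i)) ∂•m

/-- The random tensor `∫ x^{⊗q} dμ` is (almost surely) deterministic. -/
def HasDeterministicMoment (P : Measure Ω) (μ : Ω → SignedMeasure (Rd d)) (q : ℕ) : Prop :=
  ∃ c : (Fin q → Fin d) → ℝ, ∀ᵐ ω ∂P, momentTensor q (μ ω) = c

end RandomMeasures

/-! The proof computes the spectral measure of the cluster measure. Write `m̂` for the Fourier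
transform of a finite signed measure `m` and put `γ₂ = E ∑ Φ{x}²`, the sum running over the distinct
points of `Φ` in the unit cube. Two points of `KΦ` in clusters around different points of `Φ` are
displaced independently, so they contribute the covariance of `Φ` smeared by the mean cluster. Two
points in the same cluster follow the second moment measure of `μ` instead of the product of its
means, and correcting for this adds a variance. In Fourier space, `KΦ` has the spectral measure `|E
μ̂(k)|² ν(dk) + γ₂ (2π)^{-d} Var(μ̂(k)) dk`, where `ν` belongs to `Φ` (`clusterSpectralMeasure`,
`HasIndependentClusters.isBartlettMeasure`). Only moduli enter, so the sign in the exponential is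
immaterial.

Upper bound: the first summand is a bounded density times a `2p`-uniform measure. For the second,
`Var(μ̂(k))` is half of `E|μ̂(k) - μ̂'(k)|²` with an independent copy `μ'`. The Taylor terms of
order less than `p` are deterministic and cancel in the difference, and the remainder is at most a
constant times `‖k‖^p` times a square-integrable variable. Hence the variance is `O(‖k‖^{2p})`
(`exists_transformVariance_le`).

Sharpness: both summands are nonnegative measures, so if the mass of `B_ε` were `o(ε^{d+2p})`, the
same would hold for the integral of the variance, because `γ₂ > 0` (`diagMeasure_unitCube_pos`).
Substituting `k = εw` and applying Fatou's lemma forces `∫ ⟨w,x⟩^p μ(dx) = ∫ ⟨w,x⟩^p μ'(dx)` for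
almost all `w`. Continuity, homogeneity and polarization turn this into equality of the moment
tensors of two independent copies, so the tensor of order `p` is deterministic
(`exists_momentTensor_eq_of_tendsto`). As the little-o property may be witnessed by any spectral
measure, uniqueness near the origin is also needed (`IsBartlettMeasure.restrict_ball_eq`).

To avoid cancellation in possibly infinite quantities, a signed measure is carried as a positive
measure on `ℝ^d × {±}` (`signKernel`). The second-order structure is then one additive identity
between positive measures (`HasIndependentClusters.pair_identity`). It rests on Campbell formulas,
proved by enumerating the atoms of `Φ` measurably; the same enumeration gives stationarity of `KΦ`.
-/

section SFinite

/-! ### s-finiteness of kernels with pointwise finite values. -/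

variable {α β : Type*} [MeasurableSpace α] [MeasurableSpace β]

/-- A kernel which is finite on each member of a countable measurable cover is s-finite. -/
theorem isSFiniteKernel_of_finite_cover (κ : Kernel α β) (U : ℕ → Set β)
    (hU : ∀ n, MeasurableSet (U n)) (hcov : ⋃ n, U n = Set.univ) (hfin : ∀ a n, κ a (U n) < ∞) :
    IsSFiniteKernel κ := by
  classical
  have hDm : ∀ n, MeasurableSet (disjointed U n) := fun n => MeasurableSet.disjointed hU n
  have hDfin : ∀ a n, κ a (disjointed U n) < ∞ := fun a n =>
    (measure_mono (disjointed_subset U n)).trans_lt (hfin a n)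
  -- A finite kernel needs a bound uniform in the parameter. Stratifying the parameters by the
  -- integer part `k` of the mass of the `n`-th piece provides the bound `k + 1`.
  set S : ℕ → ℕ → Set α := fun n k => {a | ⌊(κ a (disjointed U n)).toReal⌋₊ = k} with hS
  have hSm : ∀ n k, MeasurableSet (S n k) := fun n k => by
    have : Measurable fun a => ⌊(κ a (disjointed U n)).toReal⌋₊ :=
      Nat.measurable_floor.comp (κ.measurable_coe (hDm n)).ennreal_toReal
    exact this (measurableSet_singleton k)
  set η : ℕ → ℕ → Kernel α β := fun n k => Kernel.piecewise (hSm n k) (κ.restrict (hDm n)) 0 with hη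
  have hηfin : ∀ n k, IsFiniteKernel (η n k) := fun n k => by
    refine ⟨⟨k + 1, by simp, fun a => ?_⟩⟩
    rw [hη]
    simp only [Kernel.piecewise_apply]
    split_ifs with h
    · rw [Kernel.restrict_apply, Measure.restrict_apply MeasurableSet.univ, Set.univ_inter]
      have h1 := Nat.lt_floor_add_one (κ a (disjointed U n)).toReal
      have h2 : ⌊(κ a (disjointed U n)).toReal⌋₊ = k := h
      rw [h2] at h1
      rw [← ENNReal.ofReal_toReal (hDfin a n).ne]
      refine ENNReal.ofReal_le_of_le_toReal ?_
      rw [ENNReal.toReal_add (by simp) (by simp)]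
      simpa using h1.le
    · simp
  have key : κ = Kernel.sum fun n => Kernel.sum fun k => η n k := by
    ext a s hs
    rw [Kernel.sum_apply' _ _ hs]
    have h1 : ∀ n, Kernel.sum (fun k => η n k) a s = κ a (s ∩ disjointed U n) := fun n => by
      rw [Kernel.sum_apply' _ _ hs, tsum_eq_single ⌊(κ a (disjointed U n)).toReal⌋₊]
      · simp only [hη, Kernel.piecewise_apply]
        rw [if_pos (by simp [hS]), Kernel.restrict_apply' _ _ _ hs]
      · intro k hk
        simp only [hη, Kernel.piecewise_apply]
        rw [if_neg (by simpa [hS] using hk.symm)]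
        simp
    simp_rw [h1]
    rw [← measure_iUnion]
    · rw [← Set.inter_iUnion, iUnion_disjointed, hcov, Set.inter_univ]
    · exact fun i j hij => ((disjoint_disjointed U hij).mono Set.inter_subset_right
        Set.inter_subset_right)
    · exact fun n => hs.inter (hDm n)
  rw [key]
  have : ∀ n, IsSFiniteKernel (Kernel.sum fun k => η n k) := fun n =>
    Kernel.isSFiniteKernel_sum (hκs := fun k => inferInstance)
  exact Kernel.isSFiniteKernel_sum (hκs := this)

theorem isSFiniteKernel_of_isFiniteMeasure (κ : Kernel α β) (h : ∀ a, IsFiniteMeasure (κ a)) :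
    IsSFiniteKernel κ :=
  isSFiniteKernel_of_finite_cover κ (fun _ => Set.univ) (fun _ => MeasurableSet.univ)
    (Set.iUnion_const _) (fun a _ => (h a).measure_univ_lt_top)

end SFinite

/-! ### Signed measures as positive measures on `ℝ^d × {±}`. -/

section SignedKernel

variable {d : ℕ}

theorem measurable_signedMeasure_apply (B : Set (Rd d)) :
    Measurable fun m : SignedMeasure (Rd d) => m B :=
  Measurable.of_comap_le (le_iSup (fun B : Set (Rd d) => MeasurableSpace.comap
    (fun m : SignedMeasure (Rd d) => m B) inferInstance) B)

/-- The sigma-algebra is generated by the evaluations at all sets, but a vector measure vanishes on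
non-measurable sets, so those evaluations are constant and add nothing. -/
theorem measurable_signedMeasure_of {α : Type*} [MeasurableSpace α]
    {f : α → SignedMeasure (Rd d)} (h : ∀ B, MeasurableSet B → Measurable fun a => f a B) :
    Measurable f := by
  refine measurable_iff_comap_le.2 ?_
  rw [signedMeasureSpace, MeasurableSpace.comap_iSup]
  refine iSup_le fun B => ?_
  rw [MeasurableSpace.comap_comp]
  by_cases hB : MeasurableSet B
  · exact (h B hB).comap_le
  · have : ((fun m : SignedMeasure (Rd d) => m B) ∘ f) = fun _ => 0 := by
      ext a; exact (f a).not_measurable hB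
    rw [this]
    exact measurable_const.comap_le

/-- The supremum is attained at the positive set of a Hahn decomposition. That set can be
approximated in total variation by members of a countable generating algebra, and this algebra does
not depend on `m`. The formula therefore makes the Jordan parts measurable functions of `m`. -/
theorem SignedMeasure.exists_countable_posPart_eq_iSup :
    ∃ 𝒜 : Set (Set (Rd d)), 𝒜.Countable ∧ (∀ A ∈ 𝒜, MeasurableSet A) ∧
      ∀ (m : SignedMeasure (Rd d)) (B : Set (Rd d)), MeasurableSet B →
        m.toJordanDecomposition.posPart B = ⨆ A ∈ 𝒜, ENNReal.ofReal (m (A ∩ B)) := by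
  refine ⟨generateSetAlgebra (MeasurableSpace.countableGeneratingSet (Rd d)),
    countable_generateSetAlgebra (MeasurableSpace.countable_countableGeneratingSet), ?_, ?_⟩
  · intro A hA
    have := MeasurableSpace.measurableSet_generateFrom hA
    rwa [generateFrom_generateSetAlgebra_eq,
      MeasurableSpace.generateFrom_countableGeneratingSet] at this
  intro m B hB
  have hdense := Measure.MeasureDense.of_generateFrom_isSetAlgebra_finite m.totalVariation
    (isSetAlgebra_generateSetAlgebra
      (𝒜 := MeasurableSpace.countableGeneratingSet (Rd d)))
    (by rw [generateFrom_generateSetAlgebra_eq,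
      MeasurableSpace.generateFrom_countableGeneratingSet])
  set p := m.toJordanDecomposition.posPart with hp
  set n := m.toJordanDecomposition.negPart with hn
  have hm : ∀ A, MeasurableSet A → m A = p.real A - n.real A := fun A hA =>
    m.apply_eq_posPart_real_sub_negPart_real hA
  apply le_antisymm
  · obtain ⟨S, hS, hpS, hnS⟩ := m.toJordanDecomposition.mutuallySingular
    refine ENNReal.le_of_forall_pos_le_add fun ε hε _ => ?_
    -- `Sᶜ` carries the positive part and is null for the negative part. Replacing it by `A` changes
    -- both by amounts whose sum is at most `ε`.
    obtain ⟨A, hA, hlt⟩ := hdense.approx Sᶜ hS.compl (measure_ne_top _ _) ε (by exact_mod_cast hε)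
    have hAm := hdense.measurable A hA
    have h1 : p B ≤ ENNReal.ofReal (m (A ∩ B)) + ENNReal.ofReal ε := by
      rw [← ENNReal.ofReal_toReal (measure_ne_top p B)]
      refine le_trans (ENNReal.ofReal_le_ofReal ?_) ENNReal.ofReal_add_le
      have e1 : p.real B ≤ p.real (A ∩ B) + p.real (symmDiff Sᶜ A) + p.real S := by
        refine le_trans (measureReal_mono (s₂ := (A ∩ B) ∪ symmDiff Sᶜ A ∪ S) ?_) ?_
        · intro x hx
          by_cases hxS : x ∈ S
          · exact Or.inr hxS
          · by_cases hxA : x ∈ A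
            · exact Or.inl (Or.inl ⟨hxA, hx⟩)
            · exact Or.inl (Or.inr (Or.inl ⟨hxS, hxA⟩))
        · exact (measureReal_union_le _ _).trans (add_le_add_left (measureReal_union_le _ _) _)
      have e2 : n.real (A ∩ B) ≤ n.real (symmDiff Sᶜ A) + n.real Sᶜ := by
        refine le_trans (measureReal_mono (s₂ := symmDiff Sᶜ A ∪ Sᶜ) ?_) (measureReal_union_le _ _)
        intro x hx
        by_cases hxS : x ∈ S
        · exact Or.inl (Or.inr ⟨hx.1, not_not.2 hxS⟩)
        · exact Or.inr hxS
      have e3 : p.real S = 0 := by simp [measureReal_def, hp, hpS]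
      have e4 : n.real Sᶜ = 0 := by simp [measureReal_def, hn, hnS]
      have e5 : p.real (symmDiff Sᶜ A) + n.real (symmDiff Sᶜ A) ≤ ε := by
        have := (ENNReal.toReal_lt_of_lt_ofReal hlt).le
        rwa [SignedMeasure.totalVariation, Measure.add_apply,
          ENNReal.toReal_add (measure_ne_top _ _) (measure_ne_top _ _)] at this
      rw [hm _ (hAm.inter hB)]
      change p.real B ≤ _
      linarith
    refine h1.trans ?_
    rw [ENNReal.ofReal_coe_nnreal]
    gcongr
    exact le_iSup₂ (f := fun A _ => ENNReal.ofReal (m (A ∩ B))) A hA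
  · refine iSup₂_le fun A hA => ?_
    have hAm := hdense.measurable A hA
    rw [hm _ (hAm.inter hB)]
    refine (ENNReal.ofReal_le_ofReal (sub_le_self _ measureReal_nonneg)).trans ?_
    rw [measureReal_def, ENNReal.ofReal_toReal (measure_ne_top _ _)]
    exact measure_mono Set.inter_subset_right

theorem measurable_jordan_posPart :
    Measurable fun m : SignedMeasure (Rd d) => m.toJordanDecomposition.posPart := by
  obtain ⟨𝒜, hc, -, h⟩ := SignedMeasure.exists_countable_posPart_eq_iSup (d := d)
  refine Measure.measurable_of_measurable_coe _ fun B hB => ?_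
  simp_rw [fun m => h m B hB]
  exact Measurable.biSup _ hc fun A _ => (measurable_signedMeasure_apply _).ennreal_ofReal

theorem measurable_jordan_negPart :
    Measurable fun m : SignedMeasure (Rd d) => m.toJordanDecomposition.negPart := by
  have h : (fun m : SignedMeasure (Rd d) => m.toJordanDecomposition.negPart) =
      (fun m : SignedMeasure (Rd d) => m.toJordanDecomposition.posPart) ∘ fun m => -m := by
    ext1 m
    simp [SignedMeasure.toJordanDecomposition_neg]
  rw [h]
  refine measurable_jordan_posPart.comp (measurable_signedMeasure_of fun B _ => ?_)
  exact (measurable_signedMeasure_apply B).neg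

/-- The sign attached to a point of the positive or the negative part of a signed measure. -/
def signOf (b : Bool) : ℝ := if b then 1 else -1

theorem measurable_signOf : Measurable signOf := measurable_of_countable _

@[simp] theorem abs_signOf (b : Bool) : |signOf b| = 1 := by cases b <;> simp [signOf]

@[simp] theorem norm_signOf (b : Bool) : ‖signOf b‖ = 1 := abs_signOf b

/-- The measure on `ℝ^d × {±}` formed by the positive and negative parts of a signed measure. -/
noncomputable def signKernel : Kernel (SignedMeasure (Rd d)) (Rd d × Bool) where
  toFun m := m.toJordanDecomposition.posPart.map (fun x => (x, true)) +
    m.toJordanDecomposition.negPart.map (fun x => (x, false))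
  measurable' := by
    refine Measure.measurable_of_measurable_coe _ fun B hB => ?_
    have h1 : Measurable fun x : Rd d => (x, true) := by fun_prop
    have h2 : Measurable fun x : Rd d => (x, false) := by fun_prop
    simp_rw [Measure.add_apply, Measure.map_apply h1 hB, Measure.map_apply h2 hB]
    exact ((Measure.measurable_coe (h1 hB)).comp measurable_jordan_posPart).add
      ((Measure.measurable_coe (h2 hB)).comp measurable_jordan_negPart)

theorem signKernel_apply (m : SignedMeasure (Rd d)) :
    signKernel m = m.toJordanDecomposition.posPart.map (fun x => (x, true)) +
      m.toJordanDecomposition.negPart.map (fun x => (x, false)) := rfl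

instance (m : SignedMeasure (Rd d)) : IsFiniteMeasure (signKernel m) := by
  rw [signKernel_apply]; infer_instance

instance : IsSFiniteKernel (signKernel (d := d)) :=
  isSFiniteKernel_of_isFiniteMeasure _ fun _ => inferInstance

theorem signKernel_map_fst (m : SignedMeasure (Rd d)) :
    (signKernel m).map Prod.fst = m.totalVariation := by
  rw [signKernel_apply, Measure.map_add _ _ measurable_fst, Measure.map_map measurable_fst (by fun_prop),
    Measure.map_map measurable_fst (by fun_prop)]
  simp [Function.comp_def, SignedMeasure.totalVariation]

theorem integral_signKernel {F : Type*} [NormedAddCommGroup F] [NormedSpace ℝ F]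
    (m : SignedMeasure (Rd d)) (f : Rd d → F)
    (hf : Integrable f m.totalVariation) :
    ∫ z, signOf z.2 • f z.1 ∂signKernel m =
      ∫ x, f x ∂m.toJordanDecomposition.posPart - ∫ x, f x ∂m.toJordanDecomposition.negPart := by
  have e1 : MeasurableEmbedding fun x : Rd d => (x, true) := measurableEmbedding_prod_mk_right true
  have e2 : MeasurableEmbedding fun x : Rd d => (x, false) := measurableEmbedding_prod_mk_right false
  rw [SignedMeasure.totalVariation, integrable_add_measure] at hf
  rw [signKernel_apply, integral_add_measure, e1.integral_map, e2.integral_map]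
  · simp [signOf, integral_neg, sub_eq_add_neg]
  · rw [e1.integrable_map_iff]; simpa [Function.comp_def, signOf] using hf.1
  · rw [e2.integrable_map_iff]; simpa [Function.comp_def, signOf] using hf.2

theorem signedMeasure_apply_eq_integral (m : SignedMeasure (Rd d)) {B : Set (Rd d)}
    (hB : MeasurableSet B) :
    m B = ∫ z, signOf z.2 * B.indicator 1 z.1 ∂signKernel m := by
  have := integral_signKernel m (B.indicator (1 : Rd d → ℝ))
    ((integrable_const (1 : ℝ)).indicator hB)
  simp only [smul_eq_mul] at this
  rw [this, integral_indicator_one hB, integral_indicator_one hB]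
  exact m.apply_eq_posPart_real_sub_negPart_real hB

theorem integrable_signKernel_iff {F : Type*} [NormedAddCommGroup F] [NormedSpace ℝ F]
    (m : SignedMeasure (Rd d)) {f : Rd d → F} (hf : StronglyMeasurable f) :
    Integrable (fun z => signOf z.2 • f z.1) (signKernel m) ↔ Integrable f m.totalVariation := by
  rw [← signKernel_map_fst, integrable_map_measure hf.aestronglyMeasurable
    measurable_fst.aemeasurable]
  have h1 : StronglyMeasurable fun z : Rd d × Bool => f z.1 := hf.comp_measurable measurable_fst
  have h2 : StronglyMeasurable fun z : Rd d × Bool => signOf z.2 :=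
    (measurable_signOf.comp measurable_snd).stronglyMeasurable
  refine integrable_congr' (h2.smul h1).aestronglyMeasurable h1.aestronglyMeasurable
    (Eventually.of_forall fun z => ?_)
  simp [norm_smul]

/-- No integrability is required: if the monomial is not integrable for the total variation, both
integrals have the default value `0`. This makes the moment tensor measurable on the whole space of
signed measures. -/
theorem momentTensor_eq_integral (q : ℕ) (m : SignedMeasure (Rd d)) (j : Fin q → Fin d) :
    momentTensor q m j = ∫ z, signOf z.2 * ∏ i, z.1 (j i) ∂signKernel m := by
  have hsm : StronglyMeasurable fun x : Rd d => ∏ i, x (j i) :=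
    Measurable.stronglyMeasurable (by fun_prop)
  by_cases hf : Integrable (fun x : Rd d => ∏ i, x (j i)) m.totalVariation
  · have h := integral_signKernel m _ hf
    simp only [smul_eq_mul] at h
    rw [h, momentTensor]
    have hflip : ContinuousLinearMap.lsmul ℝ ℝ =
        (ContinuousLinearMap.lsmul ℝ ℝ : ℝ →L[ℝ] ℝ →L[ℝ] ℝ).flip := by
      ext; simp
    rw [SignedMeasure.totalVariation, integrable_add_measure] at hf
    conv_lhs => rw [← m.toSignedMeasure_toJordanDecomposition, JordanDecomposition.toSignedMeasure]
    rw [VectorMeasure.integral_sub_vectorMeasure]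
    · rw [hflip, VectorMeasure.integral_toSignedMeasure, VectorMeasure.integral_toSignedMeasure]
    · rw [VectorMeasure.Integrable, Measure.variation_toSignedMeasure]; exact hf.1
    · rw [VectorMeasure.Integrable, Measure.variation_toSignedMeasure]; exact hf.2
  · rw [momentTensor, VectorMeasure.integral_undef, integral_undef]
    · rwa [← integrable_signKernel_iff m hsm] at hf
    · rwa [VectorMeasure.Integrable, ← SignedMeasure.totalVariation_eq_variation]

end SignedKernel

/-! ### Counting measures and a measurable enumeration of their atoms. -/

section CountingMeasures

variable {d : ℕ}

/-- Measures with values in `ℕ` on the bounded Borel sets. -/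
abbrev CountingMeasure (d : ℕ) : Type :=
  {ν : Measure (Rd d) // ∀ B : Set (Rd d), Bornology.IsBounded B → MeasurableSet B →
    ∃ n : ℕ, ν B = n}

theorem CountingMeasure.finiteOnBounded (ν : CountingMeasure d) : FiniteOnBounded ν.1 := by
  intro B hB
  obtain ⟨r, hr⟩ := hB.subset_ball 0
  obtain ⟨n, hn⟩ := ν.2 (Metric.ball 0 r) Metric.isBounded_ball Metric.isOpen_ball.measurableSet
  exact (measure_mono hr).trans_lt (by simp [hn])

/-- The tautological kernel from counting measures. -/
noncomputable def countingKernel : Kernel (CountingMeasure d) (Rd d) where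
  toFun ν := ν.1
  measurable' := measurable_subtype_coe

@[simp] theorem countingKernel_apply (ν : CountingMeasure d) : countingKernel ν = ν.1 := rfl

instance : IsSFiniteKernel (countingKernel (d := d)) :=
  isSFiniteKernel_of_finite_cover _ (fun n => Metric.ball 0 n)
    (fun _ => Metric.isOpen_ball.measurableSet) (Metric.iUnion_ball_nat 0)
    (fun ν _ => ν.finiteOnBounded _ Metric.isBounded_ball)

instance (ν : CountingMeasure d) : SFinite ν.1 :=
  inferInstanceAs (SFinite (countingKernel ν))

theorem measurable_atom_mass {X : CountingMeasure d → Rd d} (hX : Measurable X) :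
    Measurable fun ν : CountingMeasure d => ν.1 {X ν} := by
  have hs : MeasurableSet {q : CountingMeasure d × Rd d | q.2 = X q.1} :=
    measurableSet_eq_fun measurable_snd (hX.comp measurable_fst)
  exact Kernel.measurable_kernel_prodMk_left (κ := countingKernel) hs

theorem measurable_mass_at : Measurable fun q : CountingMeasure d × Rd d => q.1.1 {q.2} := by
  have hs : MeasurableSet {q : (CountingMeasure d × Rd d) × Rd d | q.2 = q.1.2} :=
    measurableSet_eq_fun measurable_snd (measurable_snd.comp measurable_fst)
  exact Kernel.measurable_kernel_prodMk_left
    (κ := countingKernel.comap (Prod.fst : CountingMeasure d × Rd d → _) measurable_fst) hs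

/-- The points of a counting measure are isolated. -/
theorem CountingMeasure.exists_isolating_ball (ν : CountingMeasure d) (x : Rd d) :
    ∃ r > 0, ν.1 (Metric.ball x r \ {x}) = 0 := by
  -- The punctured balls decrease to the empty set, so their masses tend to zero. Being integers,
  -- the masses eventually vanish.
  have h : Tendsto (fun n : ℕ => ν.1 (Metric.ball x (1 / ((n : ℝ) + 1)) \ {x})) atTop (𝓝 0) := by
    have h1 : ⋂ n : ℕ, (Metric.ball x (1 / ((n : ℝ) + 1)) \ {x}) = ∅ := by
      ext y
      simp only [Set.mem_iInter, Set.mem_sdiff, Metric.mem_ball, Set.mem_singleton_iff,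
        Set.mem_empty_iff_false, iff_false, not_forall]
      by_cases hy : y = x
      · exact ⟨0, fun h => h.2 hy⟩
      · obtain ⟨n, hn⟩ := exists_nat_one_div_lt (dist_pos.2 hy)
        exact ⟨n, fun h => absurd h.1 (not_lt.2 hn.le)⟩
    have h2 := tendsto_measure_iInter_atTop (μ := ν.1)
      (s := fun n : ℕ => Metric.ball x (1 / ((n : ℝ) + 1)) \ {x})
      (fun n => (Metric.isOpen_ball.measurableSet.diff
        (measurableSet_singleton x)).nullMeasurableSet)
      (fun a b hab => Set.sdiff_subset_sdiff_left (Metric.ball_subset_ball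
        (one_div_le_one_div_of_le (by positivity) (by gcongr))))
      ⟨0, (ν.finiteOnBounded _ (Metric.isBounded_ball.subset Set.sdiff_subset)).ne⟩
    rwa [h1, measure_empty] at h2
  obtain ⟨n, hn⟩ := (h.eventually (gt_mem_nhds zero_lt_one)).exists
  refine ⟨1 / ((n : ℝ) + 1), by positivity, ?_⟩
  obtain ⟨k, hk⟩ := ν.2 (Metric.ball x (1 / ((n : ℝ) + 1)) \ {x})
    (Metric.isBounded_ball.subset Set.sdiff_subset)
    (Metric.isOpen_ball.measurableSet.diff (measurableSet_singleton x))
  rw [hk] at hn ⊢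
  have : k < 1 := by exact_mod_cast hn
  simp [Nat.lt_one_iff.1 this]

/-- A measurable enumeration of the points of the counting measures: `X n ν` is a point of `ν`
for `ν ∈ V n`, and each point of `ν` is listed exactly once. -/
structure IsEnumeration (X : ℕ → CountingMeasure d → Rd d) (V : ℕ → Set (CountingMeasure d)) :
    Prop where
  measurable : ∀ n, Measurable (X n)
  measurableSet : ∀ n, MeasurableSet (V n)
  atom : ∀ n, ∀ ν ∈ V n, ν.1 {X n ν} ≠ 0
  inj : ∀ n m ν, ν ∈ V n → ν ∈ V m → X n ν = X m ν → n = m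
  surj : ∀ (ν : CountingMeasure d) (x : Rd d), ν.1 {x} ≠ 0 → ∃ n, ν ∈ V n ∧ X n ν = x

/-- The barycenter of a counting measure on a set. -/
noncomputable def barycenter (U : Set (Rd d)) (ν : CountingMeasure d) : Rd d :=
  (ν.1.real U)⁻¹ • ∫ x in U, x ∂ν.1

theorem measurable_barycenter {U : Set (Rd d)} (hU : MeasurableSet U) :
    Measurable (barycenter (d := d) U) := by
  have h1 : Measurable fun ν : CountingMeasure d => (ν.1.real U)⁻¹ :=
    ((Measure.measurable_coe hU).comp measurable_subtype_coe).ennreal_toReal.inv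
  have h2 : StronglyMeasurable fun ν : CountingMeasure d => ∫ x, x ∂(countingKernel.restrict hU) ν :=
    StronglyMeasurable.integral_kernel (f := fun x : Rd d => x) stronglyMeasurable_id
  refine h1.smul ?_
  simpa [Kernel.restrict_apply] using h2.measurable

/-- The barycenter serves as a measurable selection: it is defined and measurable for every `ν`, and
returns the atom whenever `U` isolates one. -/
theorem barycenter_eq {U : Set (Rd d)} (ν : CountingMeasure d)
    {x : Rd d} (hx : x ∈ U) (h : ν.1 (U \ {x}) = 0) (hU : ν.1 U ≠ ∞) (h0 : ν.1 {x} ≠ 0) :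
    barycenter U ν = x := by
  have e : ν.1.restrict U = ν.1.restrict {x} := by
    refine Measure.restrict_congr_set ?_
    refine ((ae_eq_set (s := U) (t := {x})).2 ⟨h, ?_⟩)
    rw [Set.sdiff_eq_empty.2 (Set.singleton_subset_iff.2 hx), measure_empty]
  have e2 : ν.1 U = ν.1 {x} := by
    have := congrArg (fun m : Measure (Rd d) => m Set.univ) e
    simpa using this
  rw [barycenter, e, integral_singleton, measureReal_def, measureReal_def, e2, smul_smul,
    inv_mul_cancel₀, one_smul]
  rw [e2] at hU
  exact ENNReal.toReal_ne_zero.2 ⟨h0, hU⟩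

/-- Every atom is isolated by a ball from a fixed countable family (centres in a dense sequence,
radii `1/(k+1)`), so it occurs among the barycenters over these balls. `V n` retains the `n`-th
candidate only when it is an atom and differs from all earlier candidates, which removes
repetitions. -/
theorem exists_isEnumeration : ∃ X V, IsEnumeration (d := d) X V := by
  classical
  set U : ℕ → Set (Rd d) := fun n =>
    Metric.ball (TopologicalSpace.denseSeq (Rd d) n.unpair.1) (1 / ((n.unpair.2 : ℝ) + 1)) with hU
  have hUm : ∀ n, MeasurableSet (U n) := fun n => Metric.isOpen_ball.measurableSet
  set X : ℕ → CountingMeasure d → Rd d := fun n => barycenter (U n) with hX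
  have hXm : ∀ n, Measurable (X n) := fun n => measurable_barycenter (hUm n)
  refine ⟨X, fun n => {ν | ν.1 {X n ν} ≠ 0} ∩ ⋂ m ∈ Finset.range n, {ν | X m ν ≠ X n ν}, hXm,
    fun n => ?_, fun n ν hν => hν.1, ?_, ?_⟩
  · refine MeasurableSet.inter ?_ ?_
    · exact (measurable_atom_mass (hXm n) (measurableSet_singleton 0)).compl
    · exact Finset.measurableSet_biInter _ fun m _ =>
        (measurableSet_eq_fun (hXm m) (hXm n)).compl
  · have aux : ∀ n m (ν : CountingMeasure d), n < m → X n ν = X m ν →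
        ν ∉ {ν : CountingMeasure d | ν.1 {X m ν} ≠ 0} ∩
          ⋂ k ∈ Finset.range m, {ν | X k ν ≠ X m ν} := by
      intro n m ν hnm he hν
      exact (Set.mem_iInter₂.1 hν.2 n (Finset.mem_range.2 hnm)) he
    intro n m ν hn hm he
    rcases lt_trichotomy n m with h | h | h
    · exact absurd hm (aux n m ν h he)
    · exact h
    · exact absurd hn (aux m n ν h he.symm)
  · intro ν x hx
    have hex : ∃ n, X n ν = x := by
      obtain ⟨r, hr, h0⟩ := ν.exists_isolating_ball x
      obtain ⟨k, hk⟩ := exists_nat_one_div_lt (half_pos hr)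
      obtain ⟨i, hi⟩ := Metric.denseRange_iff.1 (TopologicalSpace.denseRange_denseSeq (Rd d)) x
        (1 / ((k : ℝ) + 1)) (by positivity)
      refine ⟨Nat.pair i k, ?_⟩
      have hUe : U (Nat.pair i k) =
          Metric.ball (TopologicalSpace.denseSeq (Rd d) i) (1 / ((k : ℝ) + 1)) := by
        simp [hU]
      refine barycenter_eq ν ?_ ?_ ?_ hx
      · rw [hUe]; exact hi
      · refine measure_mono_null (Set.sdiff_subset_sdiff_left ?_) h0
        rw [hUe]
        intro y hy
        rw [Metric.mem_ball] at hy ⊢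
        calc dist y x ≤ dist y (TopologicalSpace.denseSeq (Rd d) i) +
              dist x (TopologicalSpace.denseSeq (Rd d) i) := dist_triangle_right _ _ _
          _ < r := by linarith
      · exact (ν.finiteOnBounded _ Metric.isBounded_ball).ne
    -- The first index at which `x` appears passes the test of having no equal predecessor.
    refine ⟨Nat.find hex, ⟨?_, ?_⟩, Nat.find_spec hex⟩
    · rw [Set.mem_ofPred_eq, Nat.find_spec hex]; exact hx
    · refine Set.mem_iInter₂.2 fun m hm he => ?_
      exact Nat.find_min hex (Finset.mem_range.1 hm) (he.trans (Nat.find_spec hex))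

open Classical in
/-- A counting measure is the sum of its atoms. -/
theorem IsEnumeration.eq_sum {X : ℕ → CountingMeasure d → Rd d} {V : ℕ → Set (CountingMeasure d)}
    (h : IsEnumeration X V) (ν : CountingMeasure d) :
    ν.1 = Measure.sum fun n => (if ν ∈ V n then ν.1 {X n ν} else 0) • Measure.dirac (X n ν) := by
  set A : Set (Rd d) := {x | ν.1 {x} ≠ 0} with hA
  set I : Set ℕ := {n | ν ∈ V n} with hI
  have hAI : A = ⋃ n ∈ I, {X n ν} := by
    ext x
    simp only [hA, hI, Set.mem_ofPred_eq, Set.mem_iUnion, Set.mem_singleton_iff, exists_prop]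
    constructor
    · intro hx
      obtain ⟨n, hn, e⟩ := h.surj ν x hx
      exact ⟨n, hn, e.symm⟩
    · rintro ⟨n, hn, rfl⟩
      exact h.atom n ν hn
  have hAm : MeasurableSet A := by
    rw [hAI]
    exact MeasurableSet.biUnion (Set.to_countable _) fun n _ => measurableSet_singleton _
  -- A point that is not an atom has a null neighbourhood, namely its isolating ball. In a second
  -- countable space, a locally null set is null.
  have hnull : ν.1 Aᶜ = 0 := by
    refine measure_null_of_locally_null _ fun x hx => ?_
    obtain ⟨r, hr, h0⟩ := ν.exists_isolating_ball x
    refine ⟨Metric.ball x r, mem_nhdsWithin_of_mem_nhds (Metric.ball_mem_nhds x hr), ?_⟩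
    have hx0 : ν.1 {x} = 0 := by simpa [hA] using hx
    refine measure_mono_null (t := Metric.ball x r \ {x} ∪ {x}) (fun y hy => ?_)
      (measure_union_null h0 hx0)
    by_cases hyx : y = x
    · exact Or.inr hyx
    · exact Or.inl ⟨hy, hyx⟩
  ext B hB
  rw [Measure.sum_apply _ hB]
  have e1 : ν.1 B = ν.1 (⋃ n ∈ I, ({X n ν} ∩ B)) := by
    have h0 : ν.1 (B \ A) = 0 := measure_mono_null (fun x hx => hx.2) hnull
    rw [← Set.iUnion₂_inter, ← hAI, Set.inter_comm, ← measure_inter_add_sdiff B hAm, h0, add_zero]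
  rw [e1, measure_biUnion (Set.to_countable _) _
    (fun n _ => (measurableSet_singleton _).inter hB)]
  · rw [tsum_subtype I (fun n => ν.1 ({X n ν} ∩ B))]
    refine tsum_congr fun n => ?_
    by_cases hn : ν ∈ V n
    · rw [Set.indicator_of_mem (show n ∈ I from hn), if_pos hn, Measure.smul_apply, smul_eq_mul,
        Measure.dirac_apply' _ hB]
      by_cases hx : X n ν ∈ B
      · rw [Set.inter_eq_left.2 (Set.singleton_subset_iff.2 hx)]
        simp [hx]
      · rw [Set.singleton_inter_eq_empty.2 hx]
        simp [hx]
    · rw [Set.indicator_of_notMem (show n ∉ I from hn), if_neg hn]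
      simp
  · intro n hn m hm hnm
    refine Set.disjoint_left.2 fun x hx hx' => hnm (h.inj n m ν hn hm ?_)
    exact (Set.mem_singleton_iff.1 hx.1).symm.trans (Set.mem_singleton_iff.1 hx'.1)

/-- The weight of the `n`-th point of a counting measure. -/
noncomputable def weight (X : ℕ → CountingMeasure d → Rd d) (V : ℕ → Set (CountingMeasure d))
    (n : ℕ) (ν : CountingMeasure d) : ℝ≥0∞ :=
  (V n).indicator (fun ν => ν.1 {X n ν}) ν

theorem IsEnumeration.measurable_weight {X : ℕ → CountingMeasure d → Rd d}
    {V : ℕ → Set (CountingMeasure d)} (h : IsEnumeration X V) (n : ℕ) :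
    Measurable (weight X V n) :=
  (measurable_atom_mass (h.measurable n)).indicator (h.measurableSet n)

theorem IsEnumeration.eq_sum_weight {X : ℕ → CountingMeasure d → Rd d}
    {V : ℕ → Set (CountingMeasure d)} (h : IsEnumeration X V) (ν : CountingMeasure d) :
    ν.1 = Measure.sum fun n => weight X V n ν • Measure.dirac (X n ν) := by
  classical
  conv_lhs => rw [h.eq_sum ν]
  congr 1

theorem IsEnumeration.lintegral {X : ℕ → CountingMeasure d → Rd d}
    {V : ℕ → Set (CountingMeasure d)} (h : IsEnumeration X V) (ν : CountingMeasure d)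
    (f : Rd d → ℝ≥0∞) (hf : Measurable f) :
    ∫⁻ x, f x ∂ν.1 = ∑' n, weight X V n ν * f (X n ν) := by
  conv_lhs => rw [h.eq_sum_weight ν]
  rw [lintegral_sum_measure]
  refine tsum_congr fun n => ?_
  rw [lintegral_smul_measure, lintegral_dirac' _ hf, smul_eq_mul]

/-- Translation of a counting measure. -/
noncomputable def CountingMeasure.shift (z : Rd d) (ν : CountingMeasure d) : CountingMeasure d :=
  ⟨ν.1.map fun x => x + z, fun B hB hBm => by
    have hm : Measurable fun x : Rd d => x + z := measurable_add_const z
    rw [Measure.map_apply hm hBm]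
    refine ν.2 _ ?_ (hm hBm)
    have : (fun x => x + z) ⁻¹' B = (fun x => x - z) '' B := by
      ext x
      constructor
      · intro hx; exact ⟨x + z, hx, by simp⟩
      · rintro ⟨y, hy, rfl⟩; simpa using hy
    rw [this]
    exact (IsometryEquiv.subRight z).isometry.lipschitz.isBounded_image hB⟩

theorem CountingMeasure.shift_val (z : Rd d) (ν : CountingMeasure d) :
    (ν.shift z).1 = ν.1.map fun x => x + z := rfl

theorem CountingMeasure.measurable_shift (z : Rd d) :
    Measurable (CountingMeasure.shift (d := d) z) :=
  ((Measure.measurable_map _ (measurable_add_const z)).comp measurable_subtype_coe).subtype_mk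

theorem CountingMeasure.shift_singleton (z x : Rd d) (ν : CountingMeasure d) :
    (ν.shift z).1 {x} = ν.1 {x - z} := by
  rw [shift_val, Measure.map_apply (measurable_add_const z) (measurableSet_singleton x)]
  congr 1
  ext y
  simp only [Set.mem_preimage, Set.mem_singleton_iff, eq_sub_iff_add_eq]

/-- The enumeration obtained by enumerating the translated counting measure. -/
theorem IsEnumeration.shift {X : ℕ → CountingMeasure d → Rd d}
    {V : ℕ → Set (CountingMeasure d)} (h : IsEnumeration X V) (z : Rd d) :
    IsEnumeration (fun n ν => X n (ν.shift z) - z) (fun n => CountingMeasure.shift z ⁻¹' V n) where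
  measurable n := ((h.measurable n).comp (CountingMeasure.measurable_shift z)).sub_const z
  measurableSet n := CountingMeasure.measurable_shift z (h.measurableSet n)
  atom n ν hν := by
    rw [← CountingMeasure.shift_singleton]
    exact h.atom n _ hν
  inj n m ν hn hm he := h.inj n m _ hn hm (sub_left_injective he)
  surj ν x hx := by
    obtain ⟨n, hn, e⟩ := h.surj (ν.shift z) (x + z)
      (by rwa [CountingMeasure.shift_singleton, add_sub_cancel_right])
    exact ⟨n, hn, by simp [e]⟩

end CountingMeasures

/-! ### Independent marks and the Campbell formulas. -/

section IndependentMarks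

variable {d : ℕ} {Ω : Type*} [MeasurableSpace Ω]

/-- A point process as a random element of the space of counting measures. -/
def countingProcess {Φ : Ω → Measure (Rd d)} (hΦ : IsPointProcess Φ) (ω : Ω) : CountingMeasure d :=
  ⟨Φ ω, hΦ.2 ω⟩

theorem measurable_countingProcess {Φ : Ω → Measure (Rd d)} (hΦ : IsPointProcess Φ) :
    Measurable (countingProcess hΦ) :=
  hΦ.1.subtype_mk

theorem comap_countingProcess {Φ : Ω → Measure (Rd d)} (hΦ : IsPointProcess Φ) :
    MeasurableSpace.comap Φ inferInstance =
      MeasurableSpace.comap (countingProcess hΦ) inferInstance := by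
  rw [Subtype.instMeasurableSpace, MeasurableSpace.comap_comp]
  rfl

theorem measurable_relKernel {K : Ω → Rd d → SignedMeasure (Rd d)}
    (hK : Measurable (Function.uncurry K)) : Measurable (Function.uncurry (relKernel K)) := by
  refine measurable_signedMeasure_of fun B hB => ?_
  have hm : ∀ x : Rd d, Measurable fun y : Rd d => y - x := fun x => measurable_sub_const x
  have hf : Measurable fun q : (Ω × Rd d) × (Rd d × Bool) =>
      signOf q.2.2 * B.indicator (1 : Rd d → ℝ) (q.2.1 - q.1.2) := by
    have h1 : Measurable (B.indicator (1 : Rd d → ℝ)) := measurable_one.indicator hB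
    exact (measurable_signOf.comp (by fun_prop)).mul (h1.comp (by fun_prop))
  have h2 := StronglyMeasurable.integral_kernel_prod_right
    (κ := (signKernel (d := d)).comap (Function.uncurry K) hK) (f := fun a b =>
      signOf b.2 * B.indicator (1 : Rd d → ℝ) (b.1 - a.2)) hf.stronglyMeasurable
  convert h2.measurable using 1
  ext ⟨ω, x⟩
  have h3 := signedMeasure_apply_eq_integral (K ω x) ((hm x) hB)
  simp only [Function.uncurry, relKernel, VectorMeasure.map_apply _ (hm x) hB, h3,
    Kernel.comap_apply]
  rfl

/-- Replace the marks of the missing points by the zero measure. -/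
noncomputable def maskMarks {N : ℕ} (V : Fin N → Set (CountingMeasure d))
    (q : CountingMeasure d × (Fin N → SignedMeasure (Rd d))) :
    CountingMeasure d × (Fin N → SignedMeasure (Rd d)) :=
  (q.1, fun n => (V n).indicator (fun _ => q.2 n) q.1)

theorem measurable_maskMarks {N : ℕ} {V : Fin N → Set (CountingMeasure d)}
    (hV : ∀ n, MeasurableSet (V n)) : Measurable (maskMarks V) := by
  refine measurable_fst.prodMk (measurable_pi_lambda _ fun n => ?_)
  have : (fun q : CountingMeasure d × (Fin N → SignedMeasure (Rd d)) =>
      (V n).indicator (fun _ => q.2 n) q.1) = (Prod.fst ⁻¹' V n).indicator (fun q => (Prod.snd q) n) := by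
    ext1 q
    by_cases h : q.1 ∈ V n
    · rw [Set.indicator_of_mem h, Set.indicator_of_mem (show q ∈ Prod.fst ⁻¹' V n from h)]
    · rw [Set.indicator_of_notMem h, Set.indicator_of_notMem (show q ∉ Prod.fst ⁻¹' V n from h)]
  rw [this]
  exact ((measurable_pi_apply n).comp measurable_snd).indicator (measurable_fst (hV n))

theorem ext_of_rectangles {α : Type*} [MeasurableSpace α] {ι : Type*} [Fintype ι] {β : Type*}
    [MeasurableSpace β] {m₁ m₂ : Measure (α × (ι → β))} [IsFiniteMeasure m₁]
    (h : ∀ (T : Set α) (A : ι → Set β), MeasurableSet T → (∀ i, MeasurableSet (A i)) →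
      m₁ (T ×ˢ Set.univ.pi A) = m₂ (T ×ˢ Set.univ.pi A)) : m₁ = m₂ := by
  refine ext_of_generate_finite (Set.image2 (· ×ˢ ·) {T : Set α | MeasurableSet T}
    (Set.univ.pi '' Set.univ.pi fun _ : ι => {A : Set β | MeasurableSet A})) ?_ ?_ ?_ ?_
  · refine (generateFrom_eq_prod MeasurableSpace.generateFrom_measurableSet generateFrom_pi
      isCountablySpanning_measurableSet ?_).symm
    exact IsCountablySpanning.pi fun _ => isCountablySpanning_measurableSet
  · exact MeasurableSpace.isPiSystem_measurableSet.prod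
      (isPiSystem_pi)
  · rintro _ ⟨T, hT, _, ⟨A, hA, rfl⟩, rfl⟩
    exact h T A hT fun i => hA i (Set.mem_univ i)
  · have := h Set.univ (fun _ => Set.univ) MeasurableSet.univ fun _ => MeasurableSet.univ
    simpa using this

theorem measure_eq_tsum_inter_preimage {α γ ι : Type*} [MeasurableSpace α] [MeasurableSpace γ]
    [Countable ι] {S : ι → Set α} (m : Measure γ) {g : γ → α} {E : Set γ} (hg : Measurable g)
    (hE : MeasurableSet E) (hSm : ∀ W, MeasurableSet (S W)) (hScov : ⋃ W, S W = Set.univ)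
    (hSdisj : Pairwise fun W W' => Disjoint (S W) (S W')) :
    m E = ∑' W, m (E ∩ g ⁻¹' S W) := by
  rw [← measure_iUnion (fun W W' hne => ((hSdisj hne).preimage g).mono Set.inter_subset_right
      Set.inter_subset_right) fun W => hE.inter (hg (hSm W)), ← Set.inter_iUnion,
    ← Set.preimage_iUnion, hScov, Set.preimage_univ, Set.inter_univ]

open Classical in
/-- The joint law of a point process and of the marks of finitely many of its points. -/
theorem HasIndependentClusters.map_maskMarks {P : Measure Ω} [IsProbabilityMeasure P]
    {Φ : Ω → Measure (Rd d)} (hΦ : IsPointProcess Φ)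
    {K : Ω → Rd d → SignedMeasure (Rd d)} (hK : Measurable (Function.uncurry K))
    {L : Measure (SignedMeasure (Rd d))} [IsProbabilityMeasure L]
    (h : HasIndependentClusters P Φ K L) {N : ℕ} {X : Fin N → CountingMeasure d → Rd d}
    {V : Fin N → Set (CountingMeasure d)} (hX : ∀ n, Measurable (X n))
    (hV : ∀ n, MeasurableSet (V n)) (hatom : ∀ n, ∀ ν ∈ V n, ν.1 {X n ν} ≠ 0)
    (hinj : ∀ n m ν, ν ∈ V n → ν ∈ V m → X n ν = X m ν → n = m) :
    P.map (fun ω => maskMarks V (countingProcess hΦ ω,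
        fun n => relKernel K ω (X n (countingProcess hΦ ω)))) =
      ((P.map (countingProcess hΦ)).prod (Measure.pi fun _ => L)).map (maskMarks V) := by
  set F := countingProcess hΦ with hF
  have hFm : Measurable F := measurable_countingProcess hΦ
  have hrel := measurable_relKernel hK
  have hmarks : Measurable fun ω => (F ω, fun n => relKernel K ω (X n (F ω))) :=
    hFm.prodMk (measurable_pi_lambda _ fun n =>
      hrel.comp (measurable_id.prodMk ((hX n).comp hFm)))
  have hmask := measurable_maskMarks hV
  have : IsProbabilityMeasure (P.map F) := Measure.isProbabilityMeasure_map hFm.aemeasurable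
  have : IsProbabilityMeasure (P.map fun ω =>
      maskMarks V (F ω, fun n => relKernel K ω (X n (F ω)))) :=
    Measure.isProbabilityMeasure_map (hmask.comp hmarks).aemeasurable
  refine ext_of_rectangles fun T A hT hA => ?_
  have hR : MeasurableSet (T ×ˢ Set.univ.pi A) := hT.prod (MeasurableSet.univ_pi hA)
  have hmm : Measurable fun ω => maskMarks V (F ω, fun n => relKernel K ω (X n (F ω))) :=
    hmask.comp hmarks
  rw [Measure.map_apply hmm hR, Measure.map_apply hmask hR]
  -- `HasIndependentClusters` controls only the marks at actual, distinct points. The space is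
  -- therefore split according to the set `W` of listed points that are present, and the hypothesis
  -- is applied on each piece to these points.
  set S : Finset (Fin N) → Set (CountingMeasure d) := fun W => {ν | ∀ n, ν ∈ V n ↔ n ∈ W} with hS
  have hSm : ∀ W, MeasurableSet (S W) := fun W => by
    have : S W = ⋂ n, {ν | ν ∈ V n ↔ n ∈ W} := by
      ext ν; simp [hS]
    rw [this]
    refine MeasurableSet.iInter fun n => ?_
    by_cases hn : n ∈ W
    · simpa [hn] using hV n
    · have e : {ν | ν ∈ V n ↔ n ∈ W} = (V n)ᶜ := by ext ν; simp [hn]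
      rw [e]
      exact (hV n).compl
  have hScov : ⋃ W, S W = Set.univ := by
    refine Set.eq_univ_of_forall fun ν => Set.mem_iUnion.2
      ⟨Finset.univ.filter fun n => ν ∈ V n, fun n => ?_⟩
    simp
  have hSdisj : Pairwise fun W W' => Disjoint (S W) (S W') := fun W W' hne => by
    refine Set.disjoint_left.2 fun ν h1 h2 => hne ?_
    ext n
    rw [← h1 n, ← h2 n]
  rw [measure_eq_tsum_inter_preimage P hFm (hmm hR) hSm hScov hSdisj,
    measure_eq_tsum_inter_preimage _ measurable_fst (hmask hR) hSm hScov hSdisj]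
  refine tsum_congr fun W => ?_
  -- A missing point has the masked mark `0`. Either `A n` contains `0` for all missing points and
  -- these conditions disappear, or the event is empty on both sides.
  by_cases hW : ∀ n, n ∉ W → (0 : SignedMeasure (Rd d)) ∈ A n
  · have hmem : ∀ (ν : CountingMeasure d) (k : Fin N → SignedMeasure (Rd d)), ν ∈ S W →
        ((∀ n, (V n).indicator (fun _ => k n) ν ∈ A n) ↔ ∀ n ∈ W, k n ∈ A n) := by
      intro ν k hν
      refine forall_congr' fun n => ?_
      by_cases hn : n ∈ W
      · rw [Set.indicator_of_mem ((hν n).2 hn)]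
        simp [hn]
      · rw [Set.indicator_of_notMem (fun h => hn ((hν n).1 h))]
        simp [hn, hW n hn]
    set e := W.equivFin.symm with he
    have h1 := h W.card (fun i ω => X (e i) (F ω)) (F ⁻¹' (T ∩ S W)) (fun i => A (e i))
      (fun i => by
        rw [comap_countingProcess hΦ]
        exact (hX _).comp (comap_measurable _))
      (by
        rw [comap_countingProcess hΦ]
        exact ⟨_, hT.inter (hSm W), rfl⟩)
      (fun ω hω => ⟨fun i => hatom _ _ ((hω.2 _).2 (e i).2), fun i j hij => e.injective
        (Subtype.ext (hinj _ _ _ ((hω.2 _).2 (e i).2) ((hω.2 _).2 (e j).2) hij))⟩)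
      (fun i => hA _)
    have e1 : (fun ω => maskMarks V (F ω, fun n => relKernel K ω (X n (F ω)))) ⁻¹'
        (T ×ˢ Set.univ.pi A) ∩ F ⁻¹' S W =
        F ⁻¹' (T ∩ S W) ∩ {ω | ∀ i, relKernel K ω (X (e i) (F ω)) ∈ A (e i)} := by
      ext ω
      simp only [Set.mem_inter_iff, Set.mem_preimage, maskMarks, Set.mem_prod, Set.mem_univ_pi,
        Set.mem_ofPred_eq]
      constructor
      · rintro ⟨⟨h1, h2⟩, h3⟩
        rw [hmem _ (fun n => relKernel K ω (X n (F ω))) h3] at h2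
        exact ⟨⟨h1, h3⟩, fun i => h2 _ (e i).2⟩
      · rintro ⟨⟨h1, h3⟩, h2⟩
        refine ⟨⟨h1, ?_⟩, h3⟩
        rw [hmem _ (fun n => relKernel K ω (X n (F ω))) h3]
        intro n hn
        have := h2 (e.symm ⟨n, hn⟩)
        simpa using this
    have e2 : maskMarks V ⁻¹' (T ×ˢ Set.univ.pi A) ∩ Prod.fst ⁻¹' S W =
        (T ∩ S W) ×ˢ Set.univ.pi (fun n => if n ∈ W then A n else Set.univ) := by
      ext q
      simp only [Set.mem_inter_iff, Set.mem_preimage, maskMarks, Set.mem_prod, Set.mem_univ_pi]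
      constructor
      · rintro ⟨⟨h1, h2⟩, h3⟩
        rw [hmem _ _ h3] at h2
        refine ⟨⟨h1, h3⟩, fun n => ?_⟩
        by_cases hn : n ∈ W
        · rw [if_pos hn]; exact h2 n hn
        · rw [if_neg hn]; trivial
      · rintro ⟨⟨h1, h3⟩, h2⟩
        refine ⟨⟨h1, ?_⟩, h3⟩
        rw [hmem _ _ h3]
        intro n hn
        have := h2 n
        rwa [if_pos hn] at this
    rw [e1, h1, e2, Measure.prod_prod, Measure.pi_pi, Measure.map_apply hFm (hT.inter (hSm W))]
    congr 1
    rw [e.prod_comp fun n : W => L (A n), Finset.prod_coe_sort W fun n => L (A n),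
      ← Finset.prod_subset (Finset.subset_univ W)]
    · exact Finset.prod_congr rfl fun n hn => by rw [if_pos hn]
    · intro n _ hn
      rw [if_neg hn, measure_univ]
  · push Not at hW
    obtain ⟨n, hn, hn0⟩ := hW
    have hmem : ∀ (ν : CountingMeasure d) (k : Fin N → SignedMeasure (Rd d)), ν ∈ S W →
        ¬ ∀ n, (V n).indicator (fun _ => k n) ν ∈ A n := by
      intro ν k hν hall
      have := hall n
      rw [Set.indicator_of_notMem (fun h => hn ((hν n).1 h))] at this
      exact hn0 this
    have e1 : (fun ω => maskMarks V (F ω, fun n => relKernel K ω (X n (F ω)))) ⁻¹'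
        (T ×ˢ Set.univ.pi A) ∩ F ⁻¹' S W = ∅ := by
      refine Set.eq_empty_of_forall_notMem fun ω hω => ?_
      refine hmem (F ω) (fun n => relKernel K ω (X n (F ω))) hω.2 fun n => ?_
      exact hω.1.2 n (Set.mem_univ n)
    have e2 : maskMarks V ⁻¹' (T ×ˢ Set.univ.pi A) ∩ Prod.fst ⁻¹' S W = ∅ := by
      refine Set.eq_empty_of_forall_notMem fun q hq => ?_
      exact hmem q.1 q.2 hq.2 fun n => hq.1.2 n (Set.mem_univ n)
    rw [e1, e2, measure_empty, measure_empty]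

/-- Expectations of functionals of a point process and of the marks of finitely many points. -/
theorem HasIndependentClusters.lintegral_marks {P : Measure Ω} [IsProbabilityMeasure P]
    {Φ : Ω → Measure (Rd d)} (hΦ : IsPointProcess Φ)
    {K : Ω → Rd d → SignedMeasure (Rd d)} (hK : Measurable (Function.uncurry K))
    {L : Measure (SignedMeasure (Rd d))} [IsProbabilityMeasure L]
    (h : HasIndependentClusters P Φ K L) {N : ℕ} {X : Fin N → CountingMeasure d → Rd d}
    {V : Fin N → Set (CountingMeasure d)} (hX : ∀ n, Measurable (X n))
    (hV : ∀ n, MeasurableSet (V n)) (hatom : ∀ n, ∀ ν ∈ V n, ν.1 {X n ν} ≠ 0)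
    (hinj : ∀ n m ν, ν ∈ V n → ν ∈ V m → X n ν = X m ν → n = m)
    {f : CountingMeasure d × (Fin N → SignedMeasure (Rd d)) → ℝ≥0∞} (hf : Measurable f)
    (hmask : ∀ q, f (maskMarks V q) = f q) :
    ∫⁻ ω, f (countingProcess hΦ ω, fun n => relKernel K ω (X n (countingProcess hΦ ω))) ∂P =
      ∫⁻ ν, ∫⁻ k, f (ν, k) ∂(Measure.pi fun _ => L) ∂(P.map (countingProcess hΦ)) := by
  have hFm := measurable_countingProcess hΦ
  have hmarks : Measurable fun ω => (countingProcess hΦ ω,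
      fun n => relKernel K ω (X n (countingProcess hΦ ω))) :=
    hFm.prodMk (measurable_pi_lambda _ fun n =>
      (measurable_relKernel hK).comp (measurable_id.prodMk ((hX n).comp hFm)))
  have hmm := measurable_maskMarks hV
  have : IsProbabilityMeasure (P.map (countingProcess hΦ)) :=
    Measure.isProbabilityMeasure_map hFm.aemeasurable
  rw [← lintegral_prod _ hf.aemeasurable]
  have h1 : ∫⁻ ω, f (countingProcess hΦ ω,
      fun n => relKernel K ω (X n (countingProcess hΦ ω))) ∂P =
      ∫⁻ q, f q ∂(P.map fun ω => maskMarks V (countingProcess hΦ ω,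
        fun n => relKernel K ω (X n (countingProcess hΦ ω)))) := by
    have hc : Measurable fun ω => maskMarks V (countingProcess hΦ ω,
        fun n => relKernel K ω (X n (countingProcess hΦ ω))) := hmm.comp hmarks
    rw [lintegral_map hf hc]
    simp_rw [hmask]
  rw [h1, h.map_maskMarks hΦ hK hX hV hatom hinj, lintegral_map hf hmm]
  simp_rw [hmask]

/-- Contribution of one point to the Campbell formula. -/
theorem HasIndependentClusters.lintegral_one {P : Measure Ω} [IsProbabilityMeasure P]
    {Φ : Ω → Measure (Rd d)} (hΦ : IsPointProcess Φ)
    {K : Ω → Rd d → SignedMeasure (Rd d)} (hK : Measurable (Function.uncurry K))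
    {L : Measure (SignedMeasure (Rd d))} [IsProbabilityMeasure L]
    (h : HasIndependentClusters P Φ K L) {X : CountingMeasure d → Rd d}
    {V : Set (CountingMeasure d)} (hX : Measurable X)
    (hV : MeasurableSet V) (hatom : ∀ ν ∈ V, ν.1 {X ν} ≠ 0)
    {f : CountingMeasure d → SignedMeasure (Rd d) → ℝ≥0∞} (hf : Measurable (Function.uncurry f))
    (hzero : ∀ ν ∉ V, ∀ m, f ν m = 0) :
    ∫⁻ ω, f (countingProcess hΦ ω) (relKernel K ω (X (countingProcess hΦ ω))) ∂P =
      ∫⁻ ν, ∫⁻ m, f ν m ∂L ∂(P.map (countingProcess hΦ)) := by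
  have := h.lintegral_marks hΦ hK (N := 1) (X := fun _ => X) (V := fun _ => V) (fun _ => hX)
    (fun _ => hV) (fun _ => hatom) (fun _ _ _ _ _ _ => Subsingleton.elim _ _)
    (f := fun q => f q.1 (q.2 0)) (hf.comp (measurable_fst.prodMk
      ((measurable_pi_apply 0).comp measurable_snd))) (fun q => by
      simp only [maskMarks]
      by_cases hq : q.1 ∈ V
      · rw [Set.indicator_of_mem hq]
      · rw [hzero _ hq, hzero _ hq])
  rw [this]
  refine lintegral_congr fun ν => ?_
  exact (measurePreserving_eval (fun _ : Fin 1 => L) 0).lintegral_comp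
    (hf.comp measurable_prodMk_left)

/-- Contribution of two distinct points to the Campbell formula. -/
theorem HasIndependentClusters.lintegral_two {P : Measure Ω} [IsProbabilityMeasure P]
    {Φ : Ω → Measure (Rd d)} (hΦ : IsPointProcess Φ)
    {K : Ω → Rd d → SignedMeasure (Rd d)} (hK : Measurable (Function.uncurry K))
    {L : Measure (SignedMeasure (Rd d))} [IsProbabilityMeasure L]
    (h : HasIndependentClusters P Φ K L) {X Y : CountingMeasure d → Rd d}
    {V : Set (CountingMeasure d)} (hX : Measurable X) (hY : Measurable Y)
    (hV : MeasurableSet V) (hXatom : ∀ ν ∈ V, ν.1 {X ν} ≠ 0) (hYatom : ∀ ν ∈ V, ν.1 {Y ν} ≠ 0)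
    (hne : ∀ ν ∈ V, X ν ≠ Y ν)
    {f : CountingMeasure d → SignedMeasure (Rd d) × SignedMeasure (Rd d) → ℝ≥0∞}
    (hf : Measurable (Function.uncurry f)) (hzero : ∀ ν ∉ V, ∀ m, f ν m = 0) :
    ∫⁻ ω, f (countingProcess hΦ ω) (relKernel K ω (X (countingProcess hΦ ω)),
        relKernel K ω (Y (countingProcess hΦ ω))) ∂P =
      ∫⁻ ν, ∫⁻ m, f ν m ∂(L.prod L) ∂(P.map (countingProcess hΦ)) := by
  have hcase : ∀ {p : Fin 2 → Prop}, p 0 → p 1 → ∀ n, p n := fun h0 h1 n => by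
    fin_cases n
    · exact h0
    · exact h1
  have := h.lintegral_marks hΦ hK (N := 2) (X := ![X, Y]) (V := fun _ => V)
    (hcase hX hY) (fun _ => hV) (hcase hXatom hYatom) (by
      intro n m ν hn _ he
      fin_cases n <;> fin_cases m
      · rfl
      · exact absurd he (hne ν hn)
      · exact absurd he.symm (hne ν hn)
      · rfl)
    (f := fun q => f q.1 (q.2 0, q.2 1)) (hf.comp (measurable_fst.prodMk
      (((measurable_pi_apply 0).comp measurable_snd).prodMk
        ((measurable_pi_apply 1).comp measurable_snd)))) (fun q => by
      simp only [maskMarks]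
      by_cases hq : q.1 ∈ V
      · rw [Set.indicator_of_mem hq, Set.indicator_of_mem hq]
      · rw [hzero _ hq, hzero _ hq])
  simp only [Matrix.cons_val_zero, Matrix.cons_val_one] at this
  rw [this]
  refine lintegral_congr fun ν => ?_
  exact (measurePreserving_piFinTwo (fun _ : Fin 2 => L)).lintegral_comp
    (hf.comp measurable_prodMk_left)

/-- First-order Campbell formula for a point process with independent marks. -/
theorem HasIndependentClusters.campbell {P : Measure Ω} [IsProbabilityMeasure P]
    {Φ : Ω → Measure (Rd d)} (hΦ : IsPointProcess Φ)
    {K : Ω → Rd d → SignedMeasure (Rd d)} (hK : Measurable (Function.uncurry K))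
    {L : Measure (SignedMeasure (Rd d))} [IsProbabilityMeasure L]
    (h : HasIndependentClusters P Φ K L) {g : Rd d → SignedMeasure (Rd d) → ℝ≥0∞}
    (hg : Measurable (Function.uncurry g)) :
    ∫⁻ ω, ∫⁻ u, g u (relKernel K ω u) ∂Φ ω ∂P =
      ∫⁻ ν, ∫⁻ u, ∫⁻ m, g u m ∂L ∂ν.1 ∂(P.map (countingProcess hΦ)) := by
  obtain ⟨X, V, hXV⟩ := exists_isEnumeration (d := d)
  have hFm := measurable_countingProcess hΦ
  have hrel := measurable_relKernel hK
  have h1 : ∀ ω, ∫⁻ u, g u (relKernel K ω u) ∂Φ ω = ∑' n, weight X V n (countingProcess hΦ ω) *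
      g (X n (countingProcess hΦ ω)) (relKernel K ω (X n (countingProcess hΦ ω))) := fun ω =>
    hXV.lintegral (countingProcess hΦ ω) (fun u => g u (relKernel K ω u))
      (hg.comp (measurable_id.prodMk (hrel.comp measurable_prodMk_left)))
  have h2 : ∀ ν : CountingMeasure d, ∫⁻ u, ∫⁻ m, g u m ∂L ∂ν.1 =
      ∑' n, weight X V n ν * ∫⁻ m, g (X n ν) m ∂L := fun ν =>
    hXV.lintegral ν _ hg.lintegral_prod_right'
  have hgX : ∀ n, Measurable (Function.uncurry fun (ν : CountingMeasure d) m =>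
      weight X V n ν * g (X n ν) m) := fun n => by
    refine ((hXV.measurable_weight n).comp measurable_fst).mul
      (hg.comp (((hXV.measurable n).comp measurable_fst).prodMk measurable_snd))
  simp_rw [h1, h2]
  rw [lintegral_tsum, lintegral_tsum]
  · refine tsum_congr fun n => ?_
    have := h.lintegral_one hΦ hK (hXV.measurable n) (hXV.measurableSet n) (hXV.atom n)
      (f := fun ν m => weight X V n ν * g (X n ν) m) (hgX n) (fun ν hν m => by
        rw [weight, Set.indicator_of_notMem hν, zero_mul])
    rw [this]
    refine lintegral_congr fun ν => ?_
    have hm : Measurable fun m => g (X n ν) m := hg.comp measurable_prodMk_left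
    rw [lintegral_const_mul _ hm]
  · intro n
    exact ((hXV.measurable_weight n).mul
      (hg.lintegral_prod_right'.comp (hXV.measurable n))).aemeasurable
  · intro n
    exact ((hgX n).comp (hFm.prodMk
      (hrel.comp (measurable_id.prodMk ((hXV.measurable n).comp hFm))))).aemeasurable

open Classical in
/-- Second-order Campbell formula for a point process with independent marks. -/
theorem HasIndependentClusters.campbell_two {P : Measure Ω} [IsProbabilityMeasure P]
    {Φ : Ω → Measure (Rd d)} (hΦ : IsPointProcess Φ)
    {K : Ω → Rd d → SignedMeasure (Rd d)} (hK : Measurable (Function.uncurry K))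
    {L : Measure (SignedMeasure (Rd d))} [IsProbabilityMeasure L]
    (h : HasIndependentClusters P Φ K L)
    {G : (Rd d × Rd d) × (SignedMeasure (Rd d) × SignedMeasure (Rd d)) → ℝ≥0∞}
    (hG : Measurable G) :
    ∫⁻ ω, ∫⁻ u, ∫⁻ v, G ((u, v), (relKernel K ω u, relKernel K ω v)) ∂Φ ω ∂Φ ω ∂P =
      ∫⁻ ν, ∫⁻ u, ∫⁻ v, (if u = v then ∫⁻ m, G ((u, u), (m, m)) ∂L
        else ∫⁻ m, G ((u, v), m) ∂(L.prod L)) ∂ν.1 ∂ν.1 ∂(P.map (countingProcess hΦ)) := by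
  obtain ⟨X, V, hXV⟩ := exists_isEnumeration (d := d)
  have hFm := measurable_countingProcess hΦ
  have hrel := measurable_relKernel hK
  have hJ : Measurable fun q : Rd d × Rd d => if q.1 = q.2 then ∫⁻ m, G ((q.1, q.1), (m, m)) ∂L
        else ∫⁻ m, G (q, m) ∂(L.prod L) := by
    refine Measurable.ite (measurableSet_eq_fun measurable_fst measurable_snd) ?_ ?_
    · have : Measurable fun r : (Rd d × Rd d) × SignedMeasure (Rd d) =>
        G ((r.1.1, r.1.1), (r.2, r.2)) := hG.comp (by fun_prop)
      exact this.lintegral_prod_right'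
    · exact hG.lintegral_prod_right'
  set F := countingProcess hΦ with hF
  have hsum : ∀ (ν : CountingMeasure d) (f : Rd d × Rd d → ℝ≥0∞), Measurable f →
      ∫⁻ u, ∫⁻ v, f (u, v) ∂ν.1 ∂ν.1 =
        ∑' i, ∑' j, weight X V i ν * (weight X V j ν * f (X i ν, X j ν)) := by
    intro ν f hf
    rw [hXV.lintegral ν _ hf.lintegral_prod_right']
    refine tsum_congr fun i => ?_
    have hm : Measurable fun v => f (X i ν, v) := hf.comp measurable_prodMk_left
    rw [hXV.lintegral ν _ hm, ENNReal.tsum_mul_left]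
  have hXm : ∀ n, Measurable fun ω => X n (F ω) := fun n => (hXV.measurable n).comp hFm
  have hwm : ∀ n, Measurable fun ω => weight X V n (F ω) :=
    fun n => (hXV.measurable_weight n).comp hFm
  have hKm : ∀ n, Measurable fun ω => relKernel K ω (X n (F ω)) := fun n =>
    hrel.comp (measurable_id.prodMk (hXm n))
  have h1 : ∀ ω, ∫⁻ u, ∫⁻ v, G ((u, v), (relKernel K ω u, relKernel K ω v)) ∂Φ ω ∂Φ ω =
      ∑' i, ∑' j, weight X V i (F ω) * (weight X V j (F ω) *
        G ((X i (F ω), X j (F ω)), (relKernel K ω (X i (F ω)), relKernel K ω (X j (F ω))))) :=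
    fun ω => hsum (F ω) (fun q => G (q, (relKernel K ω q.1, relKernel K ω q.2)))
      (hG.comp (measurable_id.prodMk
        ((hrel.comp (measurable_const.prodMk measurable_fst)).prodMk
          (hrel.comp (measurable_const.prodMk measurable_snd)))))
  simp_rw [h1]
  rw [lintegral_congr fun ν => hsum ν _ hJ]
  rw [lintegral_tsum, lintegral_tsum]
  rotate_left
  · intro i
    refine (Measurable.tsum fun j => ?_).aemeasurable
    exact (hXV.measurable_weight i).mul ((hXV.measurable_weight j).mul
      (hJ.comp ((hXV.measurable i).prodMk (hXV.measurable j))))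
  · intro i
    refine (Measurable.tsum fun j => ?_).aemeasurable
    exact (hwm i).mul ((hwm j).mul (hG.comp
      (((hXm i).prodMk (hXm j)).prodMk ((hKm i).prodMk (hKm j)))))
  refine tsum_congr fun i => ?_
  rw [lintegral_tsum, lintegral_tsum]
  rotate_left
  · intro j
    exact ((hXV.measurable_weight i).mul ((hXV.measurable_weight j).mul
      (hJ.comp ((hXV.measurable i).prodMk (hXV.measurable j))))).aemeasurable
  · intro j
    exact ((hwm i).mul ((hwm j).mul (hG.comp
      (((hXm i).prodMk (hXm j)).prodMk ((hKm i).prodMk (hKm j)))))).aemeasurable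
  refine tsum_congr fun j => ?_
  -- Equal indices give the same mark twice, which yields the integral over `(m, m)` with `m` of law
  -- `L`. Different indices give distinct points wherever both are present, and the marks are
  -- independent there; elsewhere a weight vanishes.
  by_cases hij : i = j
  · subst hij
    have hf : Measurable (Function.uncurry fun (ν : CountingMeasure d) m =>
        weight X V i ν * (weight X V i ν * G ((X i ν, X i ν), (m, m)))) :=
      ((hXV.measurable_weight i).comp measurable_fst).mul
        (((hXV.measurable_weight i).comp measurable_fst).mul (hG.comp
          ((((hXV.measurable i).comp measurable_fst).prodMk
            ((hXV.measurable i).comp measurable_fst)).prodMk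
              (measurable_snd.prodMk measurable_snd))))
    have := h.lintegral_one hΦ hK (hXV.measurable i) (hXV.measurableSet i) (hXV.atom i) hf
      (fun ν hν m => by rw [weight, Set.indicator_of_notMem hν, zero_mul])
    rw [this]
    refine lintegral_congr fun ν => ?_
    rw [if_pos rfl, lintegral_const_mul, lintegral_const_mul]
    · exact hG.comp (by fun_prop)
    · exact (hG.comp (by fun_prop)).const_mul _
  · have hf : Measurable (Function.uncurry fun (ν : CountingMeasure d) m =>
        weight X V i ν * (weight X V j ν * G ((X i ν, X j ν), m))) :=
      ((hXV.measurable_weight i).comp measurable_fst).mul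
        (((hXV.measurable_weight j).comp measurable_fst).mul (hG.comp
          ((((hXV.measurable i).comp measurable_fst).prodMk
            ((hXV.measurable j).comp measurable_fst)).prodMk measurable_snd)))
    have := h.lintegral_two hΦ hK (V := V i ∩ V j) (hXV.measurable i) (hXV.measurable j)
      ((hXV.measurableSet i).inter (hXV.measurableSet j)) (fun ν hν => hXV.atom i ν hν.1)
      (fun ν hν => hXV.atom j ν hν.2) (fun ν hν he => hij (hXV.inj i j ν hν.1 hν.2 he)) hf
      (fun ν hν m => by
        by_cases hi : ν ∈ V i
        · have hj : ν ∉ V j := fun hj => hν ⟨hi, hj⟩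
          rw [weight, weight, Set.indicator_of_notMem hj, zero_mul, mul_zero]
        · rw [weight, Set.indicator_of_notMem hi, zero_mul])
    rw [this]
    refine lintegral_congr fun ν => ?_
    rw [lintegral_const_mul, lintegral_const_mul]
    · by_cases hi : ν ∈ V i
      · by_cases hj : ν ∈ V j
        · rw [if_neg fun he => hij (hXV.inj i j ν hi hj he)]
        · rw [weight, weight, Set.indicator_of_notMem hj, zero_mul, mul_zero, zero_mul, mul_zero]
      · rw [weight, Set.indicator_of_notMem hi, zero_mul, zero_mul]
    · exact hG.comp (by fun_prop)
    · exact (hG.comp (by fun_prop)).const_mul _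

end IndependentMarks

/-! ### Stationarity of the cluster measure. -/

section Stationarity

variable {d : ℕ} {Ω : Type*} [MeasurableSpace Ω]

/-- The law of a point process is determined by its finite-dimensional distributions. -/
theorem CountingMeasure.measurableSpace_eq_comap :
    (inferInstance : MeasurableSpace (CountingMeasure d)) =
      MeasurableSpace.comap (fun (ν : CountingMeasure d)
        (B : {B : Set (Rd d) // Bornology.IsBounded B ∧ MeasurableSet B}) => ν.1.real B.1)
        inferInstance := by
  set ev := fun (ν : CountingMeasure d)
    (B : {B : Set (Rd d) // Bornology.IsBounded B ∧ MeasurableSet B}) => ν.1.real B.1 with hev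
  apply le_antisymm
  · have h : @Measurable _ _ (MeasurableSpace.comap ev inferInstance) inferInstance
        (fun ν : CountingMeasure d => ν.1) := by
      refine @Measure.measurable_of_measurable_coe _ _ _ (MeasurableSpace.comap ev inferInstance)
        _ fun B hB => ?_
      have hB' : ∀ n : ℕ, Bornology.IsBounded (B ∩ Metric.ball 0 n) ∧
          MeasurableSet (B ∩ Metric.ball (0 : Rd d) n) := fun n =>
        ⟨Metric.isBounded_ball.subset Set.inter_subset_right,
          hB.inter Metric.isOpen_ball.measurableSet⟩
      -- Exhaustion by balls expresses the mass of an unbounded set through bounded ones, on which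
      -- masses are finite and the passage through `Measure.real` loses nothing.
      have e : (fun ν : CountingMeasure d => ν.1 B) = fun ν => ⨆ n : ℕ,
          ENNReal.ofReal (ev ν ⟨B ∩ Metric.ball 0 n, hB' n⟩) := by
        ext1 ν
        have hU : B = ⋃ n : ℕ, B ∩ Metric.ball (0 : Rd d) n := by
          rw [← Set.inter_iUnion, Metric.iUnion_ball_nat, Set.inter_univ]
        have hm : Monotone fun n : ℕ => B ∩ Metric.ball (0 : Rd d) n := fun a b hab =>
          Set.inter_subset_inter_right _ (Metric.ball_subset_ball (by exact_mod_cast hab))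
        conv_lhs => rw [hU, hm.measure_iUnion]
        refine iSup_congr fun n => ?_
        rw [hev]
        simp only [measureReal_def]
        rw [ENNReal.ofReal_toReal (ν.finiteOnBounded _ (hB' n).1).ne]
      rw [e]
      refine Measurable.iSup fun n => Measurable.ennreal_ofReal ?_
      exact (measurable_pi_apply _).comp (comap_measurable ev)
    exact h.comap_le
  · refine Measurable.comap_le (measurable_pi_lambda _ fun B => ?_)
    exact ((Measure.measurable_coe B.2.2).comp measurable_subtype_coe).ennreal_toReal

theorem measurableSet_shiftSet (x : Rd d) {B : Set (Rd d)} (hB : MeasurableSet B) :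
    MeasurableSet (shiftSet x B) := measurable_sub_const x hB

/-- Stationarity is given for finite-dimensional distributions. A projective limit of these is
unique, and the evaluations at bounded Borel sets generate the sigma-algebra of counting measures,
so the full law is shift-invariant. -/
theorem map_shift_eq {P : Measure Ω} [IsProbabilityMeasure P]
    {Φ : Ω → Measure (Rd d)} (hΦ : IsPointProcess Φ)
    (hstat : IsStationaryRandom P (toSigned Φ)) (z : Rd d) :
    (P.map (countingProcess hΦ)).map (CountingMeasure.shift z) = P.map (countingProcess hΦ) := by
  have hFm := measurable_countingProcess hΦ
  have hs := CountingMeasure.measurable_shift (d := d) z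
  rw [Measure.map_map hs hFm]
  set ev := fun (ν : CountingMeasure d)
    (B : {B : Set (Rd d) // Bornology.IsBounded B ∧ MeasurableSet B}) => ν.1.real B.1 with hev
  have hevm : Measurable ev := by
    refine measurable_pi_lambda _ fun B => ?_
    exact ((Measure.measurable_coe B.2.2).comp measurable_subtype_coe).ennreal_toReal
  have key : P.map (ev ∘ (CountingMeasure.shift z ∘ countingProcess hΦ)) =
      P.map (ev ∘ countingProcess hΦ) := by
    have hfin : ∀ I : Finset {B : Set (Rd d) // Bornology.IsBounded B ∧ MeasurableSet B},
        (P.map (ev ∘ (CountingMeasure.shift z ∘ countingProcess hΦ))).map I.restrict =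
          (P.map (ev ∘ countingProcess hΦ)).map I.restrict := by
      intro I
      have hr : Measurable (I.restrict (π := fun _ => ℝ)) := Finset.measurable_restrict I
      rw [Measure.map_map hr (hevm.comp (hs.comp hFm)), Measure.map_map hr (hevm.comp hFm)]
      set e := I.equivFin with he
      -- The sign is reversed because the measure shifted by `z` evaluates at `B` as the original
      -- one does at `B - z`.
      have h1 := hstat (-z) I.card (fun i => (e.symm i).1.1) (fun i => (e.symm i).1.2)
      have hg : Measurable fun (f : Fin I.card → ℝ) (i : I) => f (e i) :=
        measurable_pi_lambda _ fun i => measurable_pi_apply _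
      have h2 := congrArg (fun m => m.map fun (f : Fin I.card → ℝ) (i : I) => f (e i)) h1
      have hm : ∀ B : Set (Rd d), MeasurableSet B → Measurable fun ω => toSigned Φ ω B :=
        fun B hB => ((Measure.measurable_coe hB).comp hΦ.1).ennreal_toReal
      rw [Measure.map_map hg (measurable_pi_lambda _ fun i => hm _
          (measurableSet_shiftSet _ (e.symm i).1.2.2)),
        Measure.map_map hg (measurable_pi_lambda _ fun i => hm _ (e.symm i).1.2.2)] at h2
      convert h2 using 2
      · ext ω B
        simp only [Function.comp, Finset.restrict, hev, toSigned, shiftSet,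
          Equiv.symm_apply_apply, measureReal_def, CountingMeasure.shift_val]
        rw [Measure.map_apply (measurable_add_const z) B.1.2.2]
        simp only [sub_neg_eq_add]
        rfl
      · ext ω B
        simp only [Function.comp, Finset.restrict, hev, toSigned, Equiv.symm_apply_apply]
        rfl
    have hp : ∀ f : Ω → _, Measurable f → IsProbabilityMeasure (P.map f) := fun f hf =>
      Measure.isProbabilityMeasure_map (μ := P) (f := f) (β :=
        {B : Set (Rd d) // Bornology.IsBounded B ∧ MeasurableSet B} → ℝ) hf.aemeasurable
    have := hp _ (hevm.comp hFm)
    refine IsProjectiveLimit.unique (P := fun I => (P.map (ev ∘ countingProcess hΦ)).map I.restrict)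
      hfin (fun I => rfl)
  ext S hS
  obtain ⟨S', hS', rfl⟩ := CountingMeasure.measurableSpace_eq_comap.le S hS
  have h1 := congrArg (fun m => m S') key
  rw [Measure.map_apply (hevm.comp (hs.comp hFm)) hS', Measure.map_apply (hevm.comp hFm) hS'] at h1
  rw [Measure.map_apply (hs.comp hFm) (hevm hS'), Measure.map_apply hFm (hevm hS')]
  exact h1

/-- Almost sure convergence implies convergence of integrals of bounded continuous functions, and
these determine a finite measure. This transfers equality of laws from the partial sums over
clusters to their limits. -/
theorem map_eq_of_tendsto_of_map_eq {P : Measure Ω} [IsProbabilityMeasure P] {ι : Type*}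
    [Fintype ι] {f g : ℕ → Ω → (ι → ℝ)} {f' g' : Ω → (ι → ℝ)}
    (hf : ∀ n, Measurable (f n)) (hg : ∀ n, Measurable (g n)) (hf' : Measurable f')
    (hg' : Measurable g') (hlim : ∀ᵐ ω ∂P, Tendsto (fun n => f n ω) atTop (𝓝 (f' ω)))
    (hlim' : ∀ᵐ ω ∂P, Tendsto (fun n => g n ω) atTop (𝓝 (g' ω)))
    (h : ∀ n, P.map (f n) = P.map (g n)) : P.map f' = P.map g' := by
  have : IsProbabilityMeasure (P.map f') := Measure.isProbabilityMeasure_map hf'.aemeasurable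
  have : IsProbabilityMeasure (P.map g') := Measure.isProbabilityMeasure_map hg'.aemeasurable
  refine ext_of_forall_integral_eq_of_IsFiniteMeasure fun φ => ?_
  have key : ∀ {a : ℕ → Ω → (ι → ℝ)} {b : Ω → (ι → ℝ)}, (∀ n, Measurable (a n)) →
      Measurable b → (∀ᵐ ω ∂P, Tendsto (fun n => a n ω) atTop (𝓝 (b ω))) →
      Tendsto (fun n => ∫ x, φ x ∂(P.map (a n))) atTop (𝓝 (∫ x, φ x ∂(P.map b))) := by
    intro a b ha hb hab
    have e : ∀ {c : Ω → (ι → ℝ)}, Measurable c → ∫ x, φ x ∂(P.map c) = ∫ ω, φ (c ω) ∂P :=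
      fun hc => integral_map hc.aemeasurable φ.continuous.aestronglyMeasurable
    rw [e hb]
    simp_rw [fun n => e (ha n)]
    refine tendsto_integral_of_dominated_convergence (fun _ => ‖φ‖) ?_ (integrable_const _) ?_ ?_
    · exact fun n => φ.continuous.comp_aestronglyMeasurable (ha n).aestronglyMeasurable
    · exact fun n => Eventually.of_forall fun ω => φ.norm_coe_le_norm _
    · filter_upwards [hab] with ω hω
      exact (φ.continuous.tendsto _).comp hω
  refine tendsto_nhds_unique (key hf hf' hlim) ?_
  simp_rw [h]
  exact key hg hg' hlim'

theorem shiftSet_shiftSet (x y : Rd d) (B : Set (Rd d)) :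
    shiftSet x (shiftSet y B) = shiftSet (x + y) B := by
  ext z
  simp only [shiftSet, Set.mem_preimage]
  rw [sub_sub]

theorem isBounded_shiftSet (x : Rd d) {B : Set (Rd d)} (hB : Bornology.IsBounded B) :
    Bornology.IsBounded (shiftSet x B) := by
  have : shiftSet x B = (fun y => y + x) '' B := by
    ext y
    constructor
    · intro hy; exact ⟨y - x, hy, by simp⟩
    · rintro ⟨w, hw, rfl⟩; simpa [shiftSet] using hw
  rw [this]
  exact (IsometryEquiv.addRight x).isometry.lipschitz.isBounded_image hB

theorem measurable_apply_shiftSet {B : Set (Rd d)} (hB : MeasurableSet B) :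
    Measurable fun q : SignedMeasure (Rd d) × Rd d => q.1 (shiftSet q.2 B) := by
  have hf : Measurable fun q : (SignedMeasure (Rd d) × Rd d) × (Rd d × Bool) =>
      signOf q.2.2 * B.indicator (1 : Rd d → ℝ) (q.2.1 - q.1.2) := by
    have h1 : Measurable (B.indicator (1 : Rd d → ℝ)) := measurable_one.indicator hB
    exact (measurable_signOf.comp (by fun_prop)).mul (h1.comp (by fun_prop))
  have h2 := StronglyMeasurable.integral_kernel_prod_right
    (κ := (signKernel (d := d)).comap (Prod.fst : SignedMeasure (Rd d) × Rd d → _) measurable_fst)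
    (f := fun a b => signOf b.2 * B.indicator (1 : Rd d → ℝ) (b.1 - a.2)) hf.stronglyMeasurable
  convert h2.measurable using 1
  ext ⟨m, x⟩
  simp only [signedMeasure_apply_eq_integral m (measurableSet_shiftSet x hB), Kernel.comap_apply]
  rfl

omit [MeasurableSpace Ω] in
theorem relKernel_apply (K : Ω → Rd d → SignedMeasure (Rd d)) (ω : Ω) (x : Rd d) {B : Set (Rd d)}
    (hB : MeasurableSet B) : relKernel K ω x B = K ω x (shiftSet x B) := by
  rw [relKernel, VectorMeasure.map_apply _ (measurable_sub_const x) hB]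
  rfl

omit [MeasurableSpace Ω] in
theorem apply_eq_relKernel (K : Ω → Rd d → SignedMeasure (Rd d)) (ω : Ω) (x : Rd d)
    {B : Set (Rd d)} (hB : MeasurableSet B) : K ω x B = relKernel K ω x (shiftSet (-x) B) := by
  rw [relKernel_apply K ω x (measurableSet_shiftSet _ hB), shiftSet_shiftSet, add_neg_cancel]
  congr 1
  ext y
  simp [shiftSet]

theorem measurable_kernel_apply {K : Ω → Rd d → SignedMeasure (Rd d)}
    (hK : Measurable (Function.uncurry K)) (B : Set (Rd d)) :
    Measurable fun q : Ω × Rd d => K q.1 q.2 B :=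
  (measurable_signedMeasure_apply B).comp hK

theorem measurable_destination {Φ : Ω → Measure (Rd d)} (hΦ : IsPointProcess Φ)
    {K : Ω → Rd d → SignedMeasure (Rd d)} (hK : Measurable (Function.uncurry K))
    (B : Set (Rd d)) : Measurable fun ω => destination K Φ ω B :=
  (StronglyMeasurable.integral_kernel_prod_right
    (κ := (countingKernel (d := d)).comap (countingProcess hΦ) (measurable_countingProcess hΦ))
    (f := fun ω x => K ω x B) (measurable_kernel_apply hK B).stronglyMeasurable).measurable

/-- Partial sums of the series of the clusters of the points in an enumeration. -/
noncomputable def clusterSum (X : ℕ → CountingMeasure d → Rd d) (V : ℕ → Set (CountingMeasure d))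
    {n : ℕ} (B : Fin n → Set (Rd d)) (N : ℕ)
    (q : CountingMeasure d × (Fin N → SignedMeasure (Rd d))) (i : Fin n) : ℝ :=
  ∑ k : Fin N, (weight X V k q.1).toReal * q.2 k (shiftSet (-X k q.1) (B i))

theorem IsEnumeration.measurable_clusterSum {X : ℕ → CountingMeasure d → Rd d}
    {V : ℕ → Set (CountingMeasure d)} (h : IsEnumeration X V) {n : ℕ} {B : Fin n → Set (Rd d)}
    (hB : ∀ i, MeasurableSet (B i)) (N : ℕ) : Measurable (clusterSum X V B N) := by
  refine measurable_pi_lambda _ fun i => Finset.measurable_sum _ fun k _ => ?_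
  refine ((h.measurable_weight k).comp measurable_fst).ennreal_toReal.mul ?_
  have hp : Measurable fun q : CountingMeasure d × (Fin N → SignedMeasure (Rd d)) =>
      (q.2 k, -X k q.1) := ((measurable_pi_apply k).comp measurable_snd).prodMk
        ((h.measurable k).comp measurable_fst).neg
  exact (measurable_apply_shiftSet (hB i)).comp hp

theorem clusterSum_maskMarks (X : ℕ → CountingMeasure d → Rd d)
    (V : ℕ → Set (CountingMeasure d)) {n : ℕ} (B : Fin n → Set (Rd d)) (N : ℕ)
    (q : CountingMeasure d × (Fin N → SignedMeasure (Rd d))) :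
    clusterSum X V B N (maskMarks (fun k => V k) q) = clusterSum X V B N q := by
  ext i
  refine Finset.sum_congr rfl fun k _ => ?_
  simp only [maskMarks]
  by_cases hk : q.1 ∈ V k
  · rw [Set.indicator_of_mem hk]
  · rw [weight, Set.indicator_of_notMem hk]
    simp

/-- The weights of missing points vanish, so the partial sum sees only masked marks, whose joint law
with `Φ` is known. The right-hand side no longer involves `K`, which allows two enumerations to be
compared. -/
theorem HasIndependentClusters.map_clusterSum {P : Measure Ω} [IsProbabilityMeasure P]
    {Φ : Ω → Measure (Rd d)} (hΦ : IsPointProcess Φ)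
    {K : Ω → Rd d → SignedMeasure (Rd d)} (hK : Measurable (Function.uncurry K))
    {L : Measure (SignedMeasure (Rd d))} [IsProbabilityMeasure L]
    (h : HasIndependentClusters P Φ K L) {X : ℕ → CountingMeasure d → Rd d}
    {V : ℕ → Set (CountingMeasure d)} (hXV : IsEnumeration X V) {n : ℕ} {B : Fin n → Set (Rd d)}
    (hB : ∀ i, MeasurableSet (B i)) (N : ℕ) :
    P.map (fun ω => clusterSum X V B N (countingProcess hΦ ω,
      fun k => relKernel K ω (X k (countingProcess hΦ ω)))) =
    ((P.map (countingProcess hΦ)).prod (Measure.pi fun _ => L)).map (clusterSum X V B N) := by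
  have hFm := measurable_countingProcess hΦ
  have hc := hXV.measurable_clusterSum hB N
  have hmask := measurable_maskMarks (V := fun k : Fin N => V k) fun k => hXV.measurableSet k
  have hmarks : Measurable fun ω => (countingProcess hΦ ω,
      fun k : Fin N => relKernel K ω (X k (countingProcess hΦ ω))) :=
    hFm.prodMk (measurable_pi_lambda _ fun k =>
      (measurable_relKernel hK).comp (measurable_id.prodMk ((hXV.measurable k).comp hFm)))
  have h1 := h.map_maskMarks hΦ hK (X := fun k : Fin N => X k) (V := fun k => V k)
    (fun k => hXV.measurable k) (fun k => hXV.measurableSet k) (fun k => hXV.atom k)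
    (fun k l ν hk hl he => Fin.ext (hXV.inj k l ν hk hl he))
  have h2 := congrArg (fun m => m.map (clusterSum X V B N)) h1
  have hmm : Measurable fun ω => maskMarks (fun k : Fin N => V k) (countingProcess hΦ ω,
      fun k => relKernel K ω (X k (countingProcess hΦ ω))) := hmask.comp hmarks
  rw [Measure.map_map hc hmm, Measure.map_map hc hmask] at h2
  have e : clusterSum X V B N ∘ maskMarks (fun k => V k) = clusterSum X V B N :=
    funext fun q => clusterSum_maskMarks X V B N q
  rw [e] at h2
  rw [← h2]
  congr 1
  ext1 ω
  exact (clusterSum_maskMarks X V B N _).symm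

/-- Local finiteness of `|K|Φ` makes the series absolutely convergent. The limit is thus the same
for every enumeration. -/
theorem IsEnumeration.tendsto_clusterSum {Φ : Ω → Measure (Rd d)} (hΦ : IsPointProcess Φ)
    {K : Ω → Rd d → SignedMeasure (Rd d)} (hK : Measurable (Function.uncurry K))
    {X : ℕ → CountingMeasure d → Rd d}
    {V : ℕ → Set (CountingMeasure d)} (hXV : IsEnumeration X V) {n : ℕ} {B : Fin n → Set (Rd d)}
    (hB : ∀ i, Bornology.IsBounded (B i) ∧ MeasurableSet (B i)) {ω : Ω}
    (hω : ∀ B : Set (Rd d), Bornology.IsBounded B → MeasurableSet B →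
      ∫⁻ x, (K ω x).totalVariation B ∂Φ ω < ∞) :
    Tendsto (fun N => clusterSum X V B N (countingProcess hΦ ω,
      fun k => relKernel K ω (X k (countingProcess hΦ ω)))) atTop
      (𝓝 fun i => destination K Φ ω (B i)) := by
  refine tendsto_pi_nhds.2 fun i => ?_
  have hint : Integrable (fun x => K ω x (B i)) (Φ ω) := by
    refine ⟨((measurable_kernel_apply hK (B i)).comp
      measurable_prodMk_left).aestronglyMeasurable, ?_⟩
    refine lt_of_le_of_lt (lintegral_mono fun x => ?_) (hω _ (hB i).1 (hB i).2)
    exact (K ω x).enorm_le_totalVariation (B i)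
  set ν := countingProcess hΦ ω with hν
  have hsum : Φ ω = Measure.sum fun k => weight X V k ν • Measure.dirac (X k ν) :=
    hXV.eq_sum_weight ν
  have h1 : HasSum (fun k => (weight X V k ν).toReal * K ω (X k ν) (B i))
      (destination K Φ ω (B i)) := by
    have h2 := hasSum_integral_measure (μ := fun k => weight X V k ν • Measure.dirac (X k ν))
      (f := fun x => K ω x (B i)) (by rwa [← hsum])
    rw [← hsum] at h2
    simp only [integral_smul_measure, integral_dirac, smul_eq_mul] at h2
    exact h2
  refine h1.tendsto_sum_nat.congr fun N => ?_
  rw [clusterSum, Finset.sum_range]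
  refine Finset.sum_congr rfl fun k _ => ?_
  rw [apply_eq_relKernel K ω _ (hB i).2]

/-- The cluster process of a stationary point process with independent marks is stationary. -/
theorem HasIndependentClusters.isStationaryRandom_destination {P : Measure Ω}
    [IsProbabilityMeasure P] {Φ : Ω → Measure (Rd d)} (hΦ : IsPointProcess Φ)
    (hstat : IsStationaryRandom P (toSigned Φ))
    {K : Ω → Rd d → SignedMeasure (Rd d)} (hK : Measurable (Function.uncurry K))
    {L : Measure (SignedMeasure (Rd d))} [IsProbabilityMeasure L]
    (h : HasIndependentClusters P Φ K L)
    (hfin : ∀ᵐ ω ∂P, ∀ B : Set (Rd d), Bornology.IsBounded B → MeasurableSet B →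
      ∫⁻ x, (K ω x).totalVariation B ∂Φ ω < ∞) :
    IsStationaryRandom P (destination K Φ) := by
  intro x n B hB
  obtain ⟨X, V, hXV⟩ := exists_isEnumeration (d := d)
  -- The points are listed in the order in which their translates by `-x` would be. The partial sums
  -- for `B + x` in this order are those for `B` in the original order, evaluated at the translated
  -- configuration, and the law of the configuration is shift-invariant.
  have hXV' := hXV.shift (-x)
  have hB' : ∀ i, Bornology.IsBounded (shiftSet x (B i)) ∧ MeasurableSet (shiftSet x (B i)) :=
    fun i => ⟨isBounded_shiftSet x (hB i).1, measurableSet_shiftSet x (hB i).2⟩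
  have hFm := measurable_countingProcess hΦ
  have hmarks : ∀ {X : ℕ → CountingMeasure d → Rd d} {V : ℕ → Set (CountingMeasure d)},
      IsEnumeration X V → ∀ N : ℕ, Measurable fun ω => (countingProcess hΦ ω,
      fun k : Fin N => relKernel K ω (X k (countingProcess hΦ ω))) := fun hXV N =>
    hFm.prodMk (measurable_pi_lambda _ fun k =>
      (measurable_relKernel hK).comp (measurable_id.prodMk ((hXV.measurable k).comp hFm)))
  refine map_eq_of_tendsto_of_map_eq
    (f := fun N ω => clusterSum _ _ (fun i => shiftSet x (B i)) N (countingProcess hΦ ω,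
      fun k => relKernel K ω (X k ((countingProcess hΦ ω).shift (-x)) - -x)))
    (g := fun N ω => clusterSum X V B N (countingProcess hΦ ω,
      fun k => relKernel K ω (X k (countingProcess hΦ ω))))
    (fun N => (hXV'.measurable_clusterSum (fun i => (hB' i).2) N).comp (hmarks hXV' N))
    (fun N => (hXV.measurable_clusterSum (fun i => (hB i).2) N).comp (hmarks hXV N))
    (measurable_pi_lambda _ fun i => measurable_destination hΦ hK _)
    (measurable_pi_lambda _ fun i => measurable_destination hΦ hK _)
    (hfin.mono fun ω hω => hXV'.tendsto_clusterSum hΦ hK hB' hω)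
    (hfin.mono fun ω hω => hXV.tendsto_clusterSum hΦ hK hB hω) fun N => ?_
  rw [h.map_clusterSum hΦ hK hXV' (fun i => (hB' i).2) N,
    h.map_clusterSum hΦ hK hXV (fun i => (hB i).2) N]
  have hs := CountingMeasure.measurable_shift (d := d) (-x)
  have e : clusterSum (fun n ν => X n (ν.shift (-x)) - -x)
      (fun n => CountingMeasure.shift (-x) ⁻¹' V n) (fun i => shiftSet x (B i)) N =
      clusterSum X V B N ∘ Prod.map (CountingMeasure.shift (-x)) id := by
    ext q i
    refine Finset.sum_congr rfl fun k _ => ?_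
    congr 1
    · congr 1
      simp only [weight, Prod.map]
      by_cases hk : q.1.shift (-x) ∈ V k
      · rw [Set.indicator_of_mem hk, Set.indicator_of_mem (show q.1 ∈ _ ⁻¹' V k from hk),
          CountingMeasure.shift_singleton]
      · rw [Set.indicator_of_notMem hk, Set.indicator_of_notMem (show q.1 ∉ _ ⁻¹' V k from hk)]
    · rw [shiftSet_shiftSet]
      simp
  have : IsProbabilityMeasure (P.map (countingProcess hΦ)) :=
    Measure.isProbabilityMeasure_map hFm.aemeasurable
  rw [e, ← Measure.map_map (hXV.measurable_clusterSum (fun i => (hB i).2) N)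
    (hs.prodMap measurable_id), ← Measure.map_prod_map _ _ hs measurable_id,
    map_shift_eq hΦ hstat, Measure.map_id]

end Stationarity

/-! ### Second moment measures of points and of clusters. -/

section SecondOrder

variable {d : ℕ} {Ω : Type*} [MeasurableSpace Ω]

/-- Translation of the first component. -/
def translateFst (u : Rd d) (z : Rd d × Bool) : Rd d × Bool := (z.1 + u, z.2)

theorem measurable_translateFst :
    Measurable fun q : Rd d × (Rd d × Bool) => translateFst q.1 q.2 := by
  unfold translateFst
  fun_prop

theorem measurable_translateFst_right (u : Rd d) : Measurable (translateFst u) :=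
  measurable_translateFst.comp measurable_prodMk_left

/-- Translating the Jordan parts keeps them mutually singular, so uniqueness of the Jordan
decomposition identifies them as the parts of the translated measure. -/
theorem signKernel_map_sub (m : SignedMeasure (Rd d)) (x : Rd d) :
    signKernel (VectorMeasure.map m fun y => y - x) = (signKernel m).map (translateFst (-x)) := by
  have hs : Measurable fun y : Rd d => y - x := measurable_sub_const x
  have hj : ∃ j : JordanDecomposition (Rd d),
      j.posPart = m.toJordanDecomposition.posPart.map (fun y => y - x) ∧
      j.negPart = m.toJordanDecomposition.negPart.map (fun y => y - x) := by
    refine ⟨{ posPart := m.toJordanDecomposition.posPart.map (fun y => y - x)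
              negPart := m.toJordanDecomposition.negPart.map (fun y => y - x)
              mutuallySingular := ?_ }, rfl, rfl⟩
    obtain ⟨S, hS, h1, h2⟩ := m.toJordanDecomposition.mutuallySingular
    have hS' := measurableSet_shiftSet (-x) hS
    have e : (fun y => y - x) ⁻¹' shiftSet (-x) S = S := by
      ext y; simp [shiftSet]
    refine ⟨shiftSet (-x) S, hS', ?_, ?_⟩
    · rw [Measure.map_apply hs hS', e, h1]
    · rw [Measure.map_apply hs hS'.compl, Set.preimage_compl, e, h2]
  obtain ⟨j, hp, hn⟩ := hj
  have e : SignedMeasure.toJordanDecomposition (m.map fun y => y - x) = j := by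
    refine SignedMeasure.toJordanDecomposition_eq ?_
    ext B hB
    rw [VectorMeasure.map_apply _ hs hB, m.apply_eq_posPart_real_sub_negPart_real (hs hB),
      JordanDecomposition.toSignedMeasure, sub_apply,
      Measure.toSignedMeasure_apply_measurable hB, Measure.toSignedMeasure_apply_measurable hB,
      measureReal_def, measureReal_def, measureReal_def, measureReal_def, hp, hn,
      Measure.map_apply hs hB, Measure.map_apply hs hB]
  rw [signKernel_apply, e, hp, hn, signKernel_apply,
    Measure.map_add _ _ (measurable_translateFst_right _),
    Measure.map_map (by fun_prop) hs, Measure.map_map (by fun_prop) hs,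
    Measure.map_map (measurable_translateFst_right _) (by fun_prop),
    Measure.map_map (measurable_translateFst_right _) (by fun_prop)]
  congr 2

omit [MeasurableSpace Ω] in
theorem signKernel_eq_map_relKernel (K : Ω → Rd d → SignedMeasure (Rd d)) (ω : Ω) (u : Rd d) :
    signKernel (K ω u) = (signKernel (relKernel K ω u)).map (translateFst u) := by
  rw [relKernel, signKernel_map_sub, Measure.map_map (measurable_translateFst_right _)
    (measurable_translateFst_right _)]
  have : translateFst u ∘ translateFst (-u) = id := by
    ext z <;> simp [translateFst]
  rw [this, Measure.map_id]

theorem integral_measure_comp {α β : Type*} [MeasurableSpace α] [MeasurableSpace β]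
    {F : Type*} [NormedAddCommGroup F] [NormedSpace ℝ F]
    {m : Measure α} {κ : Kernel α β} {f : β → F} (hf : Integrable f (κ ∘ₘ m)) :
    ∫ b, f b ∂(κ ∘ₘ m) = ∫ a, ∫ b, f b ∂κ a ∂m := by
  rw [Measure.comp_eq_comp_const_apply] at hf ⊢
  rw [Kernel.integral_comp hf]
  simp

theorem lintegral_measure_comp {α β : Type*} [MeasurableSpace α] [MeasurableSpace β]
    (m : Measure α) (κ : Kernel α β) {f : β → ℝ≥0∞} (hf : Measurable f) :
    ∫⁻ b, f b ∂(κ ∘ₘ m) = ∫⁻ a, ∫⁻ b, f b ∂κ a ∂m :=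
  Measure.lintegral_bind κ.measurable.aemeasurable hf.aemeasurable

theorem lintegral_prod_comp {α β : Type*} [MeasurableSpace α] [MeasurableSpace β]
    (m : Measure α) (κ : Kernel α β) [IsSFiniteKernel κ] {f : β × β → ℝ≥0∞} (hf : Measurable f) :
    ∫⁻ b, f b ∂((κ ×ₖ κ) ∘ₘ m) = ∫⁻ a, ∫⁻ b, ∫⁻ c, f (b, c) ∂κ a ∂κ a ∂m := by
  rw [lintegral_measure_comp _ _ hf]
  exact lintegral_congr fun a => Kernel.lintegral_prod _ _ _ hf

/-- The second moment measure of a random counting measure. -/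
noncomputable def pairMeasure (Q : Measure (CountingMeasure d)) : Measure (Rd d × Rd d) :=
  (countingKernel ×ₖ countingKernel) ∘ₘ Q

/-- The measure `E ∑ Φ{x}² δ_x`, with the sum over the points of `Φ`. -/
noncomputable def diagMeasure (Q : Measure (CountingMeasure d)) : Measure (Rd d) :=
  ((pairMeasure Q).restrict (Set.diagonal (Rd d))).map Prod.fst

variable (Q : Measure (CountingMeasure d))

instance [SFinite Q] : SFinite (pairMeasure Q) := by unfold pairMeasure; infer_instance

instance [SFinite Q] : SFinite (diagMeasure Q) := by unfold diagMeasure; infer_instance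

theorem lintegral_pairMeasure {f : Rd d × Rd d → ℝ≥0∞} (hf : Measurable f) :
    ∫⁻ q, f q ∂pairMeasure Q = ∫⁻ ν, ∫⁻ u, ∫⁻ v, f (u, v) ∂ν.1 ∂ν.1 ∂Q :=
  lintegral_prod_comp Q countingKernel hf

theorem lintegral_diagMeasure {f : Rd d → ℝ≥0∞} (hf : Measurable f) :
    ∫⁻ u, f u ∂diagMeasure Q =
      ∫⁻ q, (Set.diagonal (Rd d)).indicator (fun q => f q.1) q ∂pairMeasure Q := by
  rw [diagMeasure, lintegral_map hf measurable_fst, lintegral_indicator measurableSet_diagonal]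

theorem pairMeasure_map_add (hQ : ∀ z, Q.map (CountingMeasure.shift z) = Q) (z : Rd d) :
    (pairMeasure Q).map (fun q => (q.1 + z, q.2 + z)) = pairMeasure Q := by
  have hm : Measurable fun q : Rd d × Rd d => (q.1 + z, q.2 + z) := by fun_prop
  refine Measure.ext_of_lintegral _ fun f hf => ?_
  have hf' : Measurable fun q : Rd d × Rd d => f (q.1 + z, q.2 + z) := hf.comp hm
  rw [lintegral_map hf hm, lintegral_pairMeasure Q hf', lintegral_pairMeasure Q hf]
  conv_rhs => rw [← hQ z]
  have hJ : Measurable fun ν : CountingMeasure d => ∫⁻ u, ∫⁻ v, f (u, v) ∂ν.1 ∂ν.1 := by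
    have := Measurable.lintegral_kernel (κ := countingKernel (d := d) ×ₖ countingKernel) hf
    simp only [Kernel.lintegral_prod _ _ _ hf] at this
    exact this
  rw [lintegral_map hJ (CountingMeasure.measurable_shift z)]
  refine lintegral_congr fun ν => ?_
  rw [CountingMeasure.shift_val, lintegral_map hf.lintegral_prod_right' (measurable_add_const z)]
  refine lintegral_congr fun u => ?_
  have hfu : Measurable fun v => f (u + z, v) := hf.comp measurable_prodMk_left
  rw [lintegral_map hfu (measurable_add_const z)]

theorem lintegral_diagMeasure_add (hQ : ∀ z, Q.map (CountingMeasure.shift z) = Q) (z : Rd d)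
    {f : Rd d → ℝ≥0∞} (hf : Measurable f) :
    ∫⁻ u, f (u + z) ∂diagMeasure Q = ∫⁻ u, f u ∂diagMeasure Q := by
  have hm : Measurable fun q : Rd d × Rd d => (q.1 + z, q.2 + z) := by fun_prop
  have hf' : Measurable fun u => f (u + z) := hf.comp (measurable_add_const z)
  have hi : Measurable ((Set.diagonal (Rd d)).indicator fun q : Rd d × Rd d => f q.1) :=
    (hf.comp measurable_fst).indicator measurableSet_diagonal
  rw [lintegral_diagMeasure Q hf', lintegral_diagMeasure Q hf]
  conv_rhs => rw [← pairMeasure_map_add Q hQ z]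
  rw [lintegral_map hi hm]
  refine lintegral_congr fun q => ?_
  by_cases hq : q ∈ Set.diagonal (Rd d)
  · rw [Set.indicator_of_mem hq, Set.indicator_of_mem]
    exact Set.mem_diagonal_iff.2 (by rw [Set.mem_diagonal_iff.1 hq])
  · rw [Set.indicator_of_notMem hq, Set.indicator_of_notMem]
    exact fun h => hq (Set.mem_diagonal_iff.2 (add_left_injective z (Set.mem_diagonal_iff.1 h)))

theorem lintegral_mass_shiftSet (hQ : ∀ z, Q.map (CountingMeasure.shift z) = Q) (z : Rd d)
    {B : Set (Rd d)} (hB : MeasurableSet B) (g : ℝ≥0∞ → ℝ≥0∞) (hg : Measurable g) :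
    ∫⁻ ν, g (ν.1 (shiftSet z B)) ∂Q = ∫⁻ ν, g (ν.1 B) ∂Q := by
  conv_rhs => rw [← hQ (-z)]
  have hgm : Measurable fun ν : CountingMeasure d => g (ν.1 B) :=
    hg.comp ((Measure.measurable_coe hB).comp measurable_subtype_coe)
  rw [lintegral_map hgm (CountingMeasure.measurable_shift _)]
  refine lintegral_congr fun ν => ?_
  rw [CountingMeasure.shift_val, Measure.map_apply (measurable_add_const _) hB]
  simp only [shiftSet, sub_eq_add_neg]

theorem pairMeasure_prod (B B' : Set (Rd d)) (hB : MeasurableSet B) (hB' : MeasurableSet B') :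
    pairMeasure Q (B ×ˢ B') = ∫⁻ ν, ν.1 B * ν.1 B' ∂Q := by
  rw [pairMeasure, Measure.bind_apply (hB.prod hB') (Kernel.aemeasurable _)]
  refine lintegral_congr fun ν => ?_
  rw [Kernel.prod_apply_prod]
  rfl

/-- From `ab ≤ a² + b²` and stationarity of each factor. The bound is uniform in `x` and `y`, so it
survives integration over random displacements. -/
theorem pairMeasure_shiftSet_le (hQ : ∀ z, Q.map (CountingMeasure.shift z) = Q)
    {B : Set (Rd d)} (hB : MeasurableSet B) (x y : Rd d) :
    pairMeasure Q (shiftSet x B ×ˢ shiftSet y B) ≤ 2 * pairMeasure Q (B ×ˢ B) := by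
  rw [pairMeasure_prod Q _ _ (measurableSet_shiftSet x hB) (measurableSet_shiftSet y hB),
    pairMeasure_prod Q _ _ hB hB]
  have hm : ∀ z : Rd d, Measurable fun ν : CountingMeasure d => ν.1 (shiftSet z B) := fun z =>
    (Measure.measurable_coe (measurableSet_shiftSet z hB)).comp measurable_subtype_coe
  have hle : ∀ a b : ℝ≥0∞, a * b ≤ a * a + b * b := fun a b => by
    rcases le_total a b with h | h
    · exact (mul_le_mul_left h b).trans le_add_self
    · exact (mul_le_mul_right h a).trans le_self_add
  have hsq : Measurable fun a : ℝ≥0∞ => a * a := measurable_id.mul measurable_id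
  calc ∫⁻ ν, ν.1 (shiftSet x B) * ν.1 (shiftSet y B) ∂Q
      ≤ ∫⁻ ν, (ν.1 (shiftSet x B) * ν.1 (shiftSet x B) +
          ν.1 (shiftSet y B) * ν.1 (shiftSet y B)) ∂Q := lintegral_mono fun ν => hle _ _
    _ = 2 * ∫⁻ ν, ν.1 B * ν.1 B ∂Q := by
        have hmm : Measurable fun ν : CountingMeasure d =>
          ν.1 (shiftSet x B) * ν.1 (shiftSet x B) := (hm x).mul (hm x)
        rw [lintegral_add_left hmm,
          lintegral_mass_shiftSet Q hQ x hB (fun a => a * a) hsq,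
          lintegral_mass_shiftSet Q hQ y hB (fun a => a * a) hsq, two_mul]

theorem diagMeasure_shiftSet (hQ : ∀ z, Q.map (CountingMeasure.shift z) = Q)
    {B : Set (Rd d)} (hB : MeasurableSet B) (z : Rd d) :
    diagMeasure Q (shiftSet z B) = diagMeasure Q B := by
  have h := lintegral_diagMeasure_add Q hQ (-z) (f := B.indicator 1) (measurable_one.indicator hB)
  rw [lintegral_indicator_one hB] at h
  rw [← h, ← lintegral_indicator_one (measurableSet_shiftSet z hB)]
  refine lintegral_congr fun u => ?_
  simp only [shiftSet, Set.indicator, Set.mem_preimage, sub_eq_add_neg]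
  rfl

theorem diagMeasure_le (B : Set (Rd d)) (hB : MeasurableSet B) :
    diagMeasure Q B ≤ pairMeasure Q (B ×ˢ B) := by
  rw [diagMeasure, Measure.map_apply measurable_fst hB,
    Measure.restrict_apply (measurable_fst hB)]
  refine measure_mono fun q hq => ⟨hq.1, ?_⟩
  have := Set.mem_diagonal_iff.1 hq.2
  exact this ▸ hq.1

/-- The kernel `∫ K(x, ·) Φ(dx)`, with positive and negative parts kept apart. -/
noncomputable def clusterKernel {Φ : Ω → Measure (Rd d)} (hΦ : IsPointProcess Φ)
    {K : Ω → Rd d → SignedMeasure (Rd d)} (hK : Measurable (Function.uncurry K)) :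
    Kernel Ω (Rd d × Bool) :=
  Kernel.snd (countingKernel.comap (countingProcess hΦ) (measurable_countingProcess hΦ) ⊗ₖ
    signKernel.comap (Function.uncurry K) hK)

instance {Φ : Ω → Measure (Rd d)} (hΦ : IsPointProcess Φ)
    {K : Ω → Rd d → SignedMeasure (Rd d)} (hK : Measurable (Function.uncurry K)) :
    IsSFiniteKernel (clusterKernel hΦ hK) := by
  unfold clusterKernel; infer_instance

theorem lintegral_clusterKernel {Φ : Ω → Measure (Rd d)} (hΦ : IsPointProcess Φ)
    {K : Ω → Rd d → SignedMeasure (Rd d)} (hK : Measurable (Function.uncurry K)) (ω : Ω)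
    {f : Rd d × Bool → ℝ≥0∞} (hf : Measurable f) :
    ∫⁻ z, f z ∂clusterKernel hΦ hK ω = ∫⁻ u, ∫⁻ z, f z ∂signKernel (K ω u) ∂Φ ω := by
  have hf' : Measurable fun q : Rd d × (Rd d × Bool) => f q.2 := hf.comp measurable_snd
  rw [clusterKernel, Kernel.lintegral_snd _ _ hf, Kernel.lintegral_compProd _ _ _ hf']
  rfl

theorem integral_clusterKernel {F : Type*} [NormedAddCommGroup F] [NormedSpace ℝ F]
    {Φ : Ω → Measure (Rd d)} (hΦ : IsPointProcess Φ)
    {K : Ω → Rd d → SignedMeasure (Rd d)} (hK : Measurable (Function.uncurry K)) (ω : Ω)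
    {f : Rd d × Bool → F} (hf : Integrable f (clusterKernel hΦ hK ω)) :
    ∫ z, f z ∂clusterKernel hΦ hK ω = ∫ u, ∫ z, f z ∂signKernel (K ω u) ∂Φ ω := by
  rw [clusterKernel, Kernel.snd_apply] at hf ⊢
  rw [integral_map measurable_snd.aemeasurable hf.1, integral_compProd]
  · rfl
  · exact (integrable_map_measure hf.1 measurable_snd.aemeasurable).1 hf

/-- The intensity measure of the clusters, with positive and negative parts kept apart. -/
noncomputable def clusterMean (L : Measure (SignedMeasure (Rd d))) : Measure (Rd d × Bool) :=
  signKernel ∘ₘ L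

/-- The second moment measure of the clusters. -/
noncomputable def clusterPair (L : Measure (SignedMeasure (Rd d))) :
    Measure ((Rd d × Bool) × (Rd d × Bool)) :=
  (signKernel ×ₖ signKernel) ∘ₘ L

instance (L : Measure (SignedMeasure (Rd d))) [SFinite L] : SFinite (clusterMean L) := by
  unfold clusterMean; infer_instance

instance (L : Measure (SignedMeasure (Rd d))) [SFinite L] : SFinite (clusterPair L) := by
  unfold clusterPair; infer_instance

/-- Translation of a pair of points by a pair of vectors. -/
def translatePair (q : (Rd d × Rd d) × ((Rd d × Bool) × (Rd d × Bool))) :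
    (Rd d × Bool) × (Rd d × Bool) :=
  (translateFst q.1.1 q.2.1, translateFst q.1.2 q.2.2)

/-- Translation of a pair of points by a vector. -/
def translateBoth (q : Rd d × ((Rd d × Bool) × (Rd d × Bool))) :
    (Rd d × Bool) × (Rd d × Bool) :=
  (translateFst q.1 q.2.1, translateFst q.1 q.2.2)

theorem measurable_translatePair : Measurable (translatePair (d := d)) := by
  unfold translatePair translateFst
  fun_prop

theorem measurable_translateBoth : Measurable (translateBoth (d := d)) := by
  unfold translateBoth translateFst
  fun_prop

theorem clusterMean_prod (L : Measure (SignedMeasure (Rd d))) [SFinite L] :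
    (clusterMean L).prod (clusterMean L) = (signKernel ∥ₖ signKernel) ∘ₘ (L.prod L) := by
  rw [clusterMean, Measure.prod_comp_left, Measure.prod_comp_right, Measure.comp_assoc,
    Kernel.parallelComp_comp_parallelComp, Kernel.comp_id, Kernel.id_comp]

/-- Second-order structure of a cluster process: pairs of points in distinct clusters are
distributed as for independent clusters, pairs of points in the same cluster according to
the second moment measure of the clusters. -/
theorem HasIndependentClusters.pair_identity {P : Measure Ω} [IsProbabilityMeasure P]
    {Φ : Ω → Measure (Rd d)} (hΦ : IsPointProcess Φ)
    {K : Ω → Rd d → SignedMeasure (Rd d)} (hK : Measurable (Function.uncurry K))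
    {L : Measure (SignedMeasure (Rd d))} [IsProbabilityMeasure L]
    (h : HasIndependentClusters P Φ K L) :
    (clusterKernel hΦ hK ×ₖ clusterKernel hΦ hK) ∘ₘ P +
      ((diagMeasure (P.map (countingProcess hΦ))).prod
        ((clusterMean L).prod (clusterMean L))).map translateBoth =
    ((pairMeasure (P.map (countingProcess hΦ))).prod
        ((clusterMean L).prod (clusterMean L))).map translatePair +
      ((diagMeasure (P.map (countingProcess hΦ))).prod (clusterPair L)).map translateBoth := by
  classical
  have hrel := measurable_relKernel hK
  set Q := P.map (countingProcess hΦ) with hQ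
  have : IsProbabilityMeasure Q :=
    Measure.isProbabilityMeasure_map (measurable_countingProcess hΦ).aemeasurable
  -- All measures here may be infinite. The term in which a point is wrongly paired with an
  -- independent copy of its own cluster is therefore added on the left rather than subtracted on
  -- the right.
  refine Measure.ext_of_lintegral _ fun f hf => ?_
  have hfp : Measurable fun q => f (translatePair (d := d) q) := hf.comp measurable_translatePair
  have hfb : Measurable fun q => f (translateBoth (d := d) q) := hf.comp measurable_translateBoth
  -- `G` sums `f` over the pairs of points of two given clusters placed at two given positions. It
  -- is the functional to which the second-order Campbell formula is applied.
  set G : (Rd d × Rd d) × (SignedMeasure (Rd d) × SignedMeasure (Rd d)) → ℝ≥0∞ := fun r =>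
    ∫⁻ q, f (translatePair (r.1, q)) ∂(signKernel ∥ₖ signKernel) r.2 with hG
  have hGm : Measurable G := by
    have h1 : Measurable fun s : ((Rd d × Rd d) × (SignedMeasure (Rd d) × SignedMeasure (Rd d))) ×
        ((Rd d × Bool) × (Rd d × Bool)) => f (translatePair (s.1.1, s.2)) :=
      hfp.comp ((measurable_fst.comp measurable_fst).prodMk measurable_snd)
    exact h1.lintegral_kernel_prod_right' (κ := (signKernel ∥ₖ signKernel).comap
      (Prod.snd : (Rd d × Rd d) × (SignedMeasure (Rd d) × SignedMeasure (Rd d)) → _) measurable_snd)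
  have hGe : ∀ u v m m', G ((u, v), (m, m')) =
      ∫⁻ z, ∫⁻ z', f (translateFst u z, translateFst v z') ∂signKernel m' ∂signKernel m := by
    intro u v m m'
    exact Kernel.lintegral_parallelComp _ (hfp.comp measurable_prodMk_left)
  set J₂ : Rd d × Rd d → ℝ≥0∞ := fun r => ∫⁻ m, G (r, m) ∂(L.prod L) with hJ₂
  set J₁ : Rd d → ℝ≥0∞ := fun u => ∫⁻ m, G ((u, u), (m, m)) ∂L with hJ₁
  have hJ₂m : Measurable J₂ := hGm.lintegral_prod_right'
  have hJ₁m : Measurable J₁ := by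
    have h1 : Measurable fun r : Rd d × SignedMeasure (Rd d) => G ((r.1, r.1), (r.2, r.2)) :=
      hGm.comp (by fun_prop)
    exact h1.lintegral_prod_right'
  have hJ₂e : ∀ r, J₂ r = ∫⁻ q, f (translatePair (r, q)) ∂(clusterMean L).prod (clusterMean L) := by
    intro r
    rw [clusterMean_prod]
    exact (lintegral_measure_comp _ _ (hfp.comp measurable_prodMk_left)).symm
  have hJ₁e : ∀ u, J₁ u = ∫⁻ q, f (translateBoth (u, q)) ∂clusterPair L := by
    intro u
    rw [clusterPair]
    refine Eq.trans ?_ (lintegral_prod_comp _ _ (hfb.comp measurable_prodMk_left)).symm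
    exact lintegral_congr fun m => hGe u u m m
  have e1 : ∫⁻ q, f q ∂((clusterKernel hΦ hK ×ₖ clusterKernel hΦ hK) ∘ₘ P) =
      ∫⁻ q, (if q.1 = q.2 then J₁ q.1 else J₂ q) ∂pairMeasure Q := by
    have hite : Measurable fun q : Rd d × Rd d => if q.1 = q.2 then J₁ q.1 else J₂ q :=
      Measurable.ite (measurableSet_eq_fun measurable_fst measurable_snd)
        (hJ₁m.comp measurable_fst) hJ₂m
    rw [lintegral_prod_comp _ _ hf, lintegral_pairMeasure Q hite,
      ← h.campbell_two hΦ hK hGm]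
    refine lintegral_congr fun ω => ?_
    rw [lintegral_clusterKernel hΦ hK ω hf.lintegral_prod_right']
    refine lintegral_congr fun u => ?_
    have h1 : ∀ z, ∫⁻ z', f (z, z') ∂clusterKernel hΦ hK ω =
        ∫⁻ v, ∫⁻ z', f (z, z') ∂signKernel (K ω v) ∂Φ ω := fun z =>
      lintegral_clusterKernel hΦ hK ω (hf.comp measurable_prodMk_left)
    simp_rw [h1]
    have : SFinite (Φ ω) := inferInstanceAs (SFinite (countingProcess hΦ ω).1)
    have hKω : Measurable (K ω) := hK.comp measurable_prodMk_left
    rw [lintegral_lintegral_swap]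
    · refine lintegral_congr fun v => ?_
      rw [hGe, signKernel_eq_map_relKernel K ω u, signKernel_eq_map_relKernel K ω v,
        lintegral_map _ (measurable_translateFst_right u)]
      · refine lintegral_congr fun z => ?_
        rw [lintegral_map _ (measurable_translateFst_right v)]
        exact hf.comp measurable_prodMk_left
      · exact hf.lintegral_prod_right'
    · have h2 : Measurable fun s : ((Rd d × Bool) × Rd d) × (Rd d × Bool) => f (s.1.1, s.2) :=
        hf.comp (by fun_prop)
      exact (h2.lintegral_kernel_prod_right' (κ := signKernel.comap
        (fun s : (Rd d × Bool) × Rd d => K ω s.2) (hKω.comp measurable_snd))).aemeasurable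
  have hdiag : ∀ {g : Rd d → ℝ≥0∞}, Measurable g → ∫⁻ u, g u ∂diagMeasure Q =
      ∫⁻ q, (Set.diagonal (Rd d)).indicator (fun q => g q.1) q ∂pairMeasure Q :=
    fun hg => lintegral_diagMeasure Q hg
  have e2 : ∫⁻ q, f q ∂((diagMeasure Q).prod ((clusterMean L).prod (clusterMean L))).map
      translateBoth = ∫⁻ q, (Set.diagonal (Rd d)).indicator (fun q => J₂ (q.1, q.1)) q
        ∂pairMeasure Q := by
    rw [lintegral_map hf measurable_translateBoth, lintegral_prod _ hfb.aemeasurable,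
      ← hdiag (g := fun u => J₂ (u, u)) (hJ₂m.comp (by fun_prop))]
    exact lintegral_congr fun u => (hJ₂e (u, u)).symm
  have e3 : ∫⁻ q, f q ∂((pairMeasure Q).prod ((clusterMean L).prod (clusterMean L))).map
      translatePair = ∫⁻ q, J₂ q ∂pairMeasure Q := by
    rw [lintegral_map hf measurable_translatePair, lintegral_prod _ hfp.aemeasurable]
    exact lintegral_congr fun r => (hJ₂e r).symm
  have e4 : ∫⁻ q, f q ∂((diagMeasure Q).prod (clusterPair L)).map translateBoth =
      ∫⁻ q, (Set.diagonal (Rd d)).indicator (fun q => J₁ q.1) q ∂pairMeasure Q := by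
    rw [lintegral_map hf measurable_translateBoth, lintegral_prod _ hfb.aemeasurable, ← hdiag hJ₁m]
    exact lintegral_congr fun u => (hJ₁e u).symm
  have hi2 : Measurable ((Set.diagonal (Rd d)).indicator fun q : Rd d × Rd d => J₂ (q.1, q.1)) :=
    (hJ₂m.comp (by fun_prop)).indicator measurableSet_diagonal
  -- Everything is now an integral over `pairMeasure Q`. On the diagonal both sides have the
  -- integrand `J₁ + J₂`, off the diagonal only `J₂`.
  rw [lintegral_add_measure, lintegral_add_measure, e1, e2, e3, e4,
    ← lintegral_add_right _ hi2, ← lintegral_add_left hJ₂m]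
  refine lintegral_congr fun q => ?_
  by_cases hq : q.1 = q.2
  · have hq' : q ∈ Set.diagonal (Rd d) := hq
    rw [if_pos hq, Set.indicator_of_mem hq', Set.indicator_of_mem hq', add_comm]
    congr 2
    exact Prod.ext rfl hq
  · have hq' : q ∉ Set.diagonal (Rd d) := hq
    rw [if_neg hq, Set.indicator_of_notMem hq', Set.indicator_of_notMem hq']

end SecondOrder

/-! ### Local square integrability and signed representation of the cluster measure. -/

section ClusterProcess

variable {d : ℕ} {Ω : Type*} [MeasurableSpace Ω]

theorem absVariation_ge (m : Set (Rd d) → ℝ) {A B : Set (Rd d)} (hB : MeasurableSet B)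
    (hBA : B ⊆ A) : ENNReal.ofReal |m B| ≤ absVariation m A := by
  refine le_trans ?_ (le_iSup _ 1)
  refine le_trans ?_ (le_iSup₂ (fun _ : Fin 1 => B) fun _ => ⟨hB, hBA⟩)
  refine le_trans ?_ (le_iSup _ fun i j hij => absurd (Subsingleton.elim i j) hij)
  simp

/-- Square integrability is assumed on the unit ball only. A bounded set is covered by finitely many
translates of that ball, and `pairMeasure_shiftSet_le` bounds every pair of translates. -/
theorem pairMeasure_bounded_lt_top {P : Measure Ω} [IsProbabilityMeasure P]
    {Φ : Ω → Measure (Rd d)} (hΦ : IsPointProcess Φ)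
    (hstat : IsStationaryRandom P (toSigned Φ))
    (hsq : IsLocallySquareIntegrable P (toSigned Φ)) {B : Set (Rd d)}
    (hB : Bornology.IsBounded B) :
    pairMeasure (P.map (countingProcess hΦ)) (B ×ˢ B) < ∞ := by
  have hFm := measurable_countingProcess hΦ
  set Q := P.map (countingProcess hΦ) with hQ
  set U : Set (Rd d) := Metric.ball 0 1 with hU
  have hUm : MeasurableSet U := Metric.isOpen_ball.measurableSet
  have h1 : pairMeasure Q (U ×ˢ U) < ∞ := by
    have hm : Measurable fun ν : CountingMeasure d => ν.1 U :=
      (Measure.measurable_coe hUm).comp measurable_subtype_coe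
    have hmm : Measurable fun ν : CountingMeasure d => ν.1 U * ν.1 U := hm.mul hm
    rw [pairMeasure_prod Q U U hUm hUm, hQ, lintegral_map hmm hFm]
    refine lt_of_le_of_lt (lintegral_mono fun ω => ?_) hsq
    rw [sq]
    have h2 : (countingProcess hΦ ω).1 U ≤ absVariation (toSigned Φ ω) U := by
      refine le_trans (le_of_eq ?_) (absVariation_ge (toSigned Φ ω) hUm subset_rfl)
      rw [toSigned, abs_of_nonneg measureReal_nonneg, measureReal_def, ENNReal.ofReal_toReal]
      · rfl
      · exact ((countingProcess hΦ ω).finiteOnBounded U Metric.isBounded_ball).ne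
    exact mul_le_mul' h2 h2
  obtain ⟨t, ht⟩ := (hB.isCompact_closure).elim_finite_subcover
    (fun x : Rd d => Metric.ball x 1) (fun x => Metric.isOpen_ball)
    (fun x _ => Set.mem_iUnion.2 ⟨x, Metric.mem_ball_self one_pos⟩)
  have hsub : B ×ˢ B ⊆ ⋃ x ∈ t, ⋃ y ∈ t, shiftSet x U ×ˢ shiftSet y U := by
    have hmem : ∀ q ∈ B, ∃ x ∈ t, q ∈ shiftSet x U := by
      intro q hq
      obtain ⟨x, hx, hqx⟩ := Set.mem_iUnion₂.1 (ht (subset_closure hq))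
      exact ⟨x, hx, by simpa [shiftSet, hU, dist_eq_norm] using hqx⟩
    rintro ⟨q, q'⟩ ⟨hq, hq'⟩
    obtain ⟨x, hx, h⟩ := hmem q hq
    obtain ⟨y, hy, h'⟩ := hmem q' hq'
    exact Set.mem_biUnion hx (Set.mem_biUnion hy ⟨h, h'⟩)
  refine lt_of_le_of_lt (measure_mono hsub) (measure_biUnion_lt_top t.finite_toSet fun x _ => ?_)
  refine measure_biUnion_lt_top t.finite_toSet fun y _ => ?_
  exact (pairMeasure_shiftSet_le Q (map_shift_eq hΦ hstat) hUm x y).trans_lt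
    (ENNReal.mul_lt_top (by simp) h1)

theorem isFiniteMeasure_clusterPair {L : Measure (SignedMeasure (Rd d))}
    (hL : ∫⁻ m, signKernel m Set.univ ^ 2 ∂L < ∞) : IsFiniteMeasure (clusterPair L) := by
  refine ⟨?_⟩
  rw [← lintegral_one, clusterPair, lintegral_prod_comp _ _ measurable_const]
  simpa [sq] using hL

theorem isFiniteMeasure_clusterMean {L : Measure (SignedMeasure (Rd d))} [IsProbabilityMeasure L]
    (hL : ∫⁻ m, signKernel m Set.univ ^ 2 ∂L < ∞) : IsFiniteMeasure (clusterMean L) := by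
  refine ⟨?_⟩
  rw [← lintegral_one, clusterMean, lintegral_measure_comp _ _ measurable_const]
  have h1 : ∀ a : ℝ≥0∞, a ≤ 1 + a ^ 2 := fun a => by
    rcases le_total a 1 with h | h
    · exact h.trans le_self_add
    · exact (le_self_pow h two_ne_zero).trans le_add_self
  refine lt_of_le_of_lt (lintegral_mono fun m => ?_) (?_ :
    ∫⁻ m, (1 + signKernel m Set.univ ^ 2) ∂L < ∞)
  · simpa using h1 _
  · rw [lintegral_add_left measurable_const]
    simpa using hL

/-- For a fixed pair of cluster points, the base positions moving the first of them into `B` form a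
translate of `B`. Its mass under the stationary diagonal measure is that of `B`, and `T` is finite.
-/
theorem map_translateBoth_lt_top (Q : Measure (CountingMeasure d)) [IsProbabilityMeasure Q]
    (hQ : ∀ z, Q.map (CountingMeasure.shift z) = Q) {B : Set (Rd d)} (hB : MeasurableSet B)
    (hfin : pairMeasure Q (B ×ˢ B) < ∞) (T : Measure ((Rd d × Bool) × (Rd d × Bool)))
    [IsFiniteMeasure T] :
    ((diagMeasure Q).prod T).map translateBoth ((Prod.fst ⁻¹' B) ×ˢ (Prod.fst ⁻¹' B)) < ∞ := by
  have hC : MeasurableSet ((Prod.fst ⁻¹' B) ×ˢ (Prod.fst ⁻¹' B) :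
      Set ((Rd d × Bool) × (Rd d × Bool))) := (measurable_fst hB).prod (measurable_fst hB)
  rw [Measure.map_apply measurable_translateBoth hC,
    Measure.prod_apply_symm (measurable_translateBoth hC)]
  refine lt_of_le_of_lt (lintegral_mono fun q => (?_ : _ ≤ diagMeasure Q B)) ?_
  · rw [← diagMeasure_shiftSet Q hQ hB (-q.1.1)]
    refine measure_mono fun u hu => ?_
    have : q.1.1 + u ∈ B := hu.1
    simpa [shiftSet, add_comm] using this
  · rw [lintegral_const]
    exact ENNReal.mul_lt_top ((diagMeasure_le Q B hB).trans_lt hfin) (measure_lt_top _ _)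

/-- Here the two base positions range over two different translates of `B`, which is why the
factor-two bound for pairs is needed in place of exact invariance. -/
theorem map_translatePair_lt_top (Q : Measure (CountingMeasure d)) [IsProbabilityMeasure Q]
    (hQ : ∀ z, Q.map (CountingMeasure.shift z) = Q) {B : Set (Rd d)} (hB : MeasurableSet B)
    (hfin : pairMeasure Q (B ×ˢ B) < ∞) (T : Measure ((Rd d × Bool) × (Rd d × Bool)))
    [IsFiniteMeasure T] :
    ((pairMeasure Q).prod T).map translatePair ((Prod.fst ⁻¹' B) ×ˢ (Prod.fst ⁻¹' B)) < ∞ := by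
  have hC : MeasurableSet ((Prod.fst ⁻¹' B) ×ˢ (Prod.fst ⁻¹' B) :
      Set ((Rd d × Bool) × (Rd d × Bool))) := (measurable_fst hB).prod (measurable_fst hB)
  rw [Measure.map_apply measurable_translatePair hC,
    Measure.prod_apply_symm (measurable_translatePair hC)]
  refine lt_of_le_of_lt (lintegral_mono fun q => (?_ : _ ≤ 2 * pairMeasure Q (B ×ˢ B))) ?_
  · refine le_trans (measure_mono fun r hr => ?_)
      (pairMeasure_shiftSet_le Q hQ hB (-q.1.1) (-q.2.1))
    have h1 : q.1.1 + r.1 ∈ B := hr.1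
    have h2 : q.2.1 + r.2 ∈ B := hr.2
    exact ⟨by simpa [shiftSet, add_comm] using h1, by simpa [shiftSet, add_comm] using h2⟩
  · rw [lintegral_const]
    exact ENNReal.mul_lt_top (ENNReal.mul_lt_top (by simp) hfin) (measure_lt_top _ _)

/-- The correction on the left of `pair_identity` is nonnegative and can be dropped; both terms on
the right are finite on squares of bounded sets. -/
theorem HasIndependentClusters.pair_lt_top {P : Measure Ω} [IsProbabilityMeasure P]
    {Φ : Ω → Measure (Rd d)} (hΦ : IsPointProcess Φ)
    (hstat : IsStationaryRandom P (toSigned Φ))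
    (hsq : IsLocallySquareIntegrable P (toSigned Φ))
    {K : Ω → Rd d → SignedMeasure (Rd d)} (hK : Measurable (Function.uncurry K))
    {L : Measure (SignedMeasure (Rd d))} [IsProbabilityMeasure L]
    (h : HasIndependentClusters P Φ K L) (hL : ∫⁻ m, signKernel m Set.univ ^ 2 ∂L < ∞)
    {B : Set (Rd d)} (hB : Bornology.IsBounded B) (hBm : MeasurableSet B) :
    ((clusterKernel hΦ hK ×ₖ clusterKernel hΦ hK) ∘ₘ P)
      ((Prod.fst ⁻¹' B) ×ˢ (Prod.fst ⁻¹' B)) < ∞ := by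
  have := isFiniteMeasure_clusterPair hL
  have := isFiniteMeasure_clusterMean hL
  have : IsProbabilityMeasure (P.map (countingProcess hΦ)) :=
    Measure.isProbabilityMeasure_map (measurable_countingProcess hΦ).aemeasurable
  have hQ := map_shift_eq hΦ hstat
  have hfin := pairMeasure_bounded_lt_top hΦ hstat hsq hB
  have key := congrArg (fun m => m ((Prod.fst ⁻¹' B) ×ˢ (Prod.fst ⁻¹' B)))
    (h.pair_identity hΦ hK)
  simp only [Measure.add_apply] at key
  refine lt_of_le_of_lt (le_self_add.trans key.le) (ENNReal.add_lt_top.2 ⟨?_, ?_⟩)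
  · exact map_translatePair_lt_top _ hQ hBm hfin _
  · exact map_translateBoth_lt_top _ hQ hBm hfin _

theorem HasIndependentClusters.lintegral_sq_lt_top {P : Measure Ω} [IsProbabilityMeasure P]
    {Φ : Ω → Measure (Rd d)} (hΦ : IsPointProcess Φ)
    (hstat : IsStationaryRandom P (toSigned Φ))
    (hsq : IsLocallySquareIntegrable P (toSigned Φ))
    {K : Ω → Rd d → SignedMeasure (Rd d)} (hK : Measurable (Function.uncurry K))
    {L : Measure (SignedMeasure (Rd d))} [IsProbabilityMeasure L]
    (h : HasIndependentClusters P Φ K L) (hL : ∫⁻ m, signKernel m Set.univ ^ 2 ∂L < ∞)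
    {B : Set (Rd d)} (hB : Bornology.IsBounded B) (hBm : MeasurableSet B) :
    ∫⁻ ω, clusterKernel hΦ hK ω (Prod.fst ⁻¹' B) ^ 2 ∂P < ∞ := by
  refine lt_of_eq_of_lt ?_ (h.pair_lt_top hΦ hstat hsq hK hL hB hBm)
  rw [Measure.bind_apply ((measurable_fst hBm).prod (measurable_fst hBm)) (Kernel.aemeasurable _)]
  refine lintegral_congr fun ω => ?_
  rw [Kernel.prod_apply_prod, sq]

theorem clusterKernel_fst_preimage {Φ : Ω → Measure (Rd d)} (hΦ : IsPointProcess Φ)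
    {K : Ω → Rd d → SignedMeasure (Rd d)} (hK : Measurable (Function.uncurry K)) (ω : Ω)
    {B : Set (Rd d)} (hB : MeasurableSet B) :
    clusterKernel hΦ hK ω (Prod.fst ⁻¹' B) = ∫⁻ u, (K ω u).totalVariation B ∂Φ ω := by
  have hC : MeasurableSet (Prod.fst ⁻¹' B : Set (Rd d × Bool)) := measurable_fst hB
  rw [← lintegral_indicator_one hC, lintegral_clusterKernel hΦ hK ω (measurable_one.indicator hC)]
  refine lintegral_congr fun u => ?_
  rw [lintegral_indicator_one hC, ← signKernel_map_fst, Measure.map_apply measurable_fst hB]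

/-- Finite second moments give almost sure finiteness on each ball of integer radius. These
countably many null sets serve all bounded sets at once. -/
theorem HasIndependentClusters.ae_lintegral_totalVariation_lt_top {P : Measure Ω}
    [IsProbabilityMeasure P] {Φ : Ω → Measure (Rd d)} (hΦ : IsPointProcess Φ)
    (hstat : IsStationaryRandom P (toSigned Φ))
    (hsq : IsLocallySquareIntegrable P (toSigned Φ))
    {K : Ω → Rd d → SignedMeasure (Rd d)} (hK : Measurable (Function.uncurry K))
    {L : Measure (SignedMeasure (Rd d))} [IsProbabilityMeasure L]
    (h : HasIndependentClusters P Φ K L) (hL : ∫⁻ m, signKernel m Set.univ ^ 2 ∂L < ∞) :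
    ∀ᵐ ω ∂P, ∀ B : Set (Rd d), Bornology.IsBounded B → MeasurableSet B →
      ∫⁻ x, (K ω x).totalVariation B ∂Φ ω < ∞ := by
  have h1 : ∀ᵐ ω ∂P, ∀ n : ℕ, clusterKernel hΦ hK ω (Prod.fst ⁻¹' Metric.ball 0 n) < ∞ := by
    refine ae_all_iff.2 fun n => ?_
    have hm : MeasurableSet (Metric.ball (0 : Rd d) n) := Metric.isOpen_ball.measurableSet
    have h2 := ae_lt_top (((clusterKernel hΦ hK).measurable_coe (measurable_fst hm)).pow_const 2)
      (h.lintegral_sq_lt_top hΦ hstat hsq hK hL Metric.isBounded_ball hm).ne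
    filter_upwards [h2] with ω hω
    exact lt_of_le_of_ne le_top fun he => by simp [he] at hω
  filter_upwards [h1] with ω hω B hB hBm
  obtain ⟨r, hr⟩ := hB.subset_ball 0
  obtain ⟨n, hn⟩ := exists_nat_ge r
  rw [← clusterKernel_fst_preimage hΦ hK ω hBm]
  exact (measure_mono (Set.preimage_mono (hr.trans (Metric.ball_subset_ball hn)))).trans_lt (hω n)

/-- The positive (negative) part of a measure on `ℝ^d × {±}`. -/
noncomputable def signPart (b : Bool) (ξ : Measure (Rd d × Bool)) : Measure (Rd d) :=
  (ξ.restrict (Prod.snd ⁻¹' {b})).map Prod.fst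

theorem measurableSet_snd_preimage (b : Bool) :
    MeasurableSet (Prod.snd ⁻¹' {b} : Set (Rd d × Bool)) :=
  measurable_snd (measurableSet_singleton b)

theorem finiteOnBounded_signPart {ξ : Measure (Rd d × Bool)}
    (hξ : ∀ B : Set (Rd d), Bornology.IsBounded B → MeasurableSet B → ξ (Prod.fst ⁻¹' B) < ∞)
    (b : Bool) : FiniteOnBounded (signPart b ξ) := by
  intro B hB
  obtain ⟨r, hr⟩ := hB.subset_ball 0
  refine (measure_mono hr).trans_lt ?_
  have hm : MeasurableSet (Metric.ball (0 : Rd d) r) := Metric.isOpen_ball.measurableSet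
  rw [signPart, Measure.map_apply measurable_fst hm]
  exact (Measure.restrict_apply_le _ _).trans_lt (hξ _ Metric.isBounded_ball hm)

theorem integrable_of_isTestFunction {ξ : Measure (Rd d × Bool)}
    (hξ : ∀ B : Set (Rd d), Bornology.IsBounded B → MeasurableSet B → ξ (Prod.fst ⁻¹' B) < ∞)
    {f : Rd d → ℂ} (hf : IsTestFunction f) :
    Integrable (fun z => (signOf z.2 : ℂ) * f z.1) ξ := by
  obtain ⟨c, hc⟩ := hf.bounded
  have hS : MeasurableSet (Function.support f) := measurableSet_support hf.measurable
  have hm : Measurable fun z : Rd d × Bool => (signOf z.2 : ℂ) * f z.1 :=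
    (Complex.measurable_ofReal.comp (measurable_signOf.comp measurable_snd)).mul
      (hf.measurable.comp measurable_fst)
  rw [← integrableOn_iff_integrable_of_support_subset (s := Prod.fst ⁻¹' Function.support f)]
  · refine Measure.integrableOn_of_bounded (hξ _ hf.support hS).ne hm.aestronglyMeasurable
      (M := c) (Eventually.of_forall fun z => ?_)
    simpa using hc z.1
  · intro z hz
    exact right_ne_zero_of_mul hz

theorem integral_eq_signPart_sub {ξ : Measure (Rd d × Bool)} {F : Type*} [NormedAddCommGroup F]
    [NormedSpace ℝ F] {f : Rd d → F} (hfm : StronglyMeasurable f)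
    (hf : Integrable (fun z => signOf z.2 • f z.1) ξ) :
    ∫ z, signOf z.2 • f z.1 ∂ξ = (∫ x, f x ∂signPart true ξ) - ∫ x, f x ∂signPart false ξ := by
  rw [signPart, signPart, integral_map measurable_fst.aemeasurable hfm.aestronglyMeasurable,
    integral_map measurable_fst.aemeasurable hfm.aestronglyMeasurable,
    ← integral_add_compl (measurableSet_snd_preimage true) hf]
  have hc : (Prod.snd ⁻¹' {true} : Set (Rd d × Bool))ᶜ = Prod.snd ⁻¹' {false} := by
    ext z; cases h : z.2 <;> simp [h]
  rw [hc, sub_eq_add_neg, ← integral_neg]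
  congr 1
  · refine setIntegral_congr_fun (measurableSet_snd_preimage true) fun z hz => ?_
    have : z.2 = true := hz
    simp [this, signOf]
  · refine setIntegral_congr_fun (measurableSet_snd_preimage false) fun z hz => ?_
    have : z.2 = false := hz
    simp [this, signOf]

theorem isDifference_signPart {ξ : Measure (Rd d × Bool)}
    (hξ : ∀ B : Set (Rd d), Bornology.IsBounded B → MeasurableSet B → ξ (Prod.fst ⁻¹' B) < ∞)
    {m : Set (Rd d) → ℝ} (hm : ∀ B : Set (Rd d), Bornology.IsBounded B → MeasurableSet B →
      m B = ∫ z, signOf z.2 * B.indicator 1 z.1 ∂ξ) :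
    IsDifference m (signPart true ξ) (signPart false ξ) := by
  refine ⟨finiteOnBounded_signPart hξ _, finiteOnBounded_signPart hξ _, fun B hB hBm => ?_⟩
  rw [hm B hB hBm]
  have hsm : StronglyMeasurable (B.indicator (1 : Rd d → ℝ)) :=
    (measurable_one.indicator hBm).stronglyMeasurable
  have h1 := integral_eq_signPart_sub (ξ := ξ) (f := B.indicator (1 : Rd d → ℝ)) hsm ?_
  · rw [integral_indicator_one hBm, integral_indicator_one hBm] at h1
    exact h1
  · rw [← integrableOn_iff_integrable_of_support_subset (s := Prod.fst ⁻¹' B)]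
    · refine Measure.integrableOn_of_bounded (hξ _ hB hBm).ne ?_ (M := 1)
        (Eventually.of_forall fun z => ?_)
      · exact ((measurable_signOf.comp measurable_snd).stronglyMeasurable.smul
          (hsm.comp_measurable measurable_fst)).aestronglyMeasurable
      · rw [norm_smul, norm_signOf, one_mul]
        by_cases hz : z.1 ∈ B <;> simp [hz]
    · intro z hz
      by_contra hzB
      exact hz (by simp [Set.indicator_of_notMem (show z.1 ∉ B from hzB)])

/-- The two parts of `ξ` need not be mutually singular: positive mass of one cluster may sit on
negative mass of another. This is harmless because `signedIntegral` is independent of the chosen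
difference. -/
theorem signedIntegral_eq_integral {ξ : Measure (Rd d × Bool)}
    (hξ : ∀ B : Set (Rd d), Bornology.IsBounded B → MeasurableSet B → ξ (Prod.fst ⁻¹' B) < ∞)
    {m : Set (Rd d) → ℝ} (hm : ∀ B : Set (Rd d), Bornology.IsBounded B → MeasurableSet B →
      m B = ∫ z, signOf z.2 * B.indicator 1 z.1 ∂ξ) {f : Rd d → ℂ} (hf : IsTestFunction f) :
    signedIntegral m f = ∫ z, (signOf z.2 : ℂ) * f z.1 ∂ξ := by
  rw [signedIntegral_eq (isDifference_signPart hξ hm) hf,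
    ← integral_eq_signPart_sub hf.measurable.stronglyMeasurable]
  · rfl
  · exact integrable_of_isTestFunction hξ hf

theorem destination_eq_integral {Φ : Ω → Measure (Rd d)} (hΦ : IsPointProcess Φ)
    {K : Ω → Rd d → SignedMeasure (Rd d)} (hK : Measurable (Function.uncurry K)) {ω : Ω}
    {B : Set (Rd d)} (hBm : MeasurableSet B) (hB : clusterKernel hΦ hK ω (Prod.fst ⁻¹' B) < ∞) :
    destination K Φ ω B = ∫ z, signOf z.2 * B.indicator 1 z.1 ∂clusterKernel hΦ hK ω := by
  rw [integral_clusterKernel]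
  · exact integral_congr_ae (Eventually.of_forall fun u => signedMeasure_apply_eq_integral _ hBm)
  · rw [← integrableOn_iff_integrable_of_support_subset (s := Prod.fst ⁻¹' B)]
    · refine Measure.integrableOn_of_bounded hB.ne ?_ (M := 1) (Eventually.of_forall fun z => ?_)
      · exact ((measurable_signOf.comp measurable_snd).mul
          ((measurable_one.indicator hBm).comp measurable_fst)).aestronglyMeasurable
      · rw [norm_mul, norm_signOf, one_mul]
        by_cases hz : z.1 ∈ B <;> simp [hz]
    · intro z hz
      by_contra hzB
      exact hz (by simp [Set.indicator_of_notMem (show z.1 ∉ B from hzB)])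

theorem isRandomSignedMeasure_destination {P : Measure Ω} {Φ : Ω → Measure (Rd d)}
    (hΦ : IsPointProcess Φ) {K : Ω → Rd d → SignedMeasure (Rd d)}
    (hK : Measurable (Function.uncurry K))
    (hfin : ∀ᵐ ω ∂P, ∀ B : Set (Rd d), Bornology.IsBounded B → MeasurableSet B →
      ∫⁻ x, (K ω x).totalVariation B ∂Φ ω < ∞) :
    IsRandomSignedMeasure P (destination K Φ) := by
  refine ⟨fun B _ _ => measurable_destination hΦ hK B, ?_⟩
  filter_upwards [hfin] with ω hω
  have hω' : ∀ B : Set (Rd d), Bornology.IsBounded B → MeasurableSet B →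
      clusterKernel hΦ hK ω (Prod.fst ⁻¹' B) < ∞ := fun B hB hBm => by
    rw [clusterKernel_fst_preimage hΦ hK ω hBm]; exact hω B hB hBm
  exact ⟨_, _, isDifference_signPart hω' fun B hB hBm =>
    destination_eq_integral hΦ hK hBm (hω' B hB hBm)⟩

/-- Cancellation between clusters can only lower the variation. The bound holds for every `ω`, even
where the right side is infinite. -/
theorem absVariation_destination_le {Φ : Ω → Measure (Rd d)}
    (hΦ : IsPointProcess Φ) {K : Ω → Rd d → SignedMeasure (Rd d)}
    (hK : Measurable (Function.uncurry K)) (ω : Ω) (A : Set (Rd d)) :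
    absVariation (destination K Φ ω) A ≤ clusterKernel hΦ hK ω (Prod.fst ⁻¹' A) := by
  refine iSup_le fun n => iSup_le fun B => iSup_le fun hB => iSup_le fun hdisj => ?_
  have h1 : ∀ i, ENNReal.ofReal |destination K Φ ω (B i)| ≤
      clusterKernel hΦ hK ω (Prod.fst ⁻¹' B i) := fun i => by
    rw [clusterKernel_fst_preimage hΦ hK ω (hB i).1, ← Real.enorm_eq_ofReal_abs]
    refine (enorm_integral_le_lintegral_enorm _).trans (lintegral_mono fun x => ?_)
    exact (K ω x).enorm_le_totalVariation (B i)
  refine (Finset.sum_le_sum fun i _ => h1 i).trans ?_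
  rw [← tsum_fintype (L := .unconditional _), ← measure_iUnion]
  · exact measure_mono (Set.iUnion_subset fun i => Set.preimage_mono (hB i).2)
  · exact fun i j hij => (hdisj hij).preimage _
  · exact fun i => measurable_fst (hB i).1

/-- Invariance identifies `Φ(T_x ω)` with the translate of `Φ(ω)`, and a change of variables
finishes. Since translation is a measurable embedding, no integrability is involved and the identity
holds for every `ω`. -/
theorem isInvariantRandom_destination {Φ : Ω → Measure (Rd d)} (hΦ : IsPointProcess Φ)
    {K : Ω → Rd d → SignedMeasure (Rd d)} {T : Rd d → Ω → Ω}
    (hT : IsInvariantRandom T (toSigned Φ)) (hTK : IsInvariantKernel T K) :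
    IsInvariantRandom T (destination K Φ) := by
  intro x ω B _ hBm
  have h1 : Φ (T x ω) = (Φ ω).map fun y => y + x := by
    have h2 : Φ (T x ω) = ((countingProcess hΦ ω).shift x).1 := by
      refine FiniteOnBounded.ext fun A hA hAm => ?_
      have h3 := hT x ω (shiftSet (-x) A) (isBounded_shiftSet _ hA) (measurableSet_shiftSet _ hAm)
      rw [shiftSet_shiftSet, add_neg_cancel] at h3
      have h4 : shiftSet (0 : Rd d) A = A := by ext y; simp [shiftSet]
      have f1 : Φ (T x ω) A ≠ ∞ := ((countingProcess hΦ (T x ω)).finiteOnBounded A hA).ne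
      have f2 : Φ ω (shiftSet (-x) A) ≠ ∞ :=
        ((countingProcess hΦ ω).finiteOnBounded _ (isBounded_shiftSet _ hA)).ne
      rw [h4, toSigned, toSigned, measureReal_def, measureReal_def,
        ENNReal.toReal_eq_toReal_iff' f1 f2] at h3
      rw [h3, CountingMeasure.shift_val, Measure.map_apply (measurable_add_const x) hAm]
      simp only [shiftSet, sub_neg_eq_add]
      rfl
    exact h2
  rw [destination, destination, h1,
    MeasurableEmbedding.integral_map (measurableEmbedding_addRight x)]
  exact integral_congr_ae (Eventually.of_forall fun y => hTK x ω y B hBm)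

end ClusterProcess

/-! ### Second moment functional and translations of test functions. -/

section SecondMoment

variable {d : ℕ}

theorem measurableSet_unitCube : MeasurableSet (unitCube d) := by
  have : unitCube d = ⋂ i, (fun x : Rd d => x i) ⁻¹' Set.Ico (0 : ℝ) 1 := by
    ext x; simp [unitCube]
  rw [this]
  exact MeasurableSet.iInter fun i => measurableSet_Ico.preimage (by fun_prop)

theorem isBounded_unitCube : Bornology.IsBounded (unitCube d) := by
  refine (Metric.isBounded_iff_subset_closedBall 0).2 ⟨√d, fun x hx => ?_⟩
  rw [mem_closedBall_zero_iff, EuclideanSpace.norm_eq]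
  refine Real.sqrt_le_sqrt ?_
  have : ∀ i ∈ (Finset.univ : Finset (Fin d)), ‖x i‖ ^ 2 ≤ 1 := fun i _ => by
    have := hx i
    rw [Real.norm_eq_abs, abs_of_nonneg this.1]
    nlinarith [this.1, this.2]
  simpa using Finset.sum_le_sum this

/-- The integrand `1{x ∈ [0,1)^d} h(x - y)` of the reduced second moment measure. -/
noncomputable def pairFunction (h : Rd d → ℂ) (x y : Rd d) : ℂ :=
  (unitCube d).indicator (fun x => h (x - y)) x

theorem measurable_pairFunction {h : Rd d → ℂ} (hh : Measurable h) :
    Measurable fun q : Rd d × Rd d => pairFunction h q.1 q.2 := by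
  have : (fun q : Rd d × Rd d => pairFunction h q.1 q.2) =
      (Prod.fst ⁻¹' unitCube d).indicator fun q => h (q.1 - q.2) := by
    ext q
    by_cases hq : q.1 ∈ unitCube d <;> simp [pairFunction, hq]
  rw [this]
  exact (hh.comp (measurable_fst.sub measurable_snd)).indicator
    (measurableSet_unitCube.preimage measurable_fst)

theorem norm_pairFunction_le {h : Rd d → ℂ} {c : ℝ} (hc : ∀ x, ‖h x‖ ≤ c) (x y : Rd d) :
    ‖pairFunction h x y‖ ≤ c := by
  have h0 : 0 ≤ c := (norm_nonneg _).trans (hc 0)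
  by_cases hx : x ∈ unitCube d
  · simpa [pairFunction, hx] using hc _
  · simpa [pairFunction, hx] using h0

/-- The cube confines `x`, and the bounded support of `h` then confines `y = x - (x - y)`. Only the
mass on squares of bounded sets matters from here on. -/
theorem exists_pairFunction_support {h : Rd d → ℂ} (hh : IsTestFunction h) :
    ∃ R : ℝ, ∀ x y, pairFunction h x y ≠ 0 → x ∈ Metric.ball 0 R ∧ y ∈ Metric.ball 0 R := by
  obtain ⟨a, ha⟩ := (isBounded_unitCube (d := d)).subset_ball 0
  obtain ⟨b, hb⟩ := hh.support.subset_ball 0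
  refine ⟨max a (a + b), fun x y hxy => ?_⟩
  have hx : x ∈ unitCube d := by
    by_contra hx
    exact hxy (by simp [pairFunction, hx])
  have h1 : h (x - y) ≠ 0 := by simpa [pairFunction, hx] using hxy
  have h2 := mem_ball_zero_iff.1 (ha hx)
  have h3 := mem_ball_zero_iff.1 (hb h1)
  refine ⟨mem_ball_zero_iff.2 (h2.trans_le (le_max_left _ _)),
    mem_ball_zero_iff.2 (lt_of_lt_of_le ?_ (le_max_right _ _))⟩
  calc ‖y‖ = ‖x - (x - y)‖ := by rw [sub_sub_cancel]
    _ ≤ ‖x‖ + ‖x - y‖ := norm_sub_le _ _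
    _ < a + b := add_lt_add h2 h3

variable {E : Type*} [MeasurableSpace E] {pos : E → Rd d} {sg : E → ℝ}

/-- The integrand of the second moment of a signed measure represented by `sg · ξ`. -/
noncomputable def signedPairFunction (pos : E → Rd d) (sg : E → ℝ) (h : Rd d → ℂ) (q : E × E) : ℂ :=
  (sg q.1 : ℂ) * ((sg q.2 : ℂ) * pairFunction h (pos q.1) (pos q.2))

theorem measurable_signedPairFunction (hpos : Measurable pos) (hsg : Measurable sg)
    {h : Rd d → ℂ} (hh : Measurable h) : Measurable (signedPairFunction pos sg h) := by
  refine (Complex.measurable_ofReal.comp (hsg.comp measurable_fst)).mul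
    ((Complex.measurable_ofReal.comp (hsg.comp measurable_snd)).mul ?_)
  exact (measurable_pairFunction hh).comp
    ((hpos.comp measurable_fst).prodMk (hpos.comp measurable_snd))

theorem integrable_signedPairFunction (hpos : Measurable pos) (hsg : Measurable sg)
    (hsg1 : ∀ z, |sg z| ≤ 1) {h : Rd d → ℂ} (hh : IsTestFunction h) {T : Measure (E × E)}
    (hT : ∀ B : Set (Rd d), Bornology.IsBounded B → MeasurableSet B →
      T ((pos ⁻¹' B) ×ˢ (pos ⁻¹' B)) < ∞) :
    Integrable (signedPairFunction pos sg h) T := by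
  obtain ⟨R, hR⟩ := exists_pairFunction_support hh
  obtain ⟨c, hc⟩ := hh.bounded
  have hm : MeasurableSet (Metric.ball (0 : Rd d) R) := Metric.isOpen_ball.measurableSet
  rw [← integrableOn_iff_integrable_of_support_subset
    (s := (pos ⁻¹' Metric.ball 0 R) ×ˢ (pos ⁻¹' Metric.ball 0 R))]
  · refine Measure.integrableOn_of_bounded (hT _ Metric.isBounded_ball hm).ne
      (measurable_signedPairFunction hpos hsg hh.measurable).aestronglyMeasurable (M := c)
      (Eventually.of_forall fun q => ?_)
    rw [signedPairFunction, norm_mul, norm_mul, Complex.norm_real, Complex.norm_real,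
      Real.norm_eq_abs, Real.norm_eq_abs]
    have h1 := norm_pairFunction_le hc (pos q.1) (pos q.2)
    have h2 : |sg q.2| * ‖pairFunction h (pos q.1) (pos q.2)‖ ≤ c :=
      (mul_le_of_le_one_left (norm_nonneg _) (hsg1 _)).trans h1
    exact (mul_le_of_le_one_left (by positivity) (hsg1 _)).trans h2
  · intro q hq
    have := hR _ _ (right_ne_zero_of_mul (right_ne_zero_of_mul hq))
    exact ⟨this.1, this.2⟩

/-- The second moment of a random signed measure represented by a kernel. -/
theorem secondMoment_eq {Ω : Type*} [MeasurableSpace Ω] {P : Measure Ω} [SFinite P]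
    {Ψ : Ω → Set (Rd d) → ℝ} (Ξ : Kernel Ω E) [IsSFiniteKernel Ξ]
    (hpos : Measurable pos) (hsg : Measurable sg) (hsg1 : ∀ z, |sg z| ≤ 1)
    (hfin : ∀ B : Set (Rd d), Bornology.IsBounded B → MeasurableSet B →
      ((Ξ ×ₖ Ξ) ∘ₘ P) ((pos ⁻¹' B) ×ˢ (pos ⁻¹' B)) < ∞)
    (hΨ : ∀ᵐ ω ∂P, ∀ f, IsTestFunction f →
      signedIntegral (Ψ ω) f = ∫ z, (sg z : ℂ) * f (pos z) ∂Ξ ω)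
    {h : Rd d → ℂ} (hh : IsTestFunction h) :
    secondMoment P Ψ h = ∫ q, signedPairFunction pos sg h q ∂((Ξ ×ₖ Ξ) ∘ₘ P) := by
  -- The representing space `E` is kept abstract so that one computation covers `Φ` (points with
  -- sign one) and `KΦ` (points with a sign attached).
  rw [integral_measure_comp (integrable_signedPairFunction hpos hsg hsg1 hh hfin), secondMoment]
  obtain ⟨R, hR⟩ := exists_pairFunction_support hh
  obtain ⟨c, hc⟩ := hh.bounded
  have hae : ∀ᵐ ω ∂P, ∀ n : ℕ, Ξ ω (pos ⁻¹' Metric.ball 0 n) < ∞ := by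
    refine ae_all_iff.2 fun n => ?_
    have hm : MeasurableSet (pos ⁻¹' Metric.ball (0 : Rd d) n) :=
      hpos Metric.isOpen_ball.measurableSet
    have h1 := (hfin (Metric.ball 0 n) Metric.isBounded_ball Metric.isOpen_ball.measurableSet).ne
    rw [Measure.bind_apply (hm.prod hm) (Kernel.aemeasurable _)] at h1
    have h2 := ae_lt_top ((Ξ ×ₖ Ξ).measurable_coe (hm.prod hm)) h1
    filter_upwards [h2] with ω hω
    rw [Kernel.prod_apply_prod] at hω
    exact lt_of_le_of_ne le_top fun he => by simp [he] at hω
  refine integral_congr_ae ?_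
  filter_upwards [hΨ, hae] with ω hω hn
  have hfinω : ∀ B : Set (Rd d), Bornology.IsBounded B → Ξ ω (pos ⁻¹' B) < ∞ := fun B hB => by
    obtain ⟨r, hr⟩ := hB.subset_ball 0
    obtain ⟨n, hnr⟩ := exists_nat_ge r
    exact (measure_mono (Set.preimage_mono (hr.trans (Metric.ball_subset_ball hnr)))).trans_lt
      (hn n)
  have htest : ∀ x, IsTestFunction fun y => pairFunction h x y := fun x =>
    ⟨(measurable_pairFunction hh.measurable).comp measurable_prodMk_left,
      ⟨c, norm_pairFunction_le hc x⟩,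
      Metric.isBounded_ball.subset fun y hy => (hR x y hy).2⟩
  have hinner : ∀ x, signedIntegral (Ψ ω) (fun y => (unitCube d).indicator (fun x => h (x - y)) x) =
      ∫ z, (sg z : ℂ) * pairFunction h x (pos z) ∂Ξ ω := fun x => hω _ (htest x)
  simp_rw [hinner]
  have hm : Measurable fun q : Rd d × E => (sg q.2 : ℂ) * pairFunction h q.1 (pos q.2) :=
    (Complex.measurable_ofReal.comp (hsg.comp measurable_snd)).mul
      ((measurable_pairFunction hh.measurable).comp
        (measurable_fst.prodMk (hpos.comp measurable_snd)))
  -- The representation of `signedIntegral` is applied twice, so the result of the inner integration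
  -- must again be a bounded function with bounded support.
  have htest' : IsTestFunction fun x => ∫ z, (sg z : ℂ) * pairFunction h x (pos z) ∂Ξ ω := by
    refine ⟨(hm.stronglyMeasurable.integral_prod_right').measurable,
      ⟨c * (Ξ ω).real (pos ⁻¹' Metric.ball 0 R), fun x => ?_⟩, ?_⟩
    · rw [← setIntegral_eq_integral_of_forall_compl_eq_zero
        (s := pos ⁻¹' Metric.ball (0 : Rd d) R)]
      · refine norm_setIntegral_le_of_norm_le_const (hfinω _ Metric.isBounded_ball) fun z _ => ?_
        rw [norm_mul, Complex.norm_real]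
        exact (mul_le_of_le_one_left (norm_nonneg _) (hsg1 z)).trans
          (norm_pairFunction_le hc _ _)
      · intro z hz
        by_contra hne
        exact hz (hR _ _ (right_ne_zero_of_mul hne)).2
    · refine Metric.isBounded_ball.subset (t := Metric.ball 0 R) fun x hx => ?_
      by_contra hxR
      refine hx ?_
      have : ∀ z, (sg z : ℂ) * pairFunction h x (pos z) = 0 := fun z => by
        by_contra hne
        exact hxR (hR _ _ (right_ne_zero_of_mul hne)).1
      simp [this]
  rw [hω _ htest', Kernel.prod_apply, integral_prod]
  · refine integral_congr_ae (Eventually.of_forall fun z => ?_)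
    exact (integral_const_mul _ _).symm
  · refine integrable_signedPairFunction hpos hsg hsg1 hh fun B hB _ => ?_
    rw [Measure.prod_prod]
    exact ENNReal.mul_lt_top (hfinω B hB) (hfinω B hB)

/-- Displacing two points by `x` and `y` amounts to translating the two test functions. The class of
functions `f ⋆ g` is thus closed under the shifts produced by clusters. -/
theorem tiltedConv_add (f g : Rd d → ℂ) (x y z : Rd d) :
    tiltedConv (fun t => f (t + x)) (fun t => g (t + y)) z = tiltedConv f g (z + x - y) := by
  rw [tiltedConv, tiltedConv,
    ← integral_add_right_eq_self (μ := volume) (fun t => f t * (starRingEnd ℂ) (g (t - (z + x - y)))) x]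
  refine integral_congr_ae (Eventually.of_forall fun t => ?_)
  simp only
  congr 3
  abel

theorem IsTestFunction.comp_add {f : Rd d → ℂ} (hf : IsTestFunction f) (x : Rd d) :
    IsTestFunction fun t => f (t + x) := by
  refine ⟨hf.measurable.comp (measurable_add_const x), ?_, ?_⟩
  · obtain ⟨c, hc⟩ := hf.bounded
    exact ⟨c, fun t => hc _⟩
  · have h := isBounded_shiftSet (-x) hf.support
    exact h.subset fun t ht => by simpa [shiftSet] using ht

theorem isTestFunction_tiltedConv {f g : Rd d → ℂ} (hf : IsTestFunction f) (hg : IsTestFunction g) :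
    IsTestFunction (tiltedConv f g) := by
  have hm : Measurable fun q : Rd d × Rd d => f q.2 * (starRingEnd ℂ) (g (q.2 - q.1)) :=
    (hf.measurable.comp measurable_snd).mul
      (Complex.continuous_conj.measurable.comp (hg.measurable.comp
        (measurable_snd.sub measurable_fst)))
  obtain ⟨c, hc⟩ := hf.bounded
  obtain ⟨c', hc'⟩ := hg.bounded
  obtain ⟨a, ha⟩ := hf.support.subset_ball 0
  obtain ⟨b, hb⟩ := hg.support.subset_ball 0
  refine ⟨(hm.stronglyMeasurable.integral_prod_right').measurable,
    ⟨(c * c') * (volume : Measure (Rd d)).real (Metric.ball 0 a), fun y => ?_⟩, ?_⟩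
  · rw [tiltedConv, ← setIntegral_eq_integral_of_forall_compl_eq_zero (s := Metric.ball 0 a)]
    · refine norm_setIntegral_le_of_norm_le_const measure_ball_lt_top fun x _ => ?_
      rw [norm_mul, RCLike.norm_conj]
      exact mul_le_mul (hc _) (hc' _) (norm_nonneg _) ((norm_nonneg _).trans (hc 0))
    · intro x hx
      by_contra hne
      exact hx (ha (left_ne_zero_of_mul hne))
  · refine Metric.isBounded_ball.subset (t := Metric.ball 0 (a + b)) fun y hy => ?_
    by_contra hyR
    refine hy ?_
    have : ∀ x, f x * (starRingEnd ℂ) (g (x - y)) = 0 := fun x => by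
      by_contra hne
      have h1 := mem_ball_zero_iff.1 (ha (left_ne_zero_of_mul hne))
      have h2 := mem_ball_zero_iff.1 (hb (fun h0 : g (x - y) = 0 =>
        right_ne_zero_of_mul hne (by simp [h0])))
      refine hyR (mem_ball_zero_iff.2 ?_)
      calc ‖y‖ = ‖x - (x - y)‖ := by rw [sub_sub_cancel]
        _ ≤ ‖x‖ + ‖x - y‖ := norm_sub_le _ _
        _ < a + b := add_lt_add h1 h2
    simp [tiltedConv, this]

theorem fourierHat_add (f : Rd d → ℂ) (x k : Rd d) :
    fourierHat (fun t => f (t + x)) k =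
      Complex.exp (Complex.I * ((inner ℝ k x : ℝ) : ℂ)) * fourierHat f k := by
  rw [fourierHat, fourierHat, ← integral_const_mul,
    ← integral_add_right_eq_self (μ := volume) (fun t => Complex.exp (Complex.I *
      ((inner ℝ k x : ℝ) : ℂ)) * (Complex.exp (-Complex.I * ((inner ℝ k t : ℝ) : ℂ)) * f t)) x]
  refine integral_congr_ae (Eventually.of_forall fun t => ?_)
  simp only
  rw [← mul_assoc, ← Complex.exp_add, inner_add_right]
  congr 2
  push_cast
  ring

end SecondMoment

/-! ### Plancherel's theorem for bounded functions with bounded support. -/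

section Plancherel

open FourierTransform SchwartzMap

variable {d : ℕ}

/-- Conversion between the angular frequency convention and the factor `2π` in the exponent. This
rescaling is the source of the constant `(2π)^{-d}` in the spectral density. -/
theorem fourierHat_eq_fourier (f : Rd d → ℂ) (k : Rd d) :
    fourierHat f k = 𝓕 f ((2 * Real.pi)⁻¹ • k) := by
  rw [fourierHat, Real.fourier_eq']
  refine integral_congr_ae (Eventually.of_forall fun x => ?_)
  simp only [smul_eq_mul]
  congr 2
  rw [real_inner_comm, inner_smul_right]
  have : (Real.pi : ℂ) ≠ 0 := by exact_mod_cast Real.pi_ne_zero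
  simp
  field_simp

theorem continuous_fourier_of_integrable {f : Rd d → ℂ} (hf : Integrable f) :
    Continuous (𝓕 f) :=
  VectorFourier.fourierIntegral_continuous Real.continuous_fourierChar
    (innerSL ℝ (E := Rd d)).continuous₂ hf

/-- The Fourier transform on `L²` is given by the Fourier integral for integrable functions. -/
theorem coeFn_fourier_toLp {f : Rd d → ℂ} (hf : Integrable f) (hf2 : MemLp f 2) :
    ((𝓕 hf2.toLp : Lp ℂ 2 (volume : Measure (Rd d))) : Rd d → ℂ) =ᵐ[volume] 𝓕 f := by
  set F : Lp ℂ 2 (volume : Measure (Rd d)) := hf2.toLp with hF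
  refine ae_eq_of_integral_contDiff_smul_eq ?_ ?_ fun g hg hgs => ?_
  · exact (Lp.memLp (𝓕 F)).locallyIntegrable (by norm_num)
  · exact (continuous_fourier_of_integrable hf).locallyIntegrable
  · have hgs' : HasCompactSupport fun x => (g x : ℂ) :=
      hgs.comp_left (g := fun r : ℝ => (r : ℂ)) rfl
    have hg' : ContDiff ℝ ((⊤ : ℕ∞) : WithTop ℕ∞) fun x => (g x : ℂ) :=
      Complex.ofRealCLM.contDiff.comp hg
    set G : 𝓢(Rd d, ℂ) := hgs'.toSchwartzMap hg' with hG
    -- The `L²` transform agrees with the distributional one, which moves the transform onto the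
    -- Schwartz function `G`. Self-adjointness of the Fourier integral for integrable functions
    -- moves it back onto `f`.
    have h1 : (𝓕 (F : 𝓢'(Rd d, ℂ))) G = ((𝓕 F : Lp ℂ 2 (volume : Measure (Rd d))) :
        𝓢'(Rd d, ℂ)) G := by rw [Lp.fourier_toTemperedDistribution_eq]
    rw [TemperedDistribution.fourier_apply, Lp.toTemperedDistribution_apply,
      Lp.toTemperedDistribution_apply] at h1
    have h2 : ∫ x, (𝓕 G) x • F x = ∫ x, (𝓕 (G : Rd d → ℂ)) x • f x := by
      refine integral_congr_ae ?_
      filter_upwards [hf2.coeFn_toLp] with x hx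
      rw [hx]
      rfl
    have h3 : ∫ x, (𝓕 (G : Rd d → ℂ)) x • f x = ∫ x, G x • (𝓕 f) x := by
      have := VectorFourier.integral_fourierIntegral_smul_eq_flip (e := Real.fourierChar)
        (μ := (volume : Measure (Rd d))) (ν := (volume : Measure (Rd d)))
        (L := innerₗ (Rd d)) Real.continuous_fourierChar
        (innerSL ℝ (E := Rd d)).continuous₂ G.integrable hf
      rw [flip_innerₗ] at this
      exact this
    have h4 : ∀ u : Rd d → ℂ, ∫ x, g x • u x = ∫ x, G x • u x := fun u => rfl
    rw [h4, h4, ← h3, ← h2, h1]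

theorem integral_conj_eq_fourier {f g : Rd d → ℂ} (hf : Integrable f) (hf2 : MemLp f 2)
    (hg : Integrable g) (hg2 : MemLp g 2) :
    Integrable (fun k => 𝓕 f k * (starRingEnd ℂ) (𝓕 g k)) ∧
      ∫ k, 𝓕 f k * (starRingEnd ℂ) (𝓕 g k) = ∫ x, f x * (starRingEnd ℂ) (g x) := by
  have e1 := coeFn_fourier_toLp hf hf2
  have e2 := coeFn_fourier_toLp hg hg2
  have hae : (fun k => 𝓕 f k * (starRingEnd ℂ) (𝓕 g k)) =ᵐ[volume] fun k =>
      inner ℂ ((𝓕 hg2.toLp : Lp ℂ 2 (volume : Measure (Rd d))) k)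
        ((𝓕 hf2.toLp : Lp ℂ 2 (volume : Measure (Rd d))) k) := by
    filter_upwards [e1, e2] with k h1 h2
    rw [h1, h2]
    simp
  refine ⟨(L2.integrable_inner _ _).congr hae.symm, ?_⟩
  rw [integral_congr_ae hae, ← L2.inner_def, Lp.inner_fourier_eq, L2.inner_def]
  refine integral_congr_ae ?_
  filter_upwards [hf2.coeFn_toLp, hg2.coeFn_toLp] with x h1 h2
  rw [h1, h2]
  simp

theorem IsTestFunction.integrable_volume {f : Rd d → ℂ} (hf : IsTestFunction f) : Integrable f :=
  hf.integrable fun _ hB => hB.measure_lt_top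

theorem IsTestFunction.memLp_two {f : Rd d → ℂ} (hf : IsTestFunction f) : MemLp f 2 := by
  obtain ⟨c, hc⟩ := hf.bounded
  rw [memLp_two_iff_integrable_sq_norm hf.measurable.aestronglyMeasurable]
  refine (hf.integrable_volume.norm.const_mul c).mono'
    (hf.measurable.norm.pow_const 2).aestronglyMeasurable (Eventually.of_forall fun x => ?_)
  rw [Real.norm_of_nonneg (by positivity), sq]
  exact mul_le_mul_of_nonneg_right (hc x) (norm_nonneg _)

/-- Plancherel's theorem for bounded functions with bounded support. -/
theorem IsTestFunction.plancherel {f g : Rd d → ℂ} (hf : IsTestFunction f) (hg : IsTestFunction g) :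
    Integrable (fun k => fourierHat f k * (starRingEnd ℂ) (fourierHat g k)) ∧
      ∫ x, f x * (starRingEnd ℂ) (g x) =
        (((2 * Real.pi) ^ d)⁻¹ : ℝ) * ∫ k, fourierHat f k * (starRingEnd ℂ) (fourierHat g k) := by
  obtain ⟨h1, h2⟩ := integral_conj_eq_fourier hf.integrable_volume hf.memLp_two
    hg.integrable_volume hg.memLp_two
  have hpi : (2 * Real.pi)⁻¹ ≠ 0 := by positivity
  simp only [fourierHat_eq_fourier]
  refine ⟨h1.comp_smul hpi, ?_⟩
  have h3 := Measure.integral_comp_smul (volume : Measure (Rd d))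
    (fun k => 𝓕 f k * (starRingEnd ℂ) (𝓕 g k)) (2 * Real.pi)⁻¹
  rw [h3, h2, finrank_euclideanSpace_fin, Complex.real_smul, ← mul_assoc, ← Complex.ofReal_mul,
    abs_of_pos (by positivity)]
  have : ((2 * Real.pi) ^ d)⁻¹ * ((2 * Real.pi)⁻¹ ^ d)⁻¹ = 1 := by
    rw [inv_pow, inv_inv, inv_mul_cancel₀ (by positivity)]
  rw [this, Complex.ofReal_one, one_mul]

theorem continuous_fourierHat {f : Rd d → ℂ} (hf : Integrable f) : Continuous (fourierHat f) := by
  simp only [funext (fourierHat_eq_fourier f)]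
  exact (continuous_fourier_of_integrable hf).comp (continuous_const_smul _)

end Plancherel

/-! ### Intensity and covariance measure of the cluster measure. -/

section Covariance

variable {d : ℕ} {Ω : Type*} [MeasurableSpace Ω]

theorem abs_signOf_snd_le (z : Rd d × Bool) : |signOf z.2| ≤ 1 := by simp

theorem measurable_signOf_snd : Measurable fun z : Rd d × Bool => signOf z.2 :=
  measurable_signOf.comp measurable_snd

/-- A common translation does not change the difference of two positions. The base point enters only
through the condition that the first position lie in the cube, and by stationarity this has the same
mass for every pair. -/
theorem integral_map_translateBoth (Q : Measure (CountingMeasure d)) [IsProbabilityMeasure Q]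
    (hQ : ∀ z, Q.map (CountingMeasure.shift z) = Q)
    (hfin : ∀ B : Set (Rd d), Bornology.IsBounded B → pairMeasure Q (B ×ˢ B) < ∞)
    (T : Measure ((Rd d × Bool) × (Rd d × Bool))) [IsFiniteMeasure T]
    {h : Rd d → ℂ} (hh : IsTestFunction h) :
    ∫ q, signedPairFunction Prod.fst (fun z => signOf z.2) h q
        ∂((diagMeasure Q).prod T).map translateBoth =
      (diagMeasure Q).real (unitCube d) *
        ∫ q, (signOf q.1.2 : ℂ) * ((signOf q.2.2 : ℂ) * h (q.1.1 - q.2.1)) ∂T := by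
  have hm := measurable_signedPairFunction measurable_fst measurable_signOf_snd hh.measurable
  have hint : Integrable (signedPairFunction Prod.fst (fun z => signOf z.2) h)
      (((diagMeasure Q).prod T).map translateBoth) :=
    integrable_signedPairFunction measurable_fst measurable_signOf_snd abs_signOf_snd_le hh
      fun B hB hBm => map_translateBoth_lt_top Q hQ hBm (hfin B hB) T
  have hint' : Integrable (fun r => signedPairFunction Prod.fst (fun z => signOf z.2) h
      (translateBoth r)) ((diagMeasure Q).prod T) :=
    (integrable_map_measure hm.aestronglyMeasurable
      measurable_translateBoth.aemeasurable).1 hint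
  rw [integral_map measurable_translateBoth.aemeasurable hm.aestronglyMeasurable,
    integral_prod_symm _ hint', ← integral_const_mul]
  refine integral_congr_ae (Eventually.of_forall fun q => ?_)
  simp only
  rw [mul_comm, measureReal_def, ← diagMeasure_shiftSet Q hQ measurableSet_unitCube (-q.1.1)]
  have h1 : ∀ u, signedPairFunction Prod.fst (fun z => signOf z.2) h (translateBoth (u, q)) =
      (shiftSet (-q.1.1) (unitCube d)).indicator (fun _ =>
        (signOf q.1.2 : ℂ) * ((signOf q.2.2 : ℂ) * h (q.1.1 - q.2.1))) u := fun u => by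
    have e : u ∈ shiftSet (-q.1.1) (unitCube d) ↔ q.1.1 + u ∈ unitCube d := by
      simp [shiftSet, add_comm]
    by_cases hu : q.1.1 + u ∈ unitCube d
    · rw [Set.indicator_of_mem (e.2 hu)]
      simp [signedPairFunction, pairFunction, translateBoth, translateFst, hu]
    · rw [Set.indicator_of_notMem (fun hu' => hu (e.1 hu'))]
      simp [signedPairFunction, pairFunction, translateBoth, translateFst, hu]
  simp_rw [h1]
  rw [integral_indicator_const _ (measurableSet_shiftSet _ measurableSet_unitCube),
    Complex.real_smul, mul_comm]
  rfl

/-- The common part `x` of the two displacements is absorbed by stationarity of the pair measure,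
leaving only the relative displacement `x - y` inside `h`. -/
theorem integral_pairFunction_add (Q : Measure (CountingMeasure d)) [IsProbabilityMeasure Q]
    (hQ : ∀ z, Q.map (CountingMeasure.shift z) = Q)
    {h : Rd d → ℂ} (hh : Measurable h) (x y : Rd d) :
    ∫ r, pairFunction h (x + r.1) (y + r.2) ∂pairMeasure Q =
      ∫ r, pairFunction (fun z => h (z + x - y)) r.1 r.2 ∂pairMeasure Q := by
  have hs : Measurable fun q : Rd d × Rd d => (q.1 + x, q.2 + x) := by fun_prop
  conv_rhs => rw [← pairMeasure_map_add Q hQ x]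
  have hh' : Measurable fun z => h (z + x - y) :=
    hh.comp ((measurable_add_const x).sub_const y)
  rw [integral_map hs.aemeasurable (measurable_pairFunction hh').aestronglyMeasurable]
  refine integral_congr_ae (Eventually.of_forall fun r => ?_)
  simp only [pairFunction]
  rw [add_comm x r.1]
  by_cases hr : r.1 + x ∈ unitCube d
  · rw [Set.indicator_of_mem hr, Set.indicator_of_mem hr]
    congr 1
    abel
  · rw [Set.indicator_of_notMem hr, Set.indicator_of_notMem hr]

theorem integrable_map_translatePair (Q : Measure (CountingMeasure d)) [IsProbabilityMeasure Q]
    (hQ : ∀ z, Q.map (CountingMeasure.shift z) = Q)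
    (hfin : ∀ B : Set (Rd d), Bornology.IsBounded B → pairMeasure Q (B ×ˢ B) < ∞)
    (T : Measure ((Rd d × Bool) × (Rd d × Bool))) [IsFiniteMeasure T]
    {h : Rd d → ℂ} (hh : IsTestFunction h) :
    Integrable (fun r => signedPairFunction Prod.fst (fun z => signOf z.2) h (translatePair r))
      ((pairMeasure Q).prod T) := by
  have hm := measurable_signedPairFunction measurable_fst measurable_signOf_snd hh.measurable
  exact (integrable_map_measure hm.aestronglyMeasurable
    measurable_translatePair.aemeasurable).1
    (integrable_signedPairFunction measurable_fst measurable_signOf_snd abs_signOf_snd_le hh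
      fun B hB hBm => map_translatePair_lt_top Q hQ hBm (hfin B hB) T)

theorem integral_signedPairFunction_translatePair (Q : Measure (CountingMeasure d))
    [IsProbabilityMeasure Q] (hQ : ∀ z, Q.map (CountingMeasure.shift z) = Q)
    {h : Rd d → ℂ} (hh : IsTestFunction h) (q : (Rd d × Bool) × (Rd d × Bool)) :
    ∫ r, signedPairFunction Prod.fst (fun z => signOf z.2) h (translatePair (r, q))
        ∂pairMeasure Q =
      (signOf q.1.2 : ℂ) * ((signOf q.2.2 : ℂ) *
        ∫ r, pairFunction (fun z => h (z + q.1.1 - q.2.1)) r.1 r.2 ∂pairMeasure Q) := by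
  rw [← integral_pairFunction_add Q hQ hh.measurable, ← integral_const_mul, ← integral_const_mul]
  rfl

theorem pairMeasure_map_countingProcess {P : Measure Ω} {Φ : Ω → Measure (Rd d)}
    (hΦ : IsPointProcess Φ) :
    (countingKernel.comap (countingProcess hΦ) (measurable_countingProcess hΦ) ×ₖ
      countingKernel.comap (countingProcess hΦ) (measurable_countingProcess hΦ)) ∘ₘ P =
    pairMeasure (P.map (countingProcess hΦ)) := by
  refine Measure.ext_of_lintegral _ fun f hf => ?_
  have hJ : Measurable fun ν : CountingMeasure d => ∫⁻ u, ∫⁻ v, f (u, v) ∂ν.1 ∂ν.1 := by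
    have := Measurable.lintegral_kernel (κ := countingKernel (d := d) ×ₖ countingKernel) hf
    simp only [Kernel.lintegral_prod _ _ _ hf] at this
    exact this
  rw [lintegral_prod_comp _ _ hf, lintegral_pairMeasure _ hf,
    lintegral_map hJ (measurable_countingProcess hΦ)]
  rfl

theorem secondMoment_toSigned {P : Measure Ω} [IsProbabilityMeasure P] {Φ : Ω → Measure (Rd d)}
    (hΦ : IsPointProcess Φ)
    (hfin : ∀ B : Set (Rd d), Bornology.IsBounded B →
      pairMeasure (P.map (countingProcess hΦ)) (B ×ˢ B) < ∞)
    {h : Rd d → ℂ} (hh : IsTestFunction h) :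
    secondMoment P (toSigned Φ) h =
      ∫ r, pairFunction h r.1 r.2 ∂pairMeasure (P.map (countingProcess hΦ)) := by
  rw [secondMoment_eq (pos := id) (sg := fun _ => 1)
    (countingKernel.comap (countingProcess hΦ) (measurable_countingProcess hΦ)) measurable_id
    measurable_const (by simp) _ _ hh, pairMeasure_map_countingProcess]
  · refine integral_congr_ae (Eventually.of_forall fun r => ?_)
    simp [signedPairFunction]
  · intro B hB _
    rw [pairMeasure_map_countingProcess]
    exact hfin B hB
  · refine Eventually.of_forall fun ω f hf => ?_
    have hd : IsDifference (toSigned Φ ω) (Φ ω) 0 :=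
      ⟨fun B hB => (countingProcess hΦ ω).finiteOnBounded B hB, fun B _ => by simp,
        fun B _ _ => by simp [toSigned]⟩
    rw [signedIntegral_eq hd hf]
    simp only [integral_zero_measure, sub_zero, Complex.ofReal_one, one_mul, id]
    rfl

/-- The intensity measure of a random counting measure. -/
noncomputable def meanMeasure (Q : Measure (CountingMeasure d)) : Measure (Rd d) :=
  countingKernel ∘ₘ Q

instance (Q : Measure (CountingMeasure d)) [SFinite Q] : SFinite (meanMeasure Q) := by
  unfold meanMeasure; infer_instance

theorem meanMeasure_apply (Q : Measure (CountingMeasure d)) {B : Set (Rd d)}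
    (hB : MeasurableSet B) : meanMeasure Q B = ∫⁻ ν, ν.1 B ∂Q := by
  rw [meanMeasure, Measure.bind_apply hB (Kernel.aemeasurable _)]
  rfl

theorem meanMeasure_shiftSet (Q : Measure (CountingMeasure d))
    (hQ : ∀ z, Q.map (CountingMeasure.shift z) = Q) {B : Set (Rd d)} (hB : MeasurableSet B)
    (z : Rd d) : meanMeasure Q (shiftSet z B) = meanMeasure Q B := by
  rw [meanMeasure_apply Q hB, meanMeasure_apply Q (measurableSet_shiftSet z hB)]
  exact lintegral_mass_shiftSet Q hQ z hB id measurable_id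

theorem intensity_toSigned {P : Measure Ω} {Φ : Ω → Measure (Rd d)} (hΦ : IsPointProcess Φ) :
    intensity P (toSigned Φ) = (meanMeasure (P.map (countingProcess hΦ))).real (unitCube d) := by
  have hm : Measurable fun ν : CountingMeasure d => ν.1 (unitCube d) :=
    (Measure.measurable_coe measurableSet_unitCube).comp measurable_subtype_coe
  rw [intensity, measureReal_def, meanMeasure_apply _ measurableSet_unitCube,
    lintegral_map hm (measurable_countingProcess hΦ)]
  exact integral_toReal (hm.comp (measurable_countingProcess hΦ)).aemeasurable
    (Eventually.of_forall fun ω =>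
      (countingProcess hΦ ω).finiteOnBounded _ isBounded_unitCube)

theorem HasIndependentClusters.mean_identity {P : Measure Ω} [IsProbabilityMeasure P]
    {Φ : Ω → Measure (Rd d)} (hΦ : IsPointProcess Φ)
    {K : Ω → Rd d → SignedMeasure (Rd d)} (hK : Measurable (Function.uncurry K))
    {L : Measure (SignedMeasure (Rd d))} [IsProbabilityMeasure L]
    (h : HasIndependentClusters P Φ K L) :
    clusterKernel hΦ hK ∘ₘ P = ((meanMeasure (P.map (countingProcess hΦ))).prod
      (clusterMean L)).map fun q => translateFst q.1 q.2 := by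
  have : IsProbabilityMeasure (P.map (countingProcess hΦ)) :=
    Measure.isProbabilityMeasure_map (measurable_countingProcess hΦ).aemeasurable
  refine Measure.ext_of_lintegral _ fun f hf => ?_
  have hft : Measurable fun q : Rd d × (Rd d × Bool) => f (translateFst q.1 q.2) :=
    hf.comp measurable_translateFst
  have hg : Measurable (Function.uncurry fun (u : Rd d) (m : SignedMeasure (Rd d)) =>
      ∫⁻ z, f (translateFst u z) ∂signKernel m) := by
    have h1 : Measurable fun s : (Rd d × SignedMeasure (Rd d)) × (Rd d × Bool) =>
        f (translateFst s.1.1 s.2) :=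
      hft.comp ((measurable_fst.comp measurable_fst).prodMk measurable_snd)
    exact h1.lintegral_kernel_prod_right' (κ := signKernel.comap
      (Prod.snd : Rd d × SignedMeasure (Rd d) → _) measurable_snd)
  have e1 : ∀ ω, ∫⁻ z, f z ∂clusterKernel hΦ hK ω =
      ∫⁻ u, ∫⁻ z, f (translateFst u z) ∂signKernel (relKernel K ω u) ∂Φ ω := fun ω => by
    rw [lintegral_clusterKernel hΦ hK ω hf]
    refine lintegral_congr fun u => ?_
    rw [signKernel_eq_map_relKernel K ω u, lintegral_map hf (measurable_translateFst_right u)]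
  rw [lintegral_measure_comp _ _ hf, lintegral_congr e1, h.campbell hΦ hK hg,
    lintegral_map hf measurable_translateFst, lintegral_prod _ hft.aemeasurable,
    meanMeasure, lintegral_measure_comp _ _ hft.lintegral_prod_right']
  refine lintegral_congr fun ν => lintegral_congr fun u => ?_
  exact (lintegral_measure_comp _ _ (hft.comp measurable_prodMk_left)).symm

theorem lintegral_le_one_add_sq {P : Measure Ω} [IsProbabilityMeasure P] (f : Ω → ℝ≥0∞) :
    ∫⁻ ω, f ω ∂P ≤ 1 + ∫⁻ ω, f ω ^ 2 ∂P := by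
  have h1 : ∀ a : ℝ≥0∞, a ≤ 1 + a ^ 2 := fun a => by
    rcases le_total a 1 with h | h
    · exact h.trans le_self_add
    · exact (le_self_pow h two_ne_zero).trans le_add_self
  refine (lintegral_mono fun ω => h1 _).trans ?_
  rw [lintegral_add_left measurable_const]
  simp

/-- For a fixed cluster point, the base positions sending it into the cube form a translate of the
cube, whose mean mass is the intensity of `Φ`. Only the expected signed mass of the cluster remains.
-/
theorem HasIndependentClusters.intensity_destination {P : Measure Ω} [IsProbabilityMeasure P]
    {Φ : Ω → Measure (Rd d)} (hΦ : IsPointProcess Φ)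
    (hstat : IsStationaryRandom P (toSigned Φ))
    (hsq : IsLocallySquareIntegrable P (toSigned Φ))
    {K : Ω → Rd d → SignedMeasure (Rd d)} (hK : Measurable (Function.uncurry K))
    {L : Measure (SignedMeasure (Rd d))} [IsProbabilityMeasure L]
    (h : HasIndependentClusters P Φ K L) (hL : ∫⁻ m, signKernel m Set.univ ^ 2 ∂L < ∞) :
    intensity P (destination K Φ) =
      intensity P (toSigned Φ) * ∫ z, signOf z.2 ∂clusterMean L := by
  have := isFiniteMeasure_clusterMean hL
  have : IsProbabilityMeasure (P.map (countingProcess hΦ)) :=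
    Measure.isProbabilityMeasure_map (measurable_countingProcess hΦ).aemeasurable
  have hQ := map_shift_eq hΦ hstat
  set F : Rd d × Bool → ℝ := fun z => signOf z.2 * (unitCube d).indicator 1 z.1 with hF
  have hFm : Measurable F := measurable_signOf_snd.mul
    ((measurable_one.indicator measurableSet_unitCube).comp measurable_fst)
  have hC : MeasurableSet (Prod.fst ⁻¹' unitCube d : Set (Rd d × Bool)) :=
    measurable_fst measurableSet_unitCube
  have hint : Integrable F (clusterKernel hΦ hK ∘ₘ P) := by
    rw [← integrableOn_iff_integrable_of_support_subset (s := Prod.fst ⁻¹' unitCube d)]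
    · refine Measure.integrableOn_of_bounded ?_ hFm.aestronglyMeasurable (M := 1)
        (Eventually.of_forall fun z => ?_)
      · rw [Measure.bind_apply hC (Kernel.aemeasurable _)]
        refine ((lintegral_le_one_add_sq _).trans_lt (ENNReal.add_lt_top.2 ⟨by simp, ?_⟩)).ne
        exact h.lintegral_sq_lt_top hΦ hstat hsq hK hL isBounded_unitCube measurableSet_unitCube
      · rw [hF, norm_mul, norm_signOf, one_mul]
        by_cases hz : z.1 ∈ unitCube d <;> simp [hz]
    · intro z hz
      by_contra hzB
      exact hz (by simp [hF, Set.indicator_of_notMem (show z.1 ∉ unitCube d from hzB)])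
  have e1 : intensity P (destination K Φ) = ∫ z, F z ∂(clusterKernel hΦ hK ∘ₘ P) := by
    rw [integral_measure_comp hint, intensity]
    refine integral_congr_ae ?_
    filter_upwards [h.ae_lintegral_totalVariation_lt_top hΦ hstat hsq hK hL] with ω hω
    refine destination_eq_integral hΦ hK measurableSet_unitCube ?_
    rw [clusterKernel_fst_preimage hΦ hK ω measurableSet_unitCube]
    exact hω _ isBounded_unitCube measurableSet_unitCube
  rw [h.mean_identity hΦ hK] at hint e1
  have hint' : Integrable (fun q => F (translateFst q.1 q.2))
      ((meanMeasure (P.map (countingProcess hΦ))).prod (clusterMean L)) :=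
    (integrable_map_measure hFm.aestronglyMeasurable
      measurable_translateFst.aemeasurable).1 hint
  rw [e1, integral_map measurable_translateFst.aemeasurable hFm.aestronglyMeasurable,
    integral_prod_symm _ hint', intensity_toSigned hΦ, ← integral_const_mul]
  refine integral_congr_ae (Eventually.of_forall fun z => ?_)
  simp only
  have hz : ∀ u, F (translateFst u z) =
      (shiftSet (-z.1) (unitCube d)).indicator (fun _ => signOf z.2) u := fun u => by
    have e : u ∈ shiftSet (-z.1) (unitCube d) ↔ z.1 + u ∈ unitCube d := by
      simp [shiftSet, add_comm]
    by_cases hu : z.1 + u ∈ unitCube d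
    · rw [Set.indicator_of_mem (e.2 hu)]
      simp [hF, translateFst, hu]
    · rw [Set.indicator_of_notMem (fun hu' => hu (e.1 hu'))]
      simp [hF, translateFst, hu]
  simp_rw [hz]
  rw [integral_indicator_const _ (measurableSet_shiftSet _ measurableSet_unitCube), measureReal_def,
    meanMeasure_shiftSet _ hQ measurableSet_unitCube]
  rfl

/-- The covariance measure of a cluster process. -/
theorem HasIndependentClusters.covMeasure_destination {P : Measure Ω} [IsProbabilityMeasure P]
    {Φ : Ω → Measure (Rd d)} (hΦ : IsPointProcess Φ)
    (hstat : IsStationaryRandom P (toSigned Φ))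
    (hsq : IsLocallySquareIntegrable P (toSigned Φ))
    {K : Ω → Rd d → SignedMeasure (Rd d)} (hK : Measurable (Function.uncurry K))
    {L : Measure (SignedMeasure (Rd d))} [IsProbabilityMeasure L]
    (hcl : HasIndependentClusters P Φ K L) (hL : ∫⁻ m, signKernel m Set.univ ^ 2 ∂L < ∞)
    {h : Rd d → ℂ} (hh : IsTestFunction h) :
    covMeasure P (destination K Φ) h =
      ∫ q, (signOf q.1.2 : ℂ) * ((signOf q.2.2 : ℂ) *
        covMeasure P (toSigned Φ) fun z => h (z + q.1.1 - q.2.1))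
          ∂(clusterMean L).prod (clusterMean L) +
      (diagMeasure (P.map (countingProcess hΦ))).real (unitCube d) *
        (∫ q, (signOf q.1.2 : ℂ) * ((signOf q.2.2 : ℂ) * h (q.1.1 - q.2.1)) ∂clusterPair L -
          ∫ q, (signOf q.1.2 : ℂ) * ((signOf q.2.2 : ℂ) * h (q.1.1 - q.2.1))
            ∂(clusterMean L).prod (clusterMean L)) := by
  have := isFiniteMeasure_clusterMean hL
  have := isFiniteMeasure_clusterPair hL
  have : IsProbabilityMeasure (P.map (countingProcess hΦ)) :=
    Measure.isProbabilityMeasure_map (measurable_countingProcess hΦ).aemeasurable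
  have hQ := map_shift_eq hΦ hstat
  have hfin : ∀ B : Set (Rd d), Bornology.IsBounded B →
      pairMeasure (P.map (countingProcess hΦ)) (B ×ˢ B) < ∞ :=
    fun B hB => pairMeasure_bounded_lt_top hΦ hstat hsq hB
  have hint : ∀ T : Measure ((Rd d × Bool) × (Rd d × Bool)),
      (∀ B : Set (Rd d), Bornology.IsBounded B → MeasurableSet B →
        T ((Prod.fst ⁻¹' B) ×ˢ (Prod.fst ⁻¹' B)) < ∞) →
      Integrable (signedPairFunction Prod.fst (fun z : Rd d × Bool => signOf z.2) h) T :=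
    fun T hT => integrable_signedPairFunction measurable_fst measurable_signOf_snd
      abs_signOf_snd_le hh hT
  have hΘ : ∀ B : Set (Rd d), Bornology.IsBounded B → MeasurableSet B →
      ((clusterKernel hΦ hK ×ₖ clusterKernel hΦ hK) ∘ₘ P)
        ((Prod.fst ⁻¹' B) ×ˢ (Prod.fst ⁻¹' B)) < ∞ :=
    fun B hB hBm => hcl.pair_lt_top hΦ hstat hsq hK hL hB hBm
  have e1 : secondMoment P (destination K Φ) h = ∫ q, signedPairFunction Prod.fst
      (fun z : Rd d × Bool => signOf z.2) h q
        ∂((clusterKernel hΦ hK ×ₖ clusterKernel hΦ hK) ∘ₘ P) := by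
    refine secondMoment_eq (clusterKernel hΦ hK) measurable_fst measurable_signOf_snd
      abs_signOf_snd_le hΘ ?_ hh
    filter_upwards [hcl.ae_lintegral_totalVariation_lt_top hΦ hstat hsq hK hL] with ω hω f hf
    have hω' : ∀ B : Set (Rd d), Bornology.IsBounded B → MeasurableSet B →
        clusterKernel hΦ hK ω (Prod.fst ⁻¹' B) < ∞ := fun B hB hBm => by
      rw [clusterKernel_fst_preimage hΦ hK ω hBm]; exact hω B hB hBm
    exact signedIntegral_eq_integral hω' (fun B hB hBm =>
      destination_eq_integral hΦ hK hBm (hω' B hB hBm)) hf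
  -- The identity between positive measures is integrated against the signed function. All four
  -- pieces are finite on squares of bounded sets, so the integrals may be rearranged freely.
  have e2 := congrArg (fun T => ∫ q, signedPairFunction Prod.fst
    (fun z : Rd d × Bool => signOf z.2) h q ∂T) (hcl.pair_identity hΦ hK)
  have hmp := measurable_signedPairFunction (measurable_fst (α := Rd d) (β := Bool))
    measurable_signOf_snd hh.measurable
  rw [integral_add_measure (hint _ hΘ)
      (hint _ fun B hB hBm => map_translateBoth_lt_top _ hQ hBm (hfin B hB) _),
    integral_add_measure (hint _ fun B hB hBm => map_translatePair_lt_top _ hQ hBm (hfin B hB) _)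
      (hint _ fun B hB hBm => map_translateBoth_lt_top _ hQ hBm (hfin B hB) _),
    integral_map_translateBoth _ hQ hfin _ hh, integral_map_translateBoth _ hQ hfin _ hh,
    ← e1, integral_map measurable_translatePair.aemeasurable hmp.aestronglyMeasurable,
    integral_prod_symm _ (integrable_map_translatePair _ hQ hfin _ hh)] at e2
  have hI := (integrable_map_translatePair _ hQ hfin
    ((clusterMean L).prod (clusterMean L)) hh).integral_prod_right
  simp only [integral_signedPairFunction_translatePair _ hQ hh] at e2 hI
  have hht : ∀ q : (Rd d × Bool) × (Rd d × Bool),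
      IsTestFunction fun z => h (z + q.1.1 - q.2.1) := fun q => by
    have := hh.comp_add (q.1.1 - q.2.1)
    simpa only [add_sub_assoc] using this
  have e3 : ∀ q : (Rd d × Bool) × (Rd d × Bool),
      covMeasure P (toSigned Φ) (fun z => h (z + q.1.1 - q.2.1)) =
      ∫ r, pairFunction (fun z => h (z + q.1.1 - q.2.1)) r.1 r.2
        ∂pairMeasure (P.map (countingProcess hΦ)) -
      ((intensity P (toSigned Φ) : ℝ) : ℂ) ^ 2 * ∫ x, h x := fun q => by
    rw [covMeasure, secondMoment_toSigned hΦ hfin (hht q)]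
    congr 2
    rw [← integral_add_right_eq_self (μ := volume) h (q.1.1 - q.2.1)]
    simp only [add_sub_assoc]
  have hs : Integrable (fun z : Rd d × Bool => (signOf z.2 : ℂ)) (clusterMean L) :=
    Integrable.of_bound
      (Complex.measurable_ofReal.comp measurable_signOf_snd).aestronglyMeasurable 1
      (Eventually.of_forall fun z => by simp)
  have e4 : ∫ q, (signOf q.1.2 : ℂ) * ((signOf q.2.2 : ℂ) *
        covMeasure P (toSigned Φ) fun z => h (z + q.1.1 - q.2.1))
          ∂(clusterMean L).prod (clusterMean L) =
      ∫ q, (signOf q.1.2 : ℂ) * ((signOf q.2.2 : ℂ) *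
        ∫ r, pairFunction (fun z => h (z + q.1.1 - q.2.1)) r.1 r.2
          ∂pairMeasure (P.map (countingProcess hΦ))) ∂(clusterMean L).prod (clusterMean L) -
      ((intensity P (destination K Φ) : ℝ) : ℂ) ^ 2 * ∫ x, h x := by
    -- The intensity of `KΦ` is that of `Φ` times the mean signed mass of a cluster. Its square
    -- therefore distributes over pairs of independent cluster points and turns the second moment of
    -- `Φ` into its covariance.
    have e5 : ((intensity P (destination K Φ) : ℝ) : ℂ) ^ 2 * ∫ x, h x =
        ∫ q : (Rd d × Bool) × (Rd d × Bool), ((signOf q.1.2 : ℂ) * (signOf q.2.2 : ℂ)) *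
          (((intensity P (toSigned Φ) : ℝ) : ℂ) ^ 2 * ∫ x, h x)
          ∂(clusterMean L).prod (clusterMean L) := by
      rw [integral_mul_const, integral_prod_mul (fun z : Rd d × Bool => (signOf z.2 : ℂ))
        (fun z : Rd d × Bool => (signOf z.2 : ℂ)),
        hcl.intensity_destination hΦ hstat hsq hK hL, Complex.ofReal_mul, ← integral_complex_ofReal]
      ring
    rw [e5, ← integral_sub hI ((hs.mul_prod hs).mul_const _)]
    refine integral_congr_ae (Eventually.of_forall fun q => ?_)
    simp only [e3]
    ring
  rw [e4, covMeasure]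
  linear_combination e2

end Covariance

/-! ### The spectral measure of the cluster measure. -/

section SpectralMeasure

variable {d : ℕ}

/-- The character `x ↦ exp(i⟨k,x⟩)`. -/
noncomputable def planeWave (k x : Rd d) : ℂ := Complex.exp (Complex.I * ((inner ℝ k x : ℝ) : ℂ))

theorem measurable_planeWave {α : Type*} [MeasurableSpace α] {a b : α → Rd d} (ha : Measurable a)
    (hb : Measurable b) : Measurable fun x => planeWave (a x) (b x) :=
  ((Complex.measurable_ofReal.comp (ha.inner hb)).const_mul Complex.I).cexp

@[simp] theorem norm_planeWave (k x : Rd d) : ‖planeWave k x‖ = 1 := by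
  rw [planeWave, mul_comm, Complex.norm_exp_ofReal_mul_I]

theorem planeWave_sub (k x y : Rd d) :
    planeWave k (x - y) = planeWave k x * (starRingEnd ℂ) (planeWave k y) := by
  rw [planeWave, planeWave, planeWave, ← Complex.exp_conj, ← Complex.exp_add, inner_sub_right]
  congr 1
  simp only [map_mul, Complex.conj_I, Complex.conj_ofReal]
  push_cast
  ring

/-- The Fourier transform of a signed measure, represented by a measure on `ℝ^d × {±}`. -/
noncomputable def signedTransform (ξ : Measure (Rd d × Bool)) (k : Rd d) : ℂ :=
  ∫ z, (signOf z.2 : ℂ) * planeWave k z.1 ∂ξ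

theorem measurable_signOf_planeWave (k : Rd d) :
    Measurable fun z : Rd d × Bool => (signOf z.2 : ℂ) * planeWave k z.1 :=
  (Complex.measurable_ofReal.comp measurable_signOf_snd).mul
    (measurable_planeWave measurable_const measurable_fst)

theorem integrable_signOf_planeWave (ξ : Measure (Rd d × Bool)) [IsFiniteMeasure ξ] (k : Rd d) :
    Integrable (fun z => (signOf z.2 : ℂ) * planeWave k z.1) ξ :=
  Integrable.of_bound (measurable_signOf_planeWave k).aestronglyMeasurable 1
    (Eventually.of_forall fun z => by simp)

theorem norm_signedTransform_le (ξ : Measure (Rd d × Bool)) (k : Rd d) :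
    ‖signedTransform ξ k‖ ≤ ξ.real Set.univ := by
  refine (norm_integral_le_integral_norm _).trans ?_
  simp

/-- The integrand of the Fourier transform of a signed measure on pairs of points. -/
noncomputable def pairWave (k : Rd d) (q : (Rd d × Bool) × (Rd d × Bool)) : ℂ :=
  (signOf q.1.2 : ℂ) * ((signOf q.2.2 : ℂ) * planeWave k (q.1.1 - q.2.1))

theorem measurable_pairWave :
    Measurable fun r : Rd d × ((Rd d × Bool) × (Rd d × Bool)) => pairWave r.1 r.2 := by
  unfold pairWave
  refine (Complex.measurable_ofReal.comp (measurable_signOf.comp (by fun_prop))).mul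
    ((Complex.measurable_ofReal.comp (measurable_signOf.comp (by fun_prop))).mul ?_)
  exact measurable_planeWave measurable_fst (by fun_prop)

@[simp] theorem norm_pairWave (k : Rd d) (q : (Rd d × Bool) × (Rd d × Bool)) :
    ‖pairWave k q‖ = 1 := by
  simp [pairWave]

theorem integrable_pairWave (T : Measure ((Rd d × Bool) × (Rd d × Bool))) [IsFiniteMeasure T]
    (k : Rd d) : Integrable (pairWave k) T :=
  Integrable.of_bound (measurable_pairWave.comp measurable_prodMk_left).aestronglyMeasurable 1
    (Eventually.of_forall fun z => by simp)

/-- The Fourier transform of the differences of pairs of points. -/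
noncomputable def pairTransform (T : Measure ((Rd d × Bool) × (Rd d × Bool))) (k : Rd d) : ℂ :=
  ∫ q, pairWave k q ∂T

theorem measurable_pairTransform (T : Measure ((Rd d × Bool) × (Rd d × Bool))) [SFinite T] :
    Measurable (pairTransform T) :=
  (measurable_pairWave.stronglyMeasurable.integral_prod_right' (ν := T)).measurable

theorem norm_pairTransform_le (T : Measure ((Rd d × Bool) × (Rd d × Bool))) (k : Rd d) :
    ‖pairTransform T k‖ ≤ T.real Set.univ := by
  refine (norm_integral_le_integral_norm _).trans ?_
  simp

theorem pairWave_eq (k : Rd d) (q : (Rd d × Bool) × (Rd d × Bool)) :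
    pairWave k q = ((signOf q.1.2 : ℂ) * planeWave k q.1.1) *
      (starRingEnd ℂ) ((signOf q.2.2 : ℂ) * planeWave k q.2.1) := by
  rw [pairWave, planeWave_sub, map_mul, Complex.conj_ofReal]
  ring

theorem pairTransform_prod (ξ : Measure (Rd d × Bool)) [IsFiniteMeasure ξ] (k : Rd d) :
    pairTransform (ξ.prod ξ) k = ((‖signedTransform ξ k‖ ^ 2 : ℝ) : ℂ) := by
  simp only [pairTransform, pairWave_eq]
  rw [integral_prod_mul (fun z : Rd d × Bool => (signOf z.2 : ℂ) * planeWave k z.1)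
    (fun z : Rd d × Bool => (starRingEnd ℂ) ((signOf z.2 : ℂ) * planeWave k z.1)), integral_conj]
  rw [← signedTransform, Complex.mul_conj, Complex.normSq_eq_norm_sq]

theorem pairTransform_clusterPair {L : Measure (SignedMeasure (Rd d))}
    (hL : ∫⁻ m, signKernel m Set.univ ^ 2 ∂L < ∞) (k : Rd d) :
    pairTransform (clusterPair L) k =
      ∫ m, ((‖signedTransform (signKernel m) k‖ ^ 2 : ℝ) : ℂ) ∂L := by
  have := isFiniteMeasure_clusterPair hL
  have h := integrable_pairWave (clusterPair L) k
  rw [clusterPair] at h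
  rw [pairTransform, clusterPair, integral_measure_comp h]
  refine integral_congr_ae (Eventually.of_forall fun m => ?_)
  simp only [Kernel.prod_apply]
  exact pairTransform_prod _ k

theorem measurable_signedTransform_signKernel (k : Rd d) :
    Measurable fun m : SignedMeasure (Rd d) => signedTransform (signKernel m) k :=
  ((measurable_signOf_planeWave k).stronglyMeasurable.integral_kernel
    (κ := signKernel (d := d))).measurable

theorem integrable_norm_signedTransform_sq {L : Measure (SignedMeasure (Rd d))}
    (hL : ∫⁻ m, signKernel m Set.univ ^ 2 ∂L < ∞) (k : Rd d) :
    Integrable (fun m => ‖signedTransform (signKernel m) k‖ ^ 2) L := by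
  refine ⟨((measurable_signedTransform_signKernel k).norm.pow_const 2).aestronglyMeasurable, ?_⟩
  refine lt_of_le_of_lt (lintegral_mono fun m => ?_) hL
  rw [enorm_pow, enorm_norm]
  refine pow_le_pow_left' ?_ 2
  rw [← ofReal_norm, ← ENNReal.ofReal_toReal (measure_ne_top (signKernel m) Set.univ)]
  exact ENNReal.ofReal_le_ofReal (norm_signedTransform_le _ k)

theorem integrable_signedTransform {L : Measure (SignedMeasure (Rd d))} [IsProbabilityMeasure L]
    (hL : ∫⁻ m, signKernel m Set.univ ^ 2 ∂L < ∞) (k : Rd d) :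
    Integrable (fun m => signedTransform (signKernel m) k) L :=
  ((memLp_two_iff_integrable_sq_norm
    (measurable_signedTransform_signKernel k).aestronglyMeasurable).2
    (integrable_norm_signedTransform_sq hL k)).integrable (by norm_num)

theorem signedTransform_clusterMean {L : Measure (SignedMeasure (Rd d))} [IsProbabilityMeasure L]
    (hL : ∫⁻ m, signKernel m Set.univ ^ 2 ∂L < ∞) (k : Rd d) :
    signedTransform (clusterMean L) k = ∫ m, signedTransform (signKernel m) k ∂L := by
  have := isFiniteMeasure_clusterMean hL
  have h := integrable_signOf_planeWave (clusterMean L) k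
  rw [clusterMean] at h
  rw [signedTransform, clusterMean, integral_measure_comp h]
  rfl

/-- The variance of the Fourier transform of a random signed measure. -/
noncomputable def transformVariance (L : Measure (SignedMeasure (Rd d))) (k : Rd d) : ℝ :=
  ∫ m, ‖signedTransform (signKernel m) k - signedTransform (clusterMean L) k‖ ^ 2 ∂L

theorem transformVariance_nonneg (L : Measure (SignedMeasure (Rd d))) (k : Rd d) :
    0 ≤ transformVariance L k :=
  integral_nonneg fun m => by positivity

/-- This is `E|Z|² - |EZ|² = E|Z - EZ|²` for the random transform `Z`. It shows that the
same-cluster correction is a nonnegative density in Fourier space. -/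
theorem pairTransform_sub_eq {L : Measure (SignedMeasure (Rd d))} [IsProbabilityMeasure L]
    (hL : ∫⁻ m, signKernel m Set.univ ^ 2 ∂L < ∞) (k : Rd d) :
    pairTransform (clusterPair L) k - pairTransform ((clusterMean L).prod (clusterMean L)) k =
      (transformVariance L k : ℂ) := by
  have := isFiniteMeasure_clusterMean hL
  have hz := integrable_signedTransform hL k
  have hz2 : Integrable (fun m => ((‖signedTransform (signKernel m) k‖ ^ 2 : ℝ) : ℂ)) L :=
    (integrable_norm_signedTransform_sq hL k).ofReal
  rw [pairTransform_clusterPair hL, pairTransform_prod, transformVariance,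
    ← integral_complex_ofReal]
  set c := signedTransform (clusterMean L) k with hc
  have hc' : ∫ m, signedTransform (signKernel m) k ∂L = c :=
    (signedTransform_clusterMean hL k).symm
  have hconj : Integrable (fun m => (starRingEnd ℂ) (signedTransform (signKernel m) k)) L :=
    Complex.conjCLE.toContinuousLinearMap.integrable_comp hz
  have e : ∀ m : SignedMeasure (Rd d), ((‖signedTransform (signKernel m) k - c‖ ^ 2 : ℝ) : ℂ) =
      ((‖signedTransform (signKernel m) k‖ ^ 2 : ℝ) : ℂ) -
        (signedTransform (signKernel m) k * (starRingEnd ℂ) c +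
          c * (starRingEnd ℂ) (signedTransform (signKernel m) k) - ((‖c‖ ^ 2 : ℝ) : ℂ)) := fun m => by
    simp only [← Complex.normSq_eq_norm_sq, ← Complex.mul_conj, map_sub]
    ring
  simp_rw [e]
  have i1 : Integrable (fun m => signedTransform (signKernel m) k * (starRingEnd ℂ) c +
      c * (starRingEnd ℂ) (signedTransform (signKernel m) k)) L :=
    (hz.mul_const _).add (hconj.const_mul _)
  have i2 : Integrable (fun m => signedTransform (signKernel m) k * (starRingEnd ℂ) c +
      c * (starRingEnd ℂ) (signedTransform (signKernel m) k) - ((‖c‖ ^ 2 : ℝ) : ℂ)) L :=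
    i1.sub (integrable_const _)
  rw [integral_sub hz2 i2, integral_sub i1 (integrable_const _),
    integral_add (hz.mul_const _) (hconj.const_mul _), integral_mul_const, integral_const_mul,
    integral_conj, hc', integral_const]
  simp only [← Complex.normSq_eq_norm_sq, ← Complex.mul_conj]
  simp

theorem measurable_transformVariance {L : Measure (SignedMeasure (Rd d))} [IsProbabilityMeasure L]
    (hL : ∫⁻ m, signKernel m Set.univ ^ 2 ∂L < ∞) : Measurable (transformVariance L) := by
  have : transformVariance L = fun k => (pairTransform (clusterPair L) k -
      pairTransform ((clusterMean L).prod (clusterMean L)) k).re := by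
    ext k
    rw [pairTransform_sub_eq hL, Complex.ofReal_re]
  rw [this]
  exact Complex.measurable_re.comp
    ((measurable_pairTransform _).sub (measurable_pairTransform _))

theorem transformVariance_le {L : Measure (SignedMeasure (Rd d))} [IsProbabilityMeasure L]
    (hL : ∫⁻ m, signKernel m Set.univ ^ 2 ∂L < ∞) (k : Rd d) :
    transformVariance L k ≤ (clusterPair L).real Set.univ +
      ((clusterMean L).prod (clusterMean L)).real Set.univ := by
  have h := congrArg norm (pairTransform_sub_eq hL k)
  rw [Complex.norm_real, Real.norm_of_nonneg (transformVariance_nonneg L k)] at h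
  rw [← h]
  exact (norm_sub_le _ _).trans (add_le_add (norm_pairTransform_le _ _) (norm_pairTransform_le _ _))

/-- By Fubini, averaging shifts over pairs of cluster points multiplies the spectral integrand by
the transform of the pairs. It is used with the spectral measure of `Φ` and with Lebesgue measure.
-/
theorem integral_pairWave_mul (T : Measure ((Rd d × Bool) × (Rd d × Bool))) [IsFiniteMeasure T]
    (ν : Measure (Rd d)) [SFinite ν] {G : Rd d → ℂ} (hG : Integrable G ν) :
    ∫ q, (signOf q.1.2 : ℂ) * ((signOf q.2.2 : ℂ) *
        ∫ k, planeWave k (q.1.1 - q.2.1) * G k ∂ν) ∂T = ∫ k, pairTransform T k * G k ∂ν := by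
  have hint : Integrable (fun r : ((Rd d × Bool) × (Rd d × Bool)) × Rd d =>
      pairWave r.2 r.1 * G r.2) (T.prod ν) := by
    have hG' : Integrable (fun r : ((Rd d × Bool) × (Rd d × Bool)) × Rd d => G r.2) (T.prod ν) :=
      hG.comp_snd T
    refine hG'.bdd_mul (c := 1) (measurable_pairWave.comp measurable_swap).aestronglyMeasurable
      (Eventually.of_forall fun r => by simp)
  have e : ∀ q : (Rd d × Bool) × (Rd d × Bool), (signOf q.1.2 : ℂ) * ((signOf q.2.2 : ℂ) *
      ∫ k, planeWave k (q.1.1 - q.2.1) * G k ∂ν) = ∫ k, pairWave k q * G k ∂ν := fun q => by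
    rw [← integral_const_mul, ← integral_const_mul]
    simp only [pairWave, mul_assoc]
  simp_rw [e]
  rw [integral_integral_swap hint]
  refine integral_congr_ae (Eventually.of_forall fun k => ?_)
  exact integral_mul_const _ _

theorem FiniteOnBounded.sigmaFinite {ν : Measure (Rd d)} (hν : FiniteOnBounded ν) :
    SigmaFinite ν := by
  have : IsLocallyFiniteMeasure ν :=
    ⟨fun x => ⟨Metric.ball x 1, Metric.ball_mem_nhds x one_pos, hν _ Metric.isBounded_ball⟩⟩
  infer_instance

theorem tiltedConv_zero (f g : Rd d → ℂ) :
    tiltedConv f g 0 = ∫ x, f x * (starRingEnd ℂ) (g x) := by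
  simp [tiltedConv]

theorem fourierHat_add_mul_conj (f g : Rd d → ℂ) (x y k : Rd d) :
    fourierHat (fun t => f (t + x)) k * (starRingEnd ℂ) (fourierHat (fun t => g (t + y)) k) =
      planeWave k (x - y) * (fourierHat f k * (starRingEnd ℂ) (fourierHat g k)) := by
  rw [fourierHat_add, fourierHat_add, planeWave_sub, map_mul, planeWave, planeWave]
  ring

/-- Plancherel for translated functions: Lebesgue measure with the factor `(2π)^{-d}` is the
spectral measure of a unit mass at the origin. The same-cluster correction is a mixture of shifts of
this case. -/
theorem tiltedConv_eq_integral_fourier {f g : Rd d → ℂ} (hf : IsTestFunction f)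
    (hg : IsTestFunction g) (x y : Rd d) :
    tiltedConv f g (x - y) = (((2 * Real.pi) ^ d)⁻¹ : ℝ) *
      ∫ k, planeWave k (x - y) * (fourierHat f k * (starRingEnd ℂ) (fourierHat g k)) := by
  have h := tiltedConv_add f g x y 0
  rw [zero_add] at h
  rw [← h, tiltedConv_zero, ((hf.comp_add x).plancherel (hg.comp_add y)).2]
  simp only [fourierHat_add_mul_conj]

variable {Ω : Type*} [MeasurableSpace Ω]

theorem IsBartlettMeasure.covMeasure_tiltedConv_add {P : Measure Ω} {Ψ : Ω → Set (Rd d) → ℝ}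
    {ν : Measure (Rd d)} (hν : IsBartlettMeasure P Ψ ν) {f g : Rd d → ℂ} (hf : IsTestFunction f)
    (hg : IsTestFunction g) (x y : Rd d) :
    covMeasure P Ψ (fun z => tiltedConv f g (z + x - y)) =
      ∫ k, planeWave k (x - y) * (fourierHat f k * (starRingEnd ℂ) (fourierHat g k)) ∂ν := by
  have h : (fun z => tiltedConv f g (z + x - y)) =
      tiltedConv (fun t => f (t + x)) (fun t => g (t + y)) :=
    funext fun z => (tiltedConv_add f g x y z).symm
  rw [h, (hν.2 _ _ (hf.comp_add x) (hg.comp_add y)).2]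
  simp only [fourierHat_add_mul_conj]

/-- The Bartlett spectral measure of a cluster process. -/
noncomputable def clusterSpectralMeasure (c : ℝ) (ν : Measure (Rd d))
    (L : Measure (SignedMeasure (Rd d))) : Measure (Rd d) :=
  ν.withDensity (fun k => ENNReal.ofReal (‖signedTransform (clusterMean L) k‖ ^ 2)) +
    volume.withDensity (fun k => ENNReal.ofReal (c * transformVariance L k))

theorem measurable_signedTransform (ξ : Measure (Rd d × Bool)) [SFinite ξ] :
    Measurable (signedTransform ξ) := by
  have h : Measurable fun r : Rd d × (Rd d × Bool) => (signOf r.2.2 : ℂ) * planeWave r.1 r.2.1 :=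
    (Complex.measurable_ofReal.comp (measurable_signOf.comp (by fun_prop))).mul
      (measurable_planeWave measurable_fst (by fun_prop))
  exact (h.stronglyMeasurable.integral_prod_right' (ν := ξ)).measurable

theorem clusterSpectralMeasure_le {c : ℝ} (hc : 0 ≤ c) (ν : Measure (Rd d))
    {L : Measure (SignedMeasure (Rd d))} {B : Set (Rd d)} (hB : MeasurableSet B)
    {b : ℝ} (hb : ∀ k ∈ B, transformVariance L k ≤ b) :
    clusterSpectralMeasure c ν L B ≤
      ENNReal.ofReal ((clusterMean L).real Set.univ ^ 2) * ν B +
        ENNReal.ofReal (c * b) * volume B := by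
  rw [clusterSpectralMeasure, Measure.add_apply, withDensity_apply _ hB, withDensity_apply _ hB]
  refine add_le_add ?_ ?_
  · rw [← setLIntegral_const]
    refine lintegral_mono fun k => ENNReal.ofReal_le_ofReal ?_
    exact pow_le_pow_left₀ (norm_nonneg _) (norm_signedTransform_le _ _) 2
  · rw [← setLIntegral_const]
    refine setLIntegral_mono' hB fun k hk => ENNReal.ofReal_le_ofReal ?_
    exact mul_le_mul_of_nonneg_left (hb k hk) hc

/-- In the covariance formula for `f ⋆ g`, the independent pairs multiply the spectrum of `Φ` by the
squared modulus of the mean transform. The two same-cluster terms pass through Plancherel, and their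
difference has the variance as density. -/
theorem HasIndependentClusters.isBartlettMeasure {P : Measure Ω} [IsProbabilityMeasure P]
    {Φ : Ω → Measure (Rd d)} (hΦ : IsPointProcess Φ)
    (hstat : IsStationaryRandom P (toSigned Φ))
    (hsq : IsLocallySquareIntegrable P (toSigned Φ))
    {K : Ω → Rd d → SignedMeasure (Rd d)} (hK : Measurable (Function.uncurry K))
    {L : Measure (SignedMeasure (Rd d))} [IsProbabilityMeasure L]
    (hcl : HasIndependentClusters P Φ K L) (hL : ∫⁻ m, signKernel m Set.univ ^ 2 ∂L < ∞)
    {ν : Measure (Rd d)} (hν : IsBartlettMeasure P (toSigned Φ) ν) :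
    IsBartlettMeasure P (destination K Φ) (clusterSpectralMeasure
      ((diagMeasure (P.map (countingProcess hΦ))).real (unitCube d) * ((2 * Real.pi) ^ d)⁻¹) ν L) := by
  have := isFiniteMeasure_clusterMean hL
  have := isFiniteMeasure_clusterPair hL
  have := hν.1.sigmaFinite
  set γ := (diagMeasure (P.map (countingProcess hΦ))).real (unitCube d) with hγ
  set c := γ * ((2 * Real.pi) ^ d)⁻¹ with hc
  have hc0 : 0 ≤ c := by positivity
  refine ⟨fun B hB => ?_, fun f g hf hg => ?_⟩
  · obtain ⟨r, hr⟩ := hB.subset_ball 0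
    refine (measure_mono hr).trans_lt ((clusterSpectralMeasure_le hc0 ν
      Metric.isOpen_ball.measurableSet fun k _ => transformVariance_le hL k).trans_lt ?_)
    exact ENNReal.add_lt_top.2 ⟨ENNReal.mul_lt_top ENNReal.ofReal_lt_top
      (hν.1 _ Metric.isBounded_ball), ENNReal.mul_lt_top ENNReal.ofReal_lt_top measure_ball_lt_top⟩
  set G : Rd d → ℂ := fun k => fourierHat f k * (starRingEnd ℂ) (fourierHat g k) with hG
  have hGν : Integrable G ν := (hν.2 f g hf hg).1
  have hGv : Integrable G := (hf.plancherel hg).1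
  have hm1 : Measurable fun k => ENNReal.ofReal (‖signedTransform (clusterMean L) k‖ ^ 2) :=
    ((measurable_signedTransform _).norm.pow_const 2).ennreal_ofReal
  have hm2 : Measurable fun k => ENNReal.ofReal (c * transformVariance L k) :=
    ((measurable_transformVariance hL).const_mul c).ennreal_ofReal
  have e1 : ∀ k, (ENNReal.ofReal (‖signedTransform (clusterMean L) k‖ ^ 2)).toReal • G k =
      pairTransform ((clusterMean L).prod (clusterMean L)) k * G k := fun k => by
    rw [ENNReal.toReal_ofReal (by positivity), pairTransform_prod, Complex.real_smul]
  have e2 : ∀ k, (ENNReal.ofReal (c * transformVariance L k)).toReal • G k =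
      (c : ℂ) * ((transformVariance L k : ℂ) * G k) := fun k => by
    rw [ENNReal.toReal_ofReal (mul_nonneg hc0 (transformVariance_nonneg _ _)), Complex.real_smul,
      Complex.ofReal_mul, mul_assoc]
  have hT : ∀ (T : Measure ((Rd d × Bool) × (Rd d × Bool))) [IsFiniteMeasure T]
      (ρ : Measure (Rd d)), Integrable G ρ → Integrable (fun k => pairTransform T k * G k) ρ :=
    fun T _ ρ h => h.bdd_mul (c := T.real Set.univ)
      (measurable_pairTransform T).aestronglyMeasurable
      (Eventually.of_forall fun k => norm_pairTransform_le T k)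
  have hV : Integrable (fun k => (transformVariance L k : ℂ) * G k) := by
    simp_rw [← pairTransform_sub_eq hL, sub_mul]
    exact (hT _ _ hGv).sub (hT _ _ hGv)
  have i1 : Integrable G (ν.withDensity fun k =>
      ENNReal.ofReal (‖signedTransform (clusterMean L) k‖ ^ 2)) := by
    rw [integrable_withDensity_iff_integrable_smul' hm1
      (Eventually.of_forall fun _ => ENNReal.ofReal_lt_top)]
    simp_rw [e1]
    exact hT _ _ hGν
  have i2 : Integrable G (volume.withDensity fun k =>
      ENNReal.ofReal (c * transformVariance L k)) := by
    rw [integrable_withDensity_iff_integrable_smul' hm2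
      (Eventually.of_forall fun _ => ENNReal.ofReal_lt_top)]
    simp_rw [e2]
    exact hV.const_mul _
  refine ⟨i1.add_measure i2, ?_⟩
  rw [clusterSpectralMeasure, integral_add_measure i1 i2,
    integral_withDensity_eq_integral_toReal_smul hm1
      (Eventually.of_forall fun _ => ENNReal.ofReal_lt_top),
    integral_withDensity_eq_integral_toReal_smul hm2
      (Eventually.of_forall fun _ => ENNReal.ofReal_lt_top)]
  simp_rw [e1, e2]
  rw [hcl.covMeasure_destination hΦ hstat hsq hK hL (isTestFunction_tiltedConv hf hg)]
  simp_rw [hν.covMeasure_tiltedConv_add hf hg]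
  rw [integral_pairWave_mul _ _ hGν]
  congr 1
  have e3 : ∀ (T : Measure ((Rd d × Bool) × (Rd d × Bool))) [IsFiniteMeasure T],
      ∫ q, (signOf q.1.2 : ℂ) * ((signOf q.2.2 : ℂ) * tiltedConv f g (q.1.1 - q.2.1)) ∂T =
        (((2 * Real.pi) ^ d)⁻¹ : ℝ) * ∫ k, pairTransform T k * G k := fun T _ => by
    rw [← integral_pairWave_mul _ _ hGv, ← integral_const_mul]
    refine integral_congr_ae (Eventually.of_forall fun q => ?_)
    simp only
    rw [tiltedConv_eq_integral_fourier hf hg]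
    ring
  rw [e3, e3, ← mul_sub, ← integral_sub (hT _ _ hGv) (hT _ _ hGv), integral_const_mul, hc,
    Complex.ofReal_mul, mul_assoc]
  simp_rw [← sub_mul, pairTransform_sub_eq hL]
  rfl

end SpectralMeasure

/-! ### Polarization of homogeneous polynomials. -/

section Polarization

/-- The polarization identity for products. -/
theorem factorial_mul_prod_eq_sum_pow {R : Type*} [CommRing R] (p : ℕ) (y : Fin p → R) :
    (p.factorial : R) * ∏ i, y i =
      ∑ S : Finset (Fin p), (-1) ^ (Finset.card Sᶜ) * (∑ i ∈ S, y i) ^ p := by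
  classical
  have h1 : ∀ S : Finset (Fin p), (∑ i ∈ S, y i) ^ p =
      ∑ f : Fin p → Fin p, (if ∀ i, f i ∈ S then ∏ i, y (f i) else 0) := fun S => by
    have : ∑ i ∈ S, y i = ∑ i, if i ∈ S then y i else 0 := by simp
    rw [this, Fintype.sum_pow]
    refine Finset.sum_congr rfl fun f _ => ?_
    rw [Finset.prod_ite_zero]
    simp
  have h2 : ∀ f : Fin p → Fin p, ∑ S : Finset (Fin p),
      (-1 : R) ^ (Finset.card Sᶜ) * (if ∀ i, f i ∈ S then ∏ i, y (f i) else 0) =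
        if Function.Surjective f then ∏ i, y (f i) else 0 := fun f => by
    -- Inclusion-exclusion: the alternating sum over the sets containing the range of `f` is the
    -- expansion of a product that vanishes as soon as some index is missed.
    have h3 : ∏ a : Fin p, ((1 : R) + -(if a ∈ Set.range f then 0 else 1)) =
        if Function.Surjective f then 1 else 0 := by
      have : ∀ a : Fin p, ((1 : R) + -(if a ∈ Set.range f then 0 else 1)) =
          if a ∈ Set.range f then 1 else 0 := fun a => by split_ifs <;> simp
      simp_rw [this]
      rw [Finset.prod_ite_zero]
      simp only [Finset.mem_univ, Set.mem_range, forall_const, Finset.prod_const_one,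
        Function.Surjective]
      congr
    rw [Finset.prod_add, Finset.powerset_univ] at h3
    have h4 : (if Function.Surjective f then ∏ i, y (f i) else 0) =
        (if Function.Surjective f then 1 else 0) * ∏ i, y (f i) := by simp
    rw [h4, ← h3, Finset.sum_mul]
    refine Finset.sum_congr rfl fun S _ => ?_
    rw [Finset.prod_const_one, one_mul, Finset.prod_neg, ← Finset.compl_eq_univ_sdiff,
      mul_assoc]
    congr 1
    have h5 : ∏ a ∈ Sᶜ, (if a ∈ Set.range f then (0 : R) else 1) =
        if ∀ i, f i ∈ S then 1 else 0 := by
      have : ∀ a, (if a ∈ Set.range f then (0 : R) else 1) =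
          if a ∉ Set.range f then 1 else 0 := fun a => by split_ifs <;> simp_all
      simp_rw [this]
      rw [Finset.prod_ite_zero]
      simp only [Finset.prod_const_one]
      refine if_congr ⟨fun h i => ?_, fun h a ha hr => ?_⟩ rfl rfl
      · by_contra hi
        exact h (f i) (Finset.mem_compl.2 hi) ⟨i, rfl⟩
      · obtain ⟨i, rfl⟩ := hr
        exact Finset.mem_compl.1 ha (h i)
    rw [h5]
    simp
  simp_rw [h1, Finset.mul_sum]
  rw [Finset.sum_comm]
  simp_rw [h2]
  rw [← Finset.sum_filter]
  -- A surjective self-map of a finite set is a permutation, so the surviving terms are equal and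
  -- there are `p!` of them.
  have h6 : ∀ f ∈ Finset.univ.filter (fun f : Fin p → Fin p => Function.Surjective f),
      ∏ i, y (f i) = ∏ i, y i := fun f hf => by
    have hs := (Finset.mem_filter.1 hf).2
    exact Fintype.prod_bijective f (Finite.surjective_iff_bijective.1 hs) _ _ fun _ => rfl
  rw [Finset.sum_congr rfl h6, Finset.sum_const, nsmul_eq_mul]
  congr 2
  rw [← Fintype.card_subtype]
  have e : {f : Fin p → Fin p // Function.Surjective f} ≃ Equiv.Perm (Fin p) :=
    { toFun := fun f => Equiv.ofBijective f.1 (Finite.surjective_iff_bijective.1 f.2)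
      invFun := fun σ => ⟨σ, σ.surjective⟩
      left_inv := fun f => rfl
      right_inv := fun σ => by ext; rfl }
  rw [Fintype.card_congr e, Fintype.card_perm, Fintype.card_fin]

end Polarization

/-! ### Taylor expansion of the Fourier transform and directional moments. -/

section Taylor

/-- The remainder of the Taylor expansion of `exp(is)`. -/
noncomputable def expRemainder (p : ℕ) (s : ℝ) : ℂ :=
  Complex.exp (Complex.I * s) - ∑ q ∈ Finset.range p, (Complex.I * s) ^ q / (q.factorial : ℂ)

theorem continuous_expRemainder (p : ℕ) : Continuous (expRemainder p) := by
  unfold expRemainder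
  fun_prop

/-- For `|s| ≤ 1` the tail of the series gives the constant `e ≤ 3`. For `|s| ≥ 1` the exponential
contributes `1` and the Taylor polynomial at most `e |s|^p`, whence `4`. The bound is global and has
exponent `p`, so moments of order `p` suffice later. -/
theorem norm_expRemainder_le (p : ℕ) (s : ℝ) : ‖expRemainder p s‖ ≤ 4 * |s| ^ p := by
  have hn : ‖Complex.I * (s : ℂ)‖ = |s| := by simp
  have he : Real.exp 1 ≤ 3 := (Real.exp_one_lt_d9.trans (by norm_num)).le
  rcases le_total |s| 1 with h | h
  · have h1 := Complex.norm_exp_sub_sum_le_norm_mul_exp (Complex.I * s) p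
    rw [hn] at h1
    refine h1.trans ?_
    rw [mul_comm]
    refine mul_le_mul_of_nonneg_right ?_ (by positivity)
    linarith [Real.exp_le_exp.2 h]
  · have h1 : ‖Complex.exp (Complex.I * s)‖ = 1 := by
      rw [mul_comm, Complex.norm_exp_ofReal_mul_I]
    have h2 : ‖∑ q ∈ Finset.range p, (Complex.I * (s : ℂ)) ^ q / (q.factorial : ℂ)‖ ≤
        3 * |s| ^ p := by
      refine (norm_sum_le _ _).trans ?_
      calc ∑ q ∈ Finset.range p, ‖(Complex.I * (s : ℂ)) ^ q / (q.factorial : ℂ)‖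
          ≤ ∑ q ∈ Finset.range p, 1 ^ q / (q.factorial : ℝ) * |s| ^ p := by
            refine Finset.sum_le_sum fun q hq => ?_
            rw [norm_div, norm_pow, hn, Complex.norm_natCast, one_pow, div_mul_eq_mul_div, one_mul]
            exact div_le_div_of_nonneg_right
              (pow_le_pow_right₀ h (Finset.mem_range.1 hq).le) (by positivity)
        _ = (∑ q ∈ Finset.range p, 1 ^ q / (q.factorial : ℝ)) * |s| ^ p := by
            rw [Finset.sum_mul]
        _ ≤ 3 * |s| ^ p := by
            refine mul_le_mul_of_nonneg_right ?_ (by positivity)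
            exact (Real.sum_le_exp_of_nonneg zero_le_one p).trans he
    have h3 : 1 ≤ |s| ^ p := one_le_pow₀ h
    refine (norm_sub_le _ _).trans ?_
    rw [h1]
    linarith

theorem expRemainder_succ (p : ℕ) (s : ℝ) :
    expRemainder p s = (Complex.I * s) ^ p / (p.factorial : ℂ) + expRemainder (p + 1) s := by
  rw [expRemainder, expRemainder, Finset.sum_range_succ]
  ring

theorem tendsto_expRemainder (p : ℕ) (s : ℝ) {ε : ℕ → ℝ} (hε : ∀ n, 0 < ε n)
    (hε0 : Tendsto ε atTop (𝓝 0)) :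
    Tendsto (fun n => ((ε n ^ p)⁻¹ : ℝ) * expRemainder p (ε n * s)) atTop
      (𝓝 ((Complex.I * s) ^ p / (p.factorial : ℂ))) := by
  have h1 : ∀ n, ((ε n ^ p)⁻¹ : ℝ) * expRemainder p (ε n * s) =
      (Complex.I * s) ^ p / (p.factorial : ℂ) +
        ((ε n ^ p)⁻¹ : ℝ) * expRemainder (p + 1) (ε n * s) := fun n => by
    rw [expRemainder_succ, mul_add]
    congr 1
    have : (ε n : ℂ) ≠ 0 := by exact_mod_cast (hε n).ne'
    push_cast
    field_simp
    ring
  simp_rw [h1]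
  have h2 : Tendsto (fun n => ((ε n ^ p)⁻¹ : ℝ) * expRemainder (p + 1) (ε n * s)) atTop (𝓝 0) := by
    have h3 : Tendsto (fun n => ε n * (4 * |s| ^ (p + 1))) atTop (𝓝 0) := by
      simpa using hε0.mul_const (4 * |s| ^ (p + 1))
    refine squeeze_zero_norm (fun n => ?_) h3
    rw [norm_mul, Complex.norm_real, Real.norm_of_nonneg (by have := hε n; positivity)]
    have h4 := norm_expRemainder_le (p + 1) (ε n * s)
    rw [abs_mul, abs_of_pos (hε n)] at h4
    calc (ε n ^ p)⁻¹ * ‖expRemainder (p + 1) (ε n * s)‖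
        ≤ (ε n ^ p)⁻¹ * (4 * (ε n * |s|) ^ (p + 1)) :=
          mul_le_mul_of_nonneg_left h4 (by have := hε n; positivity)
      _ = ε n * (4 * |s| ^ (p + 1)) := by
          have := (hε n).ne'
          rw [mul_pow]
          field_simp
          ring
  simpa using h2.const_add ((Complex.I * s) ^ p / (p.factorial : ℂ))

variable {d : ℕ}

/-- The moments `∫ ⟨k,x⟩^q` of a signed measure, represented by a measure on `ℝ^d × {±}`. -/
noncomputable def dirMoment (q : ℕ) (ξ : Measure (Rd d × Bool)) (k : Rd d) : ℝ :=
  ∫ z, signOf z.2 * (inner ℝ k z.1) ^ q ∂ξ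

theorem pow_le_one_add_pow {q p : ℕ} (hqp : q ≤ p) {a : ℝ} (ha : 0 ≤ a) : a ^ q ≤ 1 + a ^ p := by
  rcases le_total a 1 with h | h
  · exact (pow_le_one₀ ha h).trans (le_add_of_nonneg_right (by positivity))
  · exact (pow_le_pow_right₀ h hqp).trans (le_add_of_nonneg_left zero_le_one)

theorem integrable_norm_pow {ξ : Measure (Rd d × Bool)} [IsFiniteMeasure ξ] {p q : ℕ} (hqp : q ≤ p)
    (hξ : Integrable (fun z => ‖z.1‖ ^ p) ξ) : Integrable (fun z => ‖z.1‖ ^ q) ξ := by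
  refine ((integrable_const (1 : ℝ)).add hξ).mono' ?_ (Eventually.of_forall fun z => ?_)
  · exact (measurable_fst.norm.pow_const q).aestronglyMeasurable
  · rw [Real.norm_of_nonneg (by positivity)]
    exact pow_le_one_add_pow hqp (norm_nonneg _)

theorem integrable_signOf_mul_of_le {F : Rd d → ℝ} (hF : Measurable F) {ξ : Measure (Rd d × Bool)}
    {q : ℕ} (hξ : Integrable (fun z => ‖z.1‖ ^ q) ξ) {c : ℝ} (hc : ∀ x, |F x| ≤ c * ‖x‖ ^ q) :
    Integrable (fun z => signOf z.2 * F z.1) ξ := by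
  refine (hξ.const_mul c).mono' ?_ (Eventually.of_forall fun z => ?_)
  · exact (measurable_signOf_snd.mul (hF.comp measurable_fst)).aestronglyMeasurable
  · rw [norm_mul, norm_signOf, one_mul]
    exact hc z.1

theorem abs_inner_pow_le (k x : Rd d) (q : ℕ) : |inner ℝ k x ^ q| ≤ ‖k‖ ^ q * ‖x‖ ^ q := by
  rw [abs_pow, ← mul_pow]
  exact pow_le_pow_left₀ (abs_nonneg _) (abs_real_inner_le_norm k x) q

theorem measurable_inner_pow (k : Rd d) (q : ℕ) : Measurable fun x : Rd d => inner ℝ k x ^ q :=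
  (measurable_const.inner measurable_id).pow_const q

theorem integrable_dirMoment {ξ : Measure (Rd d × Bool)} {q : ℕ}
    (hξ : Integrable (fun z => ‖z.1‖ ^ q) ξ) (k : Rd d) :
    Integrable (fun z => signOf z.2 * inner ℝ k z.1 ^ q) ξ :=
  integrable_signOf_mul_of_le (measurable_inner_pow k q) hξ fun x => abs_inner_pow_le k x q

theorem abs_prod_apply_le {q : ℕ} (j : Fin q → Fin d) (x : Rd d) :
    |∏ i, x (j i)| ≤ 1 * ‖x‖ ^ q := by
  rw [Finset.abs_prod, one_mul]
  refine (Finset.prod_le_prod (fun i _ => abs_nonneg _) fun i _ =>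
    (PiLp.norm_apply_le x (j i) : |x (j i)| ≤ ‖x‖)).trans ?_
  simp

theorem measurable_prod_apply {q : ℕ} (j : Fin q → Fin d) :
    Measurable fun x : Rd d => ∏ i, x (j i) :=
  Finset.measurable_prod _ fun i _ => by fun_prop

/-- Expanding `⟨k,x⟩^q` in coordinates: equal moment tensors give equal directional moments, which
is how the lower Taylor terms cancel. -/
theorem dirMoment_eq_sum (q : ℕ) (m : SignedMeasure (Rd d))
    (hm : Integrable (fun z => ‖z.1‖ ^ q) (signKernel m)) (k : Rd d) :
    dirMoment q (signKernel m) k = ∑ j : Fin q → Fin d, (∏ i, k (j i)) * momentTensor q m j := by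
  have h1 : ∀ x : Rd d, inner ℝ k x ^ q = ∑ j : Fin q → Fin d, (∏ i, k (j i)) * ∏ i, x (j i) :=
    fun x => by
      rw [PiLp.inner_apply, Fintype.sum_pow]
      refine Finset.sum_congr rfl fun j _ => ?_
      rw [← Finset.prod_mul_distrib]
      refine Finset.prod_congr rfl fun i _ => ?_
      simp [mul_comm]
  simp_rw [dirMoment, h1, Finset.mul_sum, mul_left_comm (signOf _)]
  rw [integral_finsetSum]
  · refine Finset.sum_congr rfl fun j _ => ?_
    rw [integral_const_mul, momentTensor_eq_integral]
  · intro j _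
    exact (integrable_signOf_mul_of_le (measurable_prod_apply j) hm
      (abs_prod_apply_le j)).const_mul _

/-- The converse passage, by polarization with coordinates written as `⟨e_j, x⟩`: directional
moments in all directions determine the tensor. -/
theorem momentTensor_eq_sum_dirMoment (p : ℕ) (m : SignedMeasure (Rd d))
    (hm : Integrable (fun z => ‖z.1‖ ^ p) (signKernel m)) (j : Fin p → Fin d) :
    (p.factorial : ℝ) * momentTensor p m j = ∑ S : Finset (Fin p),
      (-1) ^ (Finset.card Sᶜ) *
        dirMoment p (signKernel m) (∑ i ∈ S, EuclideanSpace.single (j i) (1 : ℝ)) := by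
  rw [momentTensor_eq_integral, ← integral_const_mul]
  have h1 : ∀ z : Rd d × Bool, (p.factorial : ℝ) * (signOf z.2 * ∏ i, z.1 (j i)) =
      ∑ S : Finset (Fin p), (-1) ^ (Finset.card Sᶜ) * (signOf z.2 *
        inner ℝ (∑ i ∈ S, EuclideanSpace.single (j i) (1 : ℝ)) z.1 ^ p) := fun z => by
    rw [mul_left_comm, factorial_mul_prod_eq_sum_pow p fun i => z.1 (j i), Finset.mul_sum]
    refine Finset.sum_congr rfl fun S _ => ?_
    rw [sum_inner]
    simp only [EuclideanSpace.inner_single_left, map_one, one_mul]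
    ring
  simp_rw [h1]
  rw [integral_finsetSum]
  · exact Finset.sum_congr rfl fun S _ => integral_const_mul _ _
  · exact fun S _ => (integrable_dirMoment hm _).const_mul _

theorem dirMoment_smul (q : ℕ) (ξ : Measure (Rd d × Bool)) (c : ℝ) (k : Rd d) :
    dirMoment q ξ (c • k) = c ^ q * dirMoment q ξ k := by
  rw [dirMoment, dirMoment, ← integral_const_mul]
  refine integral_congr_ae (Eventually.of_forall fun z => ?_)
  simp only [inner_smul_left, conj_trivial, mul_pow]
  ring

theorem continuous_dirMoment {ξ : Measure (Rd d × Bool)} {q : ℕ}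
    (hξ : Integrable (fun z => ‖z.1‖ ^ q) ξ) : Continuous (dirMoment q ξ) := by
  rw [continuous_iff_continuousAt]
  intro k₀
  refine continuousAt_of_dominated (bound := fun z => (‖k₀‖ + 1) ^ q * ‖z.1‖ ^ q)
    (Eventually.of_forall fun k => (integrable_dirMoment hξ k).1) ?_ (hξ.const_mul _)
    (Eventually.of_forall fun z => ?_)
  · filter_upwards [Metric.ball_mem_nhds k₀ one_pos] with k hk
    refine Eventually.of_forall fun z => ?_
    rw [norm_mul, norm_signOf, one_mul]
    refine (abs_inner_pow_le k z.1 q).trans (mul_le_mul_of_nonneg_right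
      (pow_le_pow_left₀ (norm_nonneg _) ?_ q) (by positivity))
    have h1 := norm_le_norm_add_norm_sub' k k₀
    rw [mem_ball_iff_norm] at hk
    linarith
  · fun_prop

/-- The remainder of the Taylor expansion of the Fourier transform. -/
noncomputable def transformRemainder (p : ℕ) (ξ : Measure (Rd d × Bool)) (k : Rd d) : ℂ :=
  ∫ z, (signOf z.2 : ℂ) * expRemainder p (inner ℝ k z.1) ∂ξ

theorem norm_signOf_expRemainder_le (p : ℕ) (k : Rd d) (z : Rd d × Bool) :
    ‖(signOf z.2 : ℂ) * expRemainder p (inner ℝ k z.1)‖ ≤ 4 * ‖k‖ ^ p * ‖z.1‖ ^ p := by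
  rw [norm_mul, Complex.norm_real, norm_signOf, one_mul, mul_assoc]
  refine (norm_expRemainder_le _ _).trans (mul_le_mul_of_nonneg_left ?_ (by norm_num))
  rw [← abs_pow]
  exact abs_inner_pow_le k z.1 p

theorem measurable_signOf_expRemainder (p : ℕ) (k : Rd d) :
    Measurable fun z : Rd d × Bool => (signOf z.2 : ℂ) * expRemainder p (inner ℝ k z.1) :=
  (Complex.measurable_ofReal.comp measurable_signOf_snd).mul
    ((continuous_expRemainder p).measurable.comp (measurable_const.inner measurable_fst))

theorem integrable_signOf_expRemainder {ξ : Measure (Rd d × Bool)} {p : ℕ}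
    (hξ : Integrable (fun z => ‖z.1‖ ^ p) ξ) (k : Rd d) :
    Integrable (fun z => (signOf z.2 : ℂ) * expRemainder p (inner ℝ k z.1)) ξ :=
  (hξ.const_mul (4 * ‖k‖ ^ p)).mono' (measurable_signOf_expRemainder p k).aestronglyMeasurable
    (Eventually.of_forall fun z => norm_signOf_expRemainder_le p k z)

theorem signedTransform_eq_add {ξ : Measure (Rd d × Bool)} [IsFiniteMeasure ξ] {p : ℕ}
    (hξ : Integrable (fun z => ‖z.1‖ ^ p) ξ) (k : Rd d) :
    signedTransform ξ k = ∑ q ∈ Finset.range p,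
      Complex.I ^ q / (q.factorial : ℂ) * (dirMoment q ξ k : ℂ) + transformRemainder p ξ k := by
  have h1 : ∀ q ∈ Finset.range p, Complex.I ^ q / (q.factorial : ℂ) * (dirMoment q ξ k : ℂ) =
      ∫ z, Complex.I ^ q / (q.factorial : ℂ) *
        ((signOf z.2 * inner ℝ k z.1 ^ q : ℝ) : ℂ) ∂ξ := fun q _ => by
    rw [integral_const_mul, integral_complex_ofReal, dirMoment]
  have h2 : ∀ q ∈ Finset.range p, Integrable (fun z => Complex.I ^ q / (q.factorial : ℂ) *
      ((signOf z.2 * inner ℝ k z.1 ^ q : ℝ) : ℂ)) ξ := fun q hq =>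
    ((integrable_dirMoment (integrable_norm_pow (Finset.mem_range.1 hq).le hξ) k).ofReal
      (𝕜 := ℂ)).const_mul _
  rw [Finset.sum_congr rfl h1, ← integral_finsetSum _ h2, transformRemainder,
    ← integral_add (integrable_finsetSum _ h2) (integrable_signOf_expRemainder hξ k)]
  refine integral_congr_ae (Eventually.of_forall fun z => ?_)
  simp only [expRemainder, planeWave, mul_sub, Finset.mul_sum]
  rw [add_sub_left_comm, ← Finset.sum_sub_distrib, eq_comm, add_eq_left]
  refine Finset.sum_eq_zero fun q _ => ?_
  push_cast
  ring

theorem enorm_transformRemainder_le (p : ℕ) (ξ : Measure (Rd d × Bool)) (k : Rd d) :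
    ‖transformRemainder p ξ k‖ₑ ≤ ENNReal.ofReal (4 * ‖k‖ ^ p) * ∫⁻ z, ‖z.1‖ₑ ^ p ∂ξ := by
  refine (enorm_integral_le_lintegral_enorm _).trans ?_
  rw [← lintegral_const_mul _ (measurable_fst.enorm.pow_const p)]
  refine lintegral_mono fun z => ?_
  rw [← ofReal_norm, ← ofReal_norm z.1, ← ENNReal.ofReal_pow (norm_nonneg _),
    ← ENNReal.ofReal_mul (by positivity)]
  exact ENNReal.ofReal_le_ofReal (norm_signOf_expRemainder_le p k z)

/-- The rescaled integrands converge pointwise to the Taylor term of order `p` and are dominated by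
a multiple of `‖x‖^p`. No moment of order `p + 1` is needed. -/
theorem tendsto_transformRemainder {ξ : Measure (Rd d × Bool)} {p : ℕ}
    (hξ : Integrable (fun z => ‖z.1‖ ^ p) ξ) (k : Rd d) {ε : ℕ → ℝ} (hε : ∀ n, 0 < ε n)
    (hε0 : Tendsto ε atTop (𝓝 0)) :
    Tendsto (fun n => ((ε n ^ p)⁻¹ : ℝ) * transformRemainder p ξ (ε n • k)) atTop
      (𝓝 (Complex.I ^ p / (p.factorial : ℂ) * (dirMoment p ξ k : ℂ))) := by
  have h1 : Complex.I ^ p / (p.factorial : ℂ) * (dirMoment p ξ k : ℂ) =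
      ∫ z, (signOf z.2 : ℂ) * ((Complex.I * (inner ℝ k z.1 : ℝ)) ^ p / (p.factorial : ℂ)) ∂ξ := by
    rw [dirMoment, ← integral_complex_ofReal, ← integral_const_mul]
    refine integral_congr_ae (Eventually.of_forall fun z => ?_)
    simp only
    push_cast
    ring
  have h2 : ∀ n, ((ε n ^ p)⁻¹ : ℝ) * transformRemainder p ξ (ε n • k) =
      ∫ z, ((ε n ^ p)⁻¹ : ℝ) * ((signOf z.2 : ℂ) *
        expRemainder p (inner ℝ (ε n • k) z.1)) ∂ξ := fun n => by
    rw [transformRemainder, integral_const_mul]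
  simp_rw [h2]
  rw [h1]
  refine tendsto_integral_of_dominated_convergence (fun z => 4 * ‖k‖ ^ p * ‖z.1‖ ^ p)
    (fun n => ((measurable_signOf_expRemainder p _).const_mul _).aestronglyMeasurable)
    (hξ.const_mul _) (fun n => Eventually.of_forall fun z => ?_)
    (Eventually.of_forall fun z => ?_)
  · have hp := hε n
    have h3 := norm_signOf_expRemainder_le p (ε n • k) z
    rw [norm_smul, Real.norm_of_nonneg hp.le] at h3
    rw [norm_mul, Complex.norm_real, Real.norm_of_nonneg (by positivity)]
    calc _ ≤ (ε n ^ p)⁻¹ * (4 * (ε n * ‖k‖) ^ p * ‖z.1‖ ^ p) :=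
          mul_le_mul_of_nonneg_left h3 (by positivity)
      _ = _ := by
          rw [mul_pow]
          field_simp
  · have h4 := (tendsto_expRemainder p (inner ℝ k z.1) hε hε0).const_mul (signOf z.2 : ℂ)
    refine h4.congr fun n => ?_
    rw [inner_smul_left, mul_left_comm]
    rfl

end Taylor

/-! ### Behaviour of the transform variance at the origin. -/

section VarianceAsymptotics

variable {d : ℕ}

/-- The centred copies are independent with mean zero, so the cross term vanishes. In a difference
of two copies, deterministic Taylor terms cancel without their values or the mean being computed. -/
theorem lintegral_enorm_signedTransform_sub {L : Measure (SignedMeasure (Rd d))}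
    [IsProbabilityMeasure L] (hL : ∫⁻ m, signKernel m Set.univ ^ 2 ∂L < ∞) (k : Rd d) :
    ∫⁻ r, ‖signedTransform (signKernel r.1) k - signedTransform (signKernel r.2) k‖ₑ ^ 2
      ∂L.prod L = 2 * ENNReal.ofReal (transformVariance L k) := by
  set c := signedTransform (clusterMean L) k with hc
  set u : SignedMeasure (Rd d) → ℂ := fun m => signedTransform (signKernel m) k - c with hu
  have hum : Measurable u := (measurable_signedTransform_signKernel k).sub_const c
  have hz := integrable_signedTransform hL k
  have hui : Integrable u L := hz.sub (integrable_const c)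
  have hu2 : Integrable (fun m => ‖u m‖ ^ 2) L := by
    refine (memLp_two_iff_integrable_sq_norm hum.aestronglyMeasurable).1 ?_
    exact ((memLp_two_iff_integrable_sq_norm
      (measurable_signedTransform_signKernel k).aestronglyMeasurable).2
      (integrable_norm_signedTransform_sq hL k)).sub (memLp_const c)
  have hu0 : ∫ m, u m ∂L = 0 := by
    rw [hu, integral_sub hz (integrable_const c), ← signedTransform_clusterMean hL, integral_const]
    simp [hc]
  have huc : Integrable (fun m => (starRingEnd ℂ) (u m)) L :=
    Complex.conjCLE.toContinuousLinearMap.integrable_comp hui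
  have hprod : Integrable (fun r : SignedMeasure (Rd d) × SignedMeasure (Rd d) =>
      u r.1 * (starRingEnd ℂ) (u r.2)) (L.prod L) := hui.mul_prod huc
  have hre : Integrable (fun r : SignedMeasure (Rd d) × SignedMeasure (Rd d) =>
      (u r.1 * (starRingEnd ℂ) (u r.2)).re) (L.prod L) := hprod.re
  have h0 : ∫ r, (u r.1 * (starRingEnd ℂ) (u r.2)).re ∂L.prod L = 0 := by
    have h1 : ∫ r, (u r.1 * (starRingEnd ℂ) (u r.2)).re ∂L.prod L =
        (∫ r, u r.1 * (starRingEnd ℂ) (u r.2) ∂L.prod L).re := integral_re hprod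
    rw [h1, integral_prod_mul u fun m => (starRingEnd ℂ) (u m), hu0]
    simp
  have e : ∀ r : SignedMeasure (Rd d) × SignedMeasure (Rd d),
      ‖signedTransform (signKernel r.1) k - signedTransform (signKernel r.2) k‖ ^ 2 =
        ‖u r.1‖ ^ 2 + ‖u r.2‖ ^ 2 - 2 * (u r.1 * (starRingEnd ℂ) (u r.2)).re := fun r => by
    have h1 : signedTransform (signKernel r.1) k - signedTransform (signKernel r.2) k =
        u r.1 - u r.2 := by simp [hu]
    rw [h1, ← Complex.normSq_eq_norm_sq, ← Complex.normSq_eq_norm_sq, ← Complex.normSq_eq_norm_sq,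
      Complex.normSq_sub]
  have i1 : Integrable (fun r : SignedMeasure (Rd d) × SignedMeasure (Rd d) =>
      ‖u r.1‖ ^ 2 + ‖u r.2‖ ^ 2) (L.prod L) := (hu2.comp_fst L).add (hu2.comp_snd L)
  have hI : Integrable (fun r : SignedMeasure (Rd d) × SignedMeasure (Rd d) =>
      ‖signedTransform (signKernel r.1) k - signedTransform (signKernel r.2) k‖ ^ 2)
      (L.prod L) := by
    simp_rw [e]
    exact i1.sub (hre.const_mul 2)
  have e2 : ∀ r : SignedMeasure (Rd d) × SignedMeasure (Rd d),
      ‖signedTransform (signKernel r.1) k - signedTransform (signKernel r.2) k‖ₑ ^ 2 =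
      ENNReal.ofReal (‖signedTransform (signKernel r.1) k -
        signedTransform (signKernel r.2) k‖ ^ 2) := fun r => by
    rw [ENNReal.ofReal_pow (norm_nonneg _), ofReal_norm]
  simp_rw [e2]
  rw [← ofReal_integral_eq_lintegral_ofReal hI (Eventually.of_forall fun r => by positivity)]
  simp_rw [e]
  rw [integral_sub i1 (hre.const_mul 2), integral_const_mul, h0,
    integral_add (hu2.comp_fst L) (hu2.comp_snd L),
    integral_fun_fst (fun m => ‖u m‖ ^ 2), integral_fun_snd (fun m => ‖u m‖ ^ 2)]
  simp only [probReal_univ, one_smul, mul_zero, sub_zero]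
  rw [← two_mul, ENNReal.ofReal_mul zero_le_two, ENNReal.ofReal_ofNat]
  rfl

variable {L : Measure (SignedMeasure (Rd d))} [IsProbabilityMeasure L] {p : ℕ}

theorem measurable_lintegral_norm_pow (p : ℕ) :
    Measurable fun m : SignedMeasure (Rd d) => ∫⁻ z, ‖z.1‖ₑ ^ p ∂signKernel m :=
  Measurable.lintegral_kernel (κ := signKernel (d := d)) (measurable_fst.enorm.pow_const p)

omit [IsProbabilityMeasure L] in
theorem ae_integrable_norm_pow (hmom : ∫⁻ m, (∫⁻ z, ‖z.1‖ₑ ^ p ∂signKernel m) ^ 2 ∂L < ∞) :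
    ∀ᵐ m ∂L, Integrable (fun z => ‖z.1‖ ^ p) (signKernel m) := by
  filter_upwards [ae_lt_top ((measurable_lintegral_norm_pow p).pow_const 2) hmom.ne] with m hm
  refine ⟨(measurable_fst.norm.pow_const p).aestronglyMeasurable, ?_⟩
  have h1 : ∫⁻ z, ‖z.1‖ₑ ^ p ∂signKernel m < ∞ :=
    lt_of_le_of_ne le_top fun he => by simp [he] at hm
  simpa [HasFiniteIntegral, enorm_pow] using h1

omit [IsProbabilityMeasure L] in
-- Two independent copies share their Taylor polynomial of degree less than `p`. The exceptional
-- null set does not depend on `k`, which the limit along rescaled frequencies requires.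
theorem ae_signedTransform_sub_eq [SFinite L] (hmom : ∫⁻ m, (∫⁻ z, ‖z.1‖ₑ ^ p ∂signKernel m) ^ 2 ∂L < ∞)
    (hfit : ∀ q < p, ∃ c, ∀ᵐ m ∂L, momentTensor q m = c) :
    ∀ᵐ r ∂L.prod L, (Integrable (fun z => ‖z.1‖ ^ p) (signKernel r.1) ∧
      Integrable (fun z => ‖z.1‖ ^ p) (signKernel r.2)) ∧
      ∀ k, signedTransform (signKernel r.1) k - signedTransform (signKernel r.2) k =
        transformRemainder p (signKernel r.1) k - transformRemainder p (signKernel r.2) k := by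
  choose! c hc using hfit
  have h1 : ∀ᵐ m ∂L, Integrable (fun z => ‖z.1‖ ^ p) (signKernel m) ∧
      ∀ q < p, momentTensor q m = c q :=
    (ae_integrable_norm_pow hmom).and (ae_all_iff.2 fun q => by
      by_cases hq : q < p
      · filter_upwards [hc q hq] with m hm _ using hm
      · exact Eventually.of_forall fun m h => absurd h hq)
  filter_upwards [Measure.quasiMeasurePreserving_fst.ae h1,
    Measure.quasiMeasurePreserving_snd.ae h1] with r h h'
  refine ⟨⟨h.1, h'.1⟩, fun k => ?_⟩
  rw [signedTransform_eq_add h.1, signedTransform_eq_add h'.1]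
  have h2 : ∀ q ∈ Finset.range p, Complex.I ^ q / (q.factorial : ℂ) *
      (dirMoment q (signKernel r.1) k : ℂ) = Complex.I ^ q / (q.factorial : ℂ) *
      (dirMoment q (signKernel r.2) k : ℂ) := fun q hq => by
    have hq' := Finset.mem_range.1 hq
    rw [dirMoment_eq_sum q _ (integrable_norm_pow hq'.le h.1),
      dirMoment_eq_sum q _ (integrable_norm_pow hq'.le h'.1), h.2 q hq', h'.2 q hq']
  rw [Finset.sum_congr rfl h2]
  ring

/-- The variance of the Fourier transform of a random signed measure with deterministic moments
of order less than `p` is of order `‖k‖^{2p}`. -/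
theorem exists_transformVariance_le (hL : ∫⁻ m, signKernel m Set.univ ^ 2 ∂L < ∞)
    (hmom : ∫⁻ m, (∫⁻ z, ‖z.1‖ₑ ^ p ∂signKernel m) ^ 2 ∂L < ∞)
    (hfit : ∀ q < p, ∃ c, ∀ᵐ m ∂L, momentTensor q m = c) :
    ∃ C, 0 ≤ C ∧ ∀ k, transformVariance L k ≤ C * (‖k‖ ^ p) ^ 2 := by
  set N : SignedMeasure (Rd d) → ℝ≥0∞ := fun m => ∫⁻ z, ‖z.1‖ₑ ^ p ∂signKernel m with hN
  have hNm : Measurable N := measurable_lintegral_norm_pow p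
  set S := ∫⁻ m, N m ^ 2 ∂L with hS
  -- The factor `16` is the square of the constant in the remainder bound; `8` comes from `(a + b)²
  -- ≤ 4(a² + b²)` integrated over both copies.
  refine ⟨16 * (8 * S).toReal, by positivity, fun k => ?_⟩
  have h1 : ENNReal.ofReal (transformVariance L k) ≤
      ENNReal.ofReal (4 * ‖k‖ ^ p) ^ 2 * (8 * S) := by
    calc ENNReal.ofReal (transformVariance L k)
        ≤ 2 * ENNReal.ofReal (transformVariance L k) := by
          rw [two_mul]; exact le_self_add
      _ = ∫⁻ r, ‖signedTransform (signKernel r.1) k - signedTransform (signKernel r.2) k‖ₑ ^ 2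
            ∂L.prod L := (lintegral_enorm_signedTransform_sub hL k).symm
      _ ≤ ∫⁻ r, ENNReal.ofReal (4 * ‖k‖ ^ p) ^ 2 * (4 * (N r.1 ^ 2 + N r.2 ^ 2)) ∂L.prod L := by
          refine lintegral_mono_ae ?_
          filter_upwards [ae_signedTransform_sub_eq hmom hfit] with r hr
          have h2 : ‖signedTransform (signKernel r.1) k - signedTransform (signKernel r.2) k‖ₑ ≤
              ENNReal.ofReal (4 * ‖k‖ ^ p) * (N r.1 + N r.2) := by
            rw [hr.2 k, mul_add]
            exact enorm_sub_le.trans (add_le_add (enorm_transformRemainder_le _ _ _)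
              (enorm_transformRemainder_le _ _ _))
          have h3 : ∀ a b : ℝ≥0∞, (a + b) ^ 2 ≤ 4 * (a ^ 2 + b ^ 2) := fun a b => by
            have h4 : (4 : ℝ≥0∞) = 2 ^ 2 := by norm_num
            rcases le_total a b with h | h
            · calc (a + b) ^ 2 ≤ (2 * b) ^ 2 := by
                    rw [two_mul]; exact pow_le_pow_left' (by gcongr) 2
                _ = 4 * b ^ 2 := by rw [mul_pow, h4]
                _ ≤ _ := by gcongr; exact le_add_self
            · calc (a + b) ^ 2 ≤ (2 * a) ^ 2 := by
                    rw [two_mul]; exact pow_le_pow_left' (by gcongr) 2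
                _ = 4 * a ^ 2 := by rw [mul_pow, h4]
                _ ≤ _ := by gcongr; exact le_self_add
          refine (pow_le_pow_left' h2 2).trans ?_
          rw [mul_pow]
          gcongr
          exact h3 _ _
      _ = ENNReal.ofReal (4 * ‖k‖ ^ p) ^ 2 * (8 * S) := by
          have m1 : Measurable fun r : SignedMeasure (Rd d) × SignedMeasure (Rd d) =>
            N r.1 ^ 2 := (hNm.comp measurable_fst).pow_const 2
          have m2 : Measurable fun r : SignedMeasure (Rd d) × SignedMeasure (Rd d) =>
            N r.2 ^ 2 := (hNm.comp measurable_snd).pow_const 2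
          have m3 : Measurable fun r : SignedMeasure (Rd d) × SignedMeasure (Rd d) =>
            N r.1 ^ 2 + N r.2 ^ 2 := m1.add m2
          rw [lintegral_const_mul _ (m3.const_mul 4), lintegral_const_mul _ m3,
            lintegral_add_left m1, lintegral_prod _ m1.aemeasurable,
            lintegral_prod _ m2.aemeasurable]
          simp only [lintegral_const, measure_univ, mul_one]
          rw [← two_mul, ← mul_assoc (4 : ℝ≥0∞), show (4 : ℝ≥0∞) * 2 = 8 by norm_num]
  have hfin : ENNReal.ofReal (4 * ‖k‖ ^ p) ^ 2 * (8 * S) ≠ ∞ :=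
    ENNReal.mul_ne_top (ENNReal.pow_ne_top ENNReal.ofReal_ne_top)
      (ENNReal.mul_ne_top (by simp) hmom.ne)
  have h5 := ENNReal.toReal_mono hfin h1
  rw [ENNReal.toReal_ofReal (transformVariance_nonneg _ _), ENNReal.toReal_mul, ENNReal.toReal_pow,
    ENNReal.toReal_ofReal (by positivity)] at h5
  refine h5.trans (le_of_eq ?_)
  ring

theorem measurable_signedTransform_prod :
    Measurable fun r : Rd d × SignedMeasure (Rd d) => signedTransform (signKernel r.2) r.1 := by
  have h : Measurable fun s : (Rd d × SignedMeasure (Rd d)) × (Rd d × Bool) =>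
      (signOf s.2.2 : ℂ) * planeWave s.1.1 s.2.1 :=
    (Complex.measurable_ofReal.comp (measurable_signOf.comp
      (measurable_snd.comp measurable_snd))).mul
      (measurable_planeWave (measurable_fst.comp measurable_fst)
        (measurable_fst.comp measurable_snd))
  exact (h.stronglyMeasurable.integral_kernel_prod_right' (κ := signKernel.comap
    (Prod.snd : Rd d × SignedMeasure (Rd d) → _) measurable_snd)).measurable

theorem setLIntegral_ball_smul {ε : ℝ} (hε : 0 < ε) {f : Rd d → ℝ≥0∞} (hf : Measurable f) :
    ∫⁻ w in Metric.ball 0 1, f (ε • w) = ENNReal.ofReal (ε ^ d)⁻¹ * ∫⁻ k in Metric.ball 0 ε, f k := by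
  have hB : ∀ r : ℝ, MeasurableSet (Metric.ball (0 : Rd d) r) := fun r =>
    Metric.isOpen_ball.measurableSet
  have h1 := Measure.map_addHaar_smul (volume : Measure (Rd d)) hε.ne'
  rw [finrank_euclideanSpace_fin, abs_of_pos (by positivity)] at h1
  have h2 : ∀ w : Rd d, (Metric.ball 0 1).indicator (fun w => f (ε • w)) w =
      (Metric.ball 0 ε).indicator f (ε • w) := fun w => by
    have : ε • w ∈ Metric.ball (0 : Rd d) ε ↔ w ∈ Metric.ball (0 : Rd d) 1 := by
      rw [mem_ball_zero_iff, mem_ball_zero_iff, norm_smul, Real.norm_of_nonneg hε.le,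
        mul_lt_iff_lt_one_right hε]
    by_cases hw : w ∈ Metric.ball (0 : Rd d) 1
    · rw [Set.indicator_of_mem hw, Set.indicator_of_mem (this.2 hw)]
    · rw [Set.indicator_of_notMem hw, Set.indicator_of_notMem fun h => hw (this.1 h)]
  rw [← lintegral_indicator (hB ε), ← lintegral_indicator (hB 1), lintegral_congr h2,
    ← lintegral_map (hf.indicator (hB ε)) (measurable_const_smul ε), h1, lintegral_smul_measure,
    smul_eq_mul]

/-- If the variance of the Fourier transform vanishes to higher order at the origin, the moments of
order `p` are deterministic. -/
theorem exists_momentTensor_eq_of_tendsto (hL : ∫⁻ m, signKernel m Set.univ ^ 2 ∂L < ∞)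
    (hmom : ∫⁻ m, (∫⁻ z, ‖z.1‖ₑ ^ p ∂signKernel m) ^ 2 ∂L < ∞)
    (hfit : ∀ q < p, ∃ c, ∀ᵐ m ∂L, momentTensor q m = c) {ε : ℕ → ℝ} (hε : ∀ n, 0 < ε n)
    (hε0 : Tendsto ε atTop (𝓝 0))
    (hlim : Tendsto (fun n => ENNReal.ofReal (ε n ^ (d + 2 * p))⁻¹ *
      ∫⁻ k in Metric.ball 0 (ε n), ENNReal.ofReal (transformVariance L k)) atTop (𝓝 0)) :
    ∃ c, ∀ᵐ m ∂L, momentTensor p m = c := by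
  -- After the substitution `k = ε w`, integrating `|T|²` over two independent copies and over `w`
  -- in the unit ball gives twice the normalized integral of the variance over `B_ε`.
  set T : ℕ → (SignedMeasure (Rd d) × SignedMeasure (Rd d)) × Rd d → ℂ := fun n q =>
    ((ε n ^ p)⁻¹ : ℝ) * (signedTransform (signKernel q.1.1) (ε n • q.2) -
      signedTransform (signKernel q.1.2) (ε n • q.2)) with hT
  have hTm : ∀ n, Measurable (T n) := fun n => by
    have hs : Measurable fun q : (SignedMeasure (Rd d) × SignedMeasure (Rd d)) × Rd d =>
      ε n • q.2 := measurable_snd.const_smul (ε n)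
    exact ((measurable_signedTransform_prod.comp (hs.prodMk
      (measurable_fst.comp measurable_fst))).sub (measurable_signedTransform_prod.comp (hs.prodMk
      (measurable_snd.comp measurable_fst)))).const_mul _
  have hgm : ∀ n, Measurable fun q => ‖T n q‖ₑ ^ 2 := fun n => (hTm n).enorm.pow_const 2
  set κ := (L.prod L).prod ((volume : Measure (Rd d)).restrict (Metric.ball 0 1)) with hκ
  have hVm : Measurable fun k => ENNReal.ofReal (transformVariance L k) :=
    (measurable_transformVariance hL).ennreal_ofReal
  have hint : ∀ n, ∫⁻ q, ‖T n q‖ₑ ^ 2 ∂κ = 2 * (ENNReal.ofReal (ε n ^ (d + 2 * p))⁻¹ *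
      ∫⁻ k in Metric.ball 0 (ε n), ENNReal.ofReal (transformVariance L k)) := fun n => by
    have hn := hε n
    have e1 : ‖(((ε n ^ p)⁻¹ : ℝ) : ℂ)‖ₑ = ENNReal.ofReal (ε n ^ p)⁻¹ := by
      rw [← ofReal_norm, Complex.norm_real, Real.norm_of_nonneg (by positivity)]
    have hmm : ∀ k : Rd d, Measurable fun r : SignedMeasure (Rd d) × SignedMeasure (Rd d) =>
        ‖signedTransform (signKernel r.1) k - signedTransform (signKernel r.2) k‖ₑ ^ 2 :=
      fun k => (((measurable_signedTransform_signKernel k).comp measurable_fst).sub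
        ((measurable_signedTransform_signKernel k).comp measurable_snd)).enorm.pow_const 2
    rw [hκ, lintegral_prod_symm _ (hgm n).aemeasurable]
    simp only [hT, enorm_mul, mul_pow, e1]
    simp_rw [lintegral_const_mul _ (hmm _), lintegral_enorm_signedTransform_sub hL]
    have hVn : Measurable fun y : Rd d => ENNReal.ofReal (transformVariance L (ε n • y)) :=
      hVm.comp (measurable_const_smul (ε n))
    rw [lintegral_const_mul _ (hVn.const_mul 2), lintegral_const_mul _ hVn,
      setLIntegral_ball_smul hn hVm, mul_left_comm, ← mul_assoc (ENNReal.ofReal _ ^ 2),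
      ← ENNReal.ofReal_pow (by positivity), ← ENNReal.ofReal_mul (by positivity)]
    congr 3
    rw [← inv_pow, ← inv_pow, ← inv_pow]
    ring
  -- Fatou's lemma transfers the vanishing of the averages to the pointwise lower limit, so no
  -- dominating function is needed.
  have hliminf : ∫⁻ q, liminf (fun n => ‖T n q‖ₑ ^ 2) atTop ∂κ = 0 := by
    refine le_antisymm ((lintegral_liminf_le hgm).trans ?_) zero_le
    simp_rw [hint]
    have := ENNReal.Tendsto.const_mul (a := 2) hlim (Or.inr (by simp))
    rw [mul_zero] at this
    exact this.liminf_eq.le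
  rw [lintegral_eq_zero_iff (Measurable.liminf hgm)] at hliminf
  have hgood := ae_signedTransform_sub_eq hmom hfit
  have hκfst : ∀ᵐ q ∂κ, (Integrable (fun z => ‖z.1‖ ^ p) (signKernel q.1.1) ∧
      Integrable (fun z => ‖z.1‖ ^ p) (signKernel q.1.2)) ∧
      ∀ k, signedTransform (signKernel q.1.1) k - signedTransform (signKernel q.1.2) k =
        transformRemainder p (signKernel q.1.1) k - transformRemainder p (signKernel q.1.2) k :=
    Measure.quasiMeasurePreserving_fst.ae hgood
  have hae : ∀ᵐ q ∂κ, dirMoment p (signKernel q.1.1) q.2 = dirMoment p (signKernel q.1.2) q.2 := by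
    filter_upwards [hliminf, hκfst] with q h1 h2
    have h3 : Tendsto (fun n => T n q) atTop
        (𝓝 (Complex.I ^ p / (p.factorial : ℂ) * (dirMoment p (signKernel q.1.1) q.2 : ℂ) -
          Complex.I ^ p / (p.factorial : ℂ) * (dirMoment p (signKernel q.1.2) q.2 : ℂ))) := by
      refine ((tendsto_transformRemainder h2.1.1 q.2 hε hε0).sub
        (tendsto_transformRemainder h2.1.2 q.2 hε hε0)).congr fun n => ?_
      rw [hT, ← mul_sub, ← h2.2]
    have h4 := ((ENNReal.continuous_pow 2).tendsto _).comp h3.enorm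
    have h5 := h4.liminf_eq
    simp only [Function.comp_def] at h5
    rw [h5] at h1
    simp only [Pi.zero_apply, pow_eq_zero_iff, ne_eq, OfNat.ofNat_ne_zero, not_false_eq_true,
      enorm_eq_zero, ← mul_sub, mul_eq_zero, div_eq_zero_iff, Nat.cast_eq_zero,
      p.factorial_ne_zero, or_false, sub_eq_zero] at h1
    rcases h1 with h1 | h1
    · exact absurd h1 (by simp)
    · exact_mod_cast h1
  have hae2 : ∀ᵐ r ∂L.prod L, momentTensor p r.1 = momentTensor p r.2 := by
    -- Equality for almost all directions in the unit ball extends to the ball by continuity, to all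
    -- directions by homogeneity, and to the tensors by polarization.
    filter_upwards [Measure.ae_ae_of_ae_prod hae, hgood] with r h1 h2
    have h3 : Set.EqOn (dirMoment p (signKernel r.1)) (dirMoment p (signKernel r.2))
        (Metric.ball 0 1) :=
      Measure.eqOn_open_of_ae_eq h1 Metric.isOpen_ball
        (continuous_dirMoment h2.1.1).continuousOn (continuous_dirMoment h2.1.2).continuousOn
    have h4 : ∀ k, dirMoment p (signKernel r.1) k = dirMoment p (signKernel r.2) k := fun k => by
      have hk : 0 < ‖k‖ + 1 := by positivity
      have e : k = (‖k‖ + 1) • ((‖k‖ + 1)⁻¹ • k) := by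
        rw [smul_smul, mul_inv_cancel₀ hk.ne', one_smul]
      have hmem : (‖k‖ + 1)⁻¹ • k ∈ Metric.ball (0 : Rd d) 1 := by
        rw [mem_ball_zero_iff, norm_smul, norm_inv, Real.norm_of_nonneg hk.le, inv_mul_lt_one₀ hk]
        exact lt_add_one _
      rw [e, dirMoment_smul, h3 hmem, ← dirMoment_smul]
    ext j
    have h5 := momentTensor_eq_sum_dirMoment p r.1 h2.1.1 j
    simp_rw [h4] at h5
    rw [← momentTensor_eq_sum_dirMoment p r.2 h2.1.2 j] at h5
    exact mul_left_cancel₀ (by exact_mod_cast p.factorial_ne_zero) h5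
  -- Freezing one copy at a typical value exhibits the constant that the other copy equals almost
  -- surely.
  obtain ⟨m, hm⟩ := (Measure.ae_ae_of_ae_prod hae2).exists
  exact ⟨momentTensor p m, hm.mono fun m' h => h.symm⟩

end VarianceAsymptotics

/-! ### Uniqueness of the spectral measure near the origin. -/

section Uniqueness

variable {d : ℕ} {Ω : Type*} [MeasurableSpace Ω]

/-- The indicator function of the unit ball. -/
noncomputable def ballIndicator (d : ℕ) : Rd d → ℂ := (Metric.ball 0 1).indicator 1

theorem isTestFunction_ballIndicator : IsTestFunction (ballIndicator d) := by
  refine ⟨measurable_one.indicator Metric.isOpen_ball.measurableSet, ⟨1, fun x => ?_⟩,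
    Metric.isBounded_ball.subset Set.support_indicator_subset⟩
  refine (norm_indicator_le_norm_self _ _).trans ?_
  simp

/-- For `‖k‖` and `‖x‖` below one, the real part of the phase is at least `cos 1 > 0`, so the
integral cannot cancel. This permits division by the squared transform on the unit ball. -/
theorem fourierHat_ballIndicator_ne_zero {k : Rd d} (hk : k ∈ Metric.ball (0 : Rd d) 1) :
    fourierHat (ballIndicator d) k ≠ 0 := by
  have hm : MeasurableSet (Metric.ball (0 : Rd d) 1) := Metric.isOpen_ball.measurableSet
  have hfin : (volume : Measure (Rd d)) (Metric.ball 0 1) ≠ ∞ := measure_ball_lt_top.ne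
  have hcont : Continuous fun x : Rd d => Complex.exp (-Complex.I * ((inner ℝ k x : ℝ) : ℂ)) := by
    fun_prop
  have e1 : fourierHat (ballIndicator d) k =
      ∫ x in Metric.ball 0 1, Complex.exp (-Complex.I * ((inner ℝ k x : ℝ) : ℂ)) := by
    rw [fourierHat, ← integral_indicator hm]
    refine integral_congr_ae (Eventually.of_forall fun x => ?_)
    by_cases hx : x ∈ Metric.ball (0 : Rd d) 1
    · simp only [ballIndicator, Set.indicator_of_mem hx, Pi.one_apply, mul_one]
    · simp only [ballIndicator, Set.indicator_of_notMem hx, mul_zero]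
  have hint : IntegrableOn (fun x : Rd d => Complex.exp (-Complex.I * ((inner ℝ k x : ℝ) : ℂ)))
      (Metric.ball 0 1) := by
    refine Measure.integrableOn_of_bounded hfin hcont.aestronglyMeasurable (M := 1)
      (Eventually.of_forall fun x => ?_)
    rw [Complex.norm_exp]
    simp
  have hre : (fourierHat (ballIndicator d) k).re =
      ∫ x in Metric.ball 0 1, Real.cos (inner ℝ k x) := by
    have h1 : (fourierHat (ballIndicator d) k).re = ∫ x in Metric.ball 0 1,
        (Complex.exp (-Complex.I * ((inner ℝ k x : ℝ) : ℂ))).re := by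
      rw [e1]
      exact (integral_re hint).symm
    rw [h1]
    refine integral_congr_ae (Eventually.of_forall fun x => ?_)
    simp [Complex.exp_re]
  have hpos : 0 < ∫ x in Metric.ball (0 : Rd d) 1, Real.cos (inner ℝ k x) := by
    have h2 : ∫ _ in Metric.ball (0 : Rd d) 1, Real.cos 1 ≤
        ∫ x in Metric.ball (0 : Rd d) 1, Real.cos (inner ℝ k x) := by
      refine setIntegral_mono_on (integrableOn_const hfin) ?_ hm fun x hx => ?_
      · have hc : Continuous fun x : Rd d => Real.cos (inner ℝ k x) := by fun_prop
        exact Measure.integrableOn_of_bounded hfin hc.aestronglyMeasurable (M := 1)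
          (Eventually.of_forall fun x => Real.abs_cos_le_one _)
      · have h3 : |inner ℝ k x| ≤ 1 := by
          refine (abs_real_inner_le_norm k x).trans ?_
          rw [mem_ball_zero_iff] at hk hx
          exact mul_le_one₀ hk.le (norm_nonneg _) hx.le
        rw [← Real.cos_abs (inner ℝ k x)]
        exact Real.cos_le_cos_of_nonneg_of_le_pi (abs_nonneg _)
          (by linarith [Real.pi_gt_three]) h3
    refine lt_of_lt_of_le ?_ h2
    rw [setIntegral_const, smul_eq_mul]
    refine mul_pos (ENNReal.toReal_pos ?_ hfin) Real.cos_one_pos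
    exact (Metric.measure_ball_pos volume _ one_pos).ne'
  intro h
  rw [h, Complex.zero_re] at hre
  linarith

/-- Translating only one of the two test functions produces the character at `t`. The characteristic
function of `|f̂|² ν` is thus expressed by the covariance of `Ψ` alone. -/
theorem IsBartlettMeasure.integral_planeWave {P : Measure Ω} {Ψ : Ω → Set (Rd d) → ℝ}
    {ν : Measure (Rd d)} (hν : IsBartlettMeasure P Ψ ν) {f : Rd d → ℂ} (hf : IsTestFunction f)
    (t : Rd d) : ∫ k, planeWave k t * ((‖fourierHat f k‖ ^ 2 : ℝ) : ℂ) ∂ν =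
      covMeasure P Ψ (tiltedConv (fun x => f (x + t)) fun x => f (x + 0)) := by
  rw [(hν.2 _ _ (hf.comp_add t) (hf.comp_add 0)).2]
  refine integral_congr_ae (Eventually.of_forall fun k => ?_)
  simp only [fourierHat_add_mul_conj, sub_zero]
  rw [Complex.mul_conj, Complex.normSq_eq_norm_sq]

/-- The Bartlett spectral measure is unique on the unit ball. -/
theorem IsBartlettMeasure.restrict_ball_eq {P : Measure Ω} {Ψ : Ω → Set (Rd d) → ℝ}
    {ν ν' : Measure (Rd d)} (hν : IsBartlettMeasure P Ψ ν) (hν' : IsBartlettMeasure P Ψ ν') :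
    ν.restrict (Metric.ball 0 1) = ν'.restrict (Metric.ball 0 1) := by
  have hm : MeasurableSet (Metric.ball (0 : Rd d) 1) := Metric.isOpen_ball.measurableSet
  have hf := isTestFunction_ballIndicator (d := d)
  set D : Rd d → ℝ≥0∞ := fun k => ENNReal.ofReal (‖fourierHat (ballIndicator d) k‖ ^ 2) with hD
  have hDm : Measurable D :=
    ((continuous_fourierHat hf.integrable_volume).measurable.norm.pow_const 2).ennreal_ofReal
  have hi : ∀ ρ, IsBartlettMeasure P Ψ ρ →
      Integrable (fun k => ‖fourierHat (ballIndicator d) k‖ ^ 2) ρ := fun ρ hρ => by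
    have h1 := (hρ.2 _ _ hf hf).1.norm
    refine h1.congr (Eventually.of_forall fun k => ?_)
    simp only [norm_mul, RCLike.norm_conj]
    rw [sq]
  have hfin : ∀ ρ, IsBartlettMeasure P Ψ ρ → IsFiniteMeasure (ρ.withDensity D) := fun ρ hρ =>
    isFiniteMeasure_withDensity_ofReal (hi ρ hρ).2
  have hchar : ∀ ρ, IsBartlettMeasure P Ψ ρ → ∀ t, charFun (ρ.withDensity D) t =
      ∫ k, planeWave k t * ((‖fourierHat (ballIndicator d) k‖ ^ 2 : ℝ) : ℂ) ∂ρ := fun ρ hρ t => by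
    rw [charFun_apply, integral_withDensity_eq_integral_toReal_smul hDm
      (Eventually.of_forall fun _ => ENNReal.ofReal_lt_top)]
    refine integral_congr_ae (Eventually.of_forall fun k => ?_)
    simp only [hD]
    rw [ENNReal.toReal_ofReal (by positivity), Complex.real_smul, mul_comm, planeWave,
      mul_comm Complex.I]
  have := hfin ν hν
  have := hfin ν' hν'
  -- Multiplying by the squared transform yields finite measures, which are determined by their
  -- characteristic functions. The density is positive on the unit ball and can be divided out
  -- there.
  have key : ν.withDensity D = ν'.withDensity D := by
    refine Measure.ext_of_charFun (funext fun t => ?_)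
    rw [hchar ν hν, hchar ν' hν', hν.integral_planeWave hf, hν'.integral_planeWave hf]
  have hinv : ∀ ρ : Measure (Rd d), ((ρ.withDensity D).restrict (Metric.ball 0 1)).withDensity D⁻¹ =
      ρ.restrict (Metric.ball 0 1) := fun ρ => by
    rw [restrict_withDensity hm]
    refine withDensity_inv_same hDm ?_ (Eventually.of_forall fun _ => ENNReal.ofReal_ne_top)
    refine (ae_restrict_iff' hm).2 (Eventually.of_forall fun k hk => ?_)
    simp only [hD, ne_eq, ENNReal.ofReal_eq_zero, not_le]
    have := norm_pos_iff.2 (fourierHat_ballIndicator_ne_zero hk)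
    positivity
  rw [← hinv ν, ← hinv ν', key]

end Uniqueness

/-! ### Positivity of the diagonal intensity and sole uniformity. -/

section SoleUniformity

variable {d : ℕ} {Ω : Type*} [MeasurableSpace Ω]

theorem iUnion_shiftSet_unitCube :
    ⋃ j : Fin d → ℤ, shiftSet (WithLp.toLp 2 fun i => (j i : ℝ)) (unitCube d) = Set.univ := by
  refine Set.eq_univ_of_forall fun x => Set.mem_iUnion.2 ⟨fun i => ⌊x i⌋, fun i => ?_⟩
  simp [Int.fract_lt_one]

theorem diagMeasure_univ (Q : Measure (CountingMeasure d)) :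
    diagMeasure Q Set.univ = ∫⁻ ν, ∫⁻ u, ν.1 {u} ∂ν.1 ∂Q := by
  have hi : Measurable ((Set.diagonal (Rd d)).indicator fun _ : Rd d × Rd d => (1 : ℝ≥0∞)) :=
    measurable_const.indicator measurableSet_diagonal
  rw [← lintegral_one, lintegral_diagMeasure Q measurable_const]
  refine (lintegral_pairMeasure Q hi).trans ?_
  refine lintegral_congr fun ν => lintegral_congr fun u => ?_
  have : ∀ v, (Set.diagonal (Rd d)).indicator (fun _ => (1 : ℝ≥0∞)) (u, v) =
      ({u} : Set (Rd d)).indicator 1 v := fun v => by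
    by_cases h : u = v
    · subst h; simp
    · have h' : v ≠ u := fun e => h e.symm
      simp [h, h']
  simp_rw [this]
  exact lintegral_indicator_one (measurableSet_singleton u)

/-- The integral is the sum of the squared masses of the atoms, and a counting measure has no other
mass. -/
theorem eq_zero_of_lintegral_mass_eq_zero (ν : CountingMeasure d)
    (h : ∫⁻ u, ν.1 {u} ∂ν.1 = 0) : ν.1 = 0 := by
  obtain ⟨X, V, hXV⟩ := exists_isEnumeration (d := d)
  have hm : Measurable fun u : Rd d => ν.1 {u} := measurable_mass_at.comp measurable_prodMk_left
  rw [hXV.lintegral ν _ hm, ENNReal.tsum_eq_zero] at h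
  rw [hXV.eq_sum_weight ν]
  have hw : ∀ n, weight X V n ν = 0 := fun n => by
    by_cases hn : ν ∈ V n
    · exact (mul_eq_zero.1 (h n)).resolve_right (hXV.atom n ν hn)
    · exact Set.indicator_of_notMem hn _
  simp [hw]

/-- If the value were zero, stationarity would make the diagonal measure null on every translate of
the cube, hence everywhere. Then `E ∑ Φ{x}²` over all points would vanish and `Φ` would be almost
surely zero. -/
theorem diagMeasure_unitCube_pos {P : Measure Ω} [IsProbabilityMeasure P]
    {Φ : Ω → Measure (Rd d)} (hΦ : IsPointProcess Φ) (hne : ¬ ∀ᵐ ω ∂P, Φ ω = 0)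
    (hstat : IsStationaryRandom P (toSigned Φ))
    (hsq : IsLocallySquareIntegrable P (toSigned Φ)) :
    0 < (diagMeasure (P.map (countingProcess hΦ))).real (unitCube d) := by
  have hFm := measurable_countingProcess hΦ
  set Q := P.map (countingProcess hΦ) with hQ
  have hfin : diagMeasure Q (unitCube d) < ∞ := (diagMeasure_le Q _ measurableSet_unitCube).trans_lt
    (pairMeasure_bounded_lt_top hΦ hstat hsq isBounded_unitCube)
  refine ENNReal.toReal_pos (fun h0 => hne ?_) hfin.ne
  have h1 : diagMeasure Q Set.univ = 0 := by
    rw [← iUnion_shiftSet_unitCube]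
    refine measure_iUnion_null fun j => ?_
    rw [diagMeasure_shiftSet Q (map_shift_eq hΦ hstat) measurableSet_unitCube, h0]
  have hm : Measurable fun ν : CountingMeasure d => ∫⁻ u, ν.1 {u} ∂ν.1 :=
    Measurable.lintegral_kernel_prod_right' (κ := countingKernel (d := d)) measurable_mass_at
  have hm' : Measurable fun ω =>
      ∫⁻ u, (countingProcess hΦ ω).1 {u} ∂(countingProcess hΦ ω).1 := hm.comp hFm
  rw [diagMeasure_univ, hQ, lintegral_map hm hFm, lintegral_eq_zero_iff hm'] at h1
  filter_upwards [h1] with ω hω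
  exact eq_zero_of_lintegral_mass_eq_zero (countingProcess hΦ ω) hω

theorem volume_real_ball {ε : ℝ} (hε : 0 < ε) : (volume : Measure (Rd d)).real (Metric.ball 0 ε) =
    ε ^ d * (volume : Measure (Rd d)).real (Metric.ball 0 1) := by
  rw [measureReal_def, Measure.addHaar_ball_of_pos _ _ hε, finrank_euclideanSpace_fin,
    ENNReal.toReal_mul, ENNReal.toReal_ofReal (by positivity)]
  rfl

theorem rpow_two_mul (ε : ℝ) (p : ℕ) : ε ^ (2 * (p : ℝ)) = (ε ^ p) ^ 2 := by
  rw [← pow_mul, mul_comm p 2, ← Real.rpow_natCast]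
  push_cast
  rfl

/-- The mean transform is bounded by the total mass, so the first part inherits the order of `ν`.
The second is at most a constant times `ε^{2p}` times the volume of the ball, which is of order
`ε^d`. -/
theorem clusterSpectralMeasure_isBigO {c : ℝ} (hc : 0 ≤ c) {ν : Measure (Rd d)}
    (hν : FiniteOnBounded ν) {L : Measure (SignedMeasure (Rd d))} {p : ℕ} {C : ℝ}
    (hC : 0 ≤ C) (hV : ∀ k, transformVariance L k ≤ C * (‖k‖ ^ p) ^ 2)
    (hO : (fun ε : ℝ => ν.real (Metric.ball 0 ε) / ε ^ d) =O[𝓝[>] 0] fun ε : ℝ => ε ^ (2 * (p : ℝ))) :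
    (fun ε : ℝ => (clusterSpectralMeasure c ν L).real (Metric.ball 0 ε) / ε ^ d) =O[𝓝[>] 0]
      fun ε : ℝ => ε ^ (2 * (p : ℝ)) := by
  set M := (clusterMean L).real Set.univ ^ 2 with hM
  set v := (volume : Measure (Rd d)).real (Metric.ball 0 1) with hv
  have h1 : (fun ε : ℝ => M * (ν.real (Metric.ball 0 ε) / ε ^ d) + c * C * v * ε ^ (2 * (p : ℝ)))
      =O[𝓝[>] 0] fun ε : ℝ => ε ^ (2 * (p : ℝ)) :=
    (hO.const_mul_left M).add ((isBigO_refl _ _).const_mul_left _)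
  refine IsBigO.trans (IsBigO.of_bound 1 ?_) h1
  filter_upwards [self_mem_nhdsWithin] with ε hε
  have hε' : 0 < ε := hε
  have h2 := clusterSpectralMeasure_le hc ν (L := L) (B := Metric.ball 0 ε)
    Metric.isOpen_ball.measurableSet (b := C * (ε ^ p) ^ 2) fun k hk => by
      refine (hV k).trans (mul_le_mul_of_nonneg_left ?_ hC)
      have hk' := (mem_ball_zero_iff.1 hk).le
      gcongr
  have h3 := ENNReal.toReal_mono (ENNReal.add_ne_top.2
    ⟨ENNReal.mul_ne_top ENNReal.ofReal_ne_top (hν _ Metric.isBounded_ball).ne,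
      ENNReal.mul_ne_top ENNReal.ofReal_ne_top measure_ball_lt_top.ne⟩) h2
  rw [ENNReal.toReal_add (ENNReal.mul_ne_top ENNReal.ofReal_ne_top (hν _ Metric.isBounded_ball).ne)
    (ENNReal.mul_ne_top ENNReal.ofReal_ne_top measure_ball_lt_top.ne), ENNReal.toReal_mul,
    ENNReal.toReal_mul, ENNReal.toReal_ofReal (by positivity), ENNReal.toReal_ofReal (by positivity),
    ← measureReal_def, ← measureReal_def, ← measureReal_def, volume_real_ball hε'] at h3
  rw [one_mul, Real.norm_of_nonneg (by positivity), Real.norm_of_nonneg (by positivity),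
    div_le_iff₀ (by positivity), rpow_two_mul]
  refine h3.trans (le_of_eq ?_)
  rw [hM, hv]
  field_simp

/-- Any spectral measure agrees with the computed one on small balls. Dropping its first,
nonnegative part bounds the integral of the variance, and a little-o bound would make the moments of
order `p` deterministic. -/
theorem not_isBeyondUniform_of_momentTensor {P : Measure Ω} {Ψ : Ω → Set (Rd d) → ℝ}
    {c : ℝ} (hc : 0 < c) {ν : Measure (Rd d)} {L : Measure (SignedMeasure (Rd d))}
    [IsProbabilityMeasure L] (hL : ∫⁻ m, signKernel m Set.univ ^ 2 ∂L < ∞) {p : ℕ}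
    (hmom : ∫⁻ m, (∫⁻ z, ‖z.1‖ₑ ^ p ∂signKernel m) ^ 2 ∂L < ∞)
    (hfit : ∀ q < p, ∃ c, ∀ᵐ m ∂L, momentTensor q m = c)
    (hnonfit : ¬ ∃ c, ∀ᵐ m ∂L, momentTensor p m = c)
    (hB : IsBartlettMeasure P Ψ (clusterSpectralMeasure c ν L)) :
    ¬ IsBeyondUniform P Ψ (2 * (p : ℝ)) := by
  rintro ⟨ν', hν', ho⟩
  refine hnonfit ?_
  -- Radii at most one keep the balls inside the unit ball, where uniqueness of the spectral measure
  -- is available.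
  set ε : ℕ → ℝ := fun n => 1 / ((n : ℝ) + 1) with hε
  have hpos : ∀ n, 0 < ε n := fun n => Nat.one_div_pos_of_nat
  have hle : ∀ n, ε n ≤ 1 := fun n => by
    rw [hε]
    exact (div_le_one (by positivity)).2 (by linarith [(Nat.cast_nonneg n : (0 : ℝ) ≤ n)])
  have hε0 : Tendsto ε atTop (𝓝 0) := tendsto_one_div_add_atTop_nhds_zero_nat
  have hε0' : Tendsto ε atTop (𝓝[>] 0) :=
    tendsto_nhdsWithin_iff.2 ⟨hε0, Eventually.of_forall hpos⟩
  refine exists_momentTensor_eq_of_tendsto hL hmom hfit hpos hε0 ?_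
  have h1 : Tendsto (fun n => ν'.real (Metric.ball 0 (ε n)) / ε n ^ d / ε n ^ (2 * (p : ℝ))) atTop
      (𝓝 0) := (ho.comp_tendsto hε0').tendsto_div_nhds_zero
  have h2 : Tendsto (fun n => ENNReal.ofReal (c⁻¹ *
      (ν'.real (Metric.ball 0 (ε n)) / ε n ^ d / ε n ^ (2 * (p : ℝ))))) atTop (𝓝 0) := by
    have := ENNReal.tendsto_ofReal (h1.const_mul c⁻¹)
    rwa [mul_zero, ENNReal.ofReal_zero] at this
  refine tendsto_of_tendsto_of_tendsto_of_le_of_le tendsto_const_nhds h2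
    (fun n => zero_le) fun n => ?_
  have hn := hpos n
  have hm : MeasurableSet (Metric.ball (0 : Rd d) (ε n)) := Metric.isOpen_ball.measurableSet
  have h3 : ν' (Metric.ball 0 (ε n)) = clusterSpectralMeasure c ν L (Metric.ball 0 (ε n)) := by
    have h4 := congrArg (fun m => m (Metric.ball (0 : Rd d) (ε n))) (hν'.restrict_ball_eq hB)
    simpa only [Measure.restrict_apply hm,
      Set.inter_eq_left.2 (Metric.ball_subset_ball (x := (0 : Rd d)) (hle n))] using h4
  have h5 : ENNReal.ofReal c * ∫⁻ k in Metric.ball 0 (ε n), ENNReal.ofReal (transformVariance L k) ≤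
      ν' (Metric.ball 0 (ε n)) := by
    rw [h3, clusterSpectralMeasure, Measure.add_apply, withDensity_apply _ hm,
      withDensity_apply _ hm,
      ← lintegral_const_mul _ (measurable_transformVariance hL).ennreal_ofReal]
    simp_rw [← ENNReal.ofReal_mul hc.le]
    exact le_add_self
  have h6 : ν' (Metric.ball 0 (ε n)) = ENNReal.ofReal (ν'.real (Metric.ball 0 (ε n))) :=
    (ENNReal.ofReal_toReal (hν'.1 _ Metric.isBounded_ball).ne).symm
  have e : c⁻¹ * (ν'.real (Metric.ball 0 (ε n)) / ε n ^ d / ε n ^ (2 * (p : ℝ))) =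
      (ε n ^ (d + 2 * p))⁻¹ * (c⁻¹ * ν'.real (Metric.ball 0 (ε n))) := by
    rw [rpow_two_mul, pow_add, ← pow_mul, mul_comm p 2]
    field_simp
  simp only
  rw [e, ENNReal.ofReal_mul (by positivity), ENNReal.ofReal_mul (by positivity), ← h6]
  refine mul_le_mul_right ?_ _
  refine le_trans (le_of_eq ?_) (mul_le_mul_right h5 _)
  rw [← mul_assoc, ← ENNReal.ofReal_mul (by positivity), inv_mul_cancel₀ hc.ne', ENNReal.ofReal_one,
    one_mul]

theorem measurable_momentTensor (q : ℕ) (j : Fin q → Fin d) :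
    Measurable fun m : SignedMeasure (Rd d) => momentTensor q m j := by
  simp_rw [momentTensor_eq_integral]
  exact (StronglyMeasurable.integral_kernel (κ := signKernel (d := d))
    (measurable_signOf_snd.mul ((measurable_prod_apply j).comp
      measurable_fst)).stronglyMeasurable).measurable

theorem ae_map_momentTensor_iff {Ω' : Type*} [MeasurableSpace Ω'] {P' : Measure Ω'}
    {μ : Ω' → SignedMeasure (Rd d)} (hμ : Measurable μ) (q : ℕ) :
    (∃ c, ∀ᵐ m ∂P'.map μ, momentTensor q m = c) ↔ HasDeterministicMoment P' μ q := by
  refine exists_congr fun c => ?_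
  refine ae_map_iff hμ.aemeasurable ?_
  exact measurableSet_eq_fun (measurable_pi_lambda _ fun j => measurable_momentTensor q j)
    measurable_const

theorem lintegral_signKernel_sq_lt_top {Ω' : Type*} [MeasurableSpace Ω'] {P' : Measure Ω'}
    {μ : Ω' → SignedMeasure (Rd d)} (hμ : Measurable μ) {p : ℕ}
    (h : ∫⁻ ω, (∫⁻ x, (‖x‖ₑ ^ p + 1) ∂(μ ω).totalVariation) ^ 2 ∂P' < ∞)
    {F : Rd d → ℝ≥0∞} (hF : Measurable F) (hle : ∀ x, F x ≤ ‖x‖ₑ ^ p + 1) :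
    ∫⁻ m, (∫⁻ z, F z.1 ∂signKernel m) ^ 2 ∂P'.map μ < ∞ := by
  have hm : Measurable fun m : SignedMeasure (Rd d) => (∫⁻ z, F z.1 ∂signKernel m) ^ 2 :=
    (Measurable.lintegral_kernel (κ := signKernel (d := d)) (hF.comp measurable_fst)).pow_const 2
  rw [lintegral_map hm hμ]
  refine (lintegral_mono fun ω => pow_le_pow_left' ?_ 2).trans_lt h
  have hm' : Measurable fun x : Rd d => ‖x‖ₑ ^ p + 1 :=
    (measurable_id.enorm.pow_const p).add_const 1
  rw [← signKernel_map_fst, lintegral_map hm' measurable_fst]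
  exact lintegral_mono fun z => hle z.1

end SoleUniformity

/-- Independent clusters with deterministic moments of order less than `p` and a non-deterministic
moment of order `p`, attached to the points of a `2p`-uniform stationary point process, form a
solely `2p`-uniform stationary random signed measure. -/
theorem theoremt {d : ℕ} (hd : 0 < d) (p : ℕ)
    {Ω : Type*} [MeasurableSpace Ω] (P : Measure Ω) [IsProbabilityMeasure P]
    {Ω' : Type*} [MeasurableSpace Ω'] (P' : Measure Ω') [IsProbabilityMeasure P']
    -- the random finite signed measure `μ`
    (μ : Ω' → SignedMeasure (Rd d)) (hμ : Measurable μ)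
    -- the point process `Φ`
    (Φ : Ω → Measure (Rd d)) (hΦ : IsPointProcess Φ)
    (hΦ_ne : ¬ ∀ᵐ ω ∂P, Φ ω = 0)
    (hΦ_stat : IsStationaryRandom P (toSigned Φ))
    (hΦ_sq : IsLocallySquareIntegrable P (toSigned Φ))
    (hΦ_unif : IsUniform P (toSigned Φ) (2 * (p : ℝ)))
    -- the random transport kernel `K`
    (K : Ω → Rd d → SignedMeasure (Rd d)) (hK : Measurable (Function.uncurry K))
    (hK_ind : HasIndependentClusters P Φ K (P'.map μ))
    -- the moment conditions
    (h_moment : ∫⁻ ω, (∫⁻ x, (‖x‖ₑ ^ p + 1) ∂(μ ω).totalVariation) ^ 2 ∂P' < ∞)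
    (h_fit : ∀ q : ℕ, q < p → HasDeterministicMoment P' μ q)
    (h_nonfit : ¬ HasDeterministicMoment P' μ p) :
    -- `|K|Φ` is locally finite, so that `KΦ` is well defined
    (∀ᵐ ω ∂P, ∀ B : Set (Rd d), Bornology.IsBounded B → MeasurableSet B →
      ∫⁻ x, (K ω x).totalVariation B ∂Φ ω < ∞) ∧
    IsRandomSignedMeasure P (destination K Φ) ∧
    IsStationaryRandom P (destination K Φ) ∧
    (∀ T : Rd d → Ω → Ω, IsInvariantRandom T (toSigned Φ) → IsInvariantKernel T K →
      IsInvariantRandom T (destination K Φ)) ∧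
    IsLocallySquareIntegrable P (destination K Φ) ∧
    IsSolelyUniform P (destination K Φ) (2 * (p : ℝ)) := by
  set L := P'.map μ with hLdef
  have : IsProbabilityMeasure L := Measure.isProbabilityMeasure_map hμ.aemeasurable
  -- The moment hypothesis is used through its two consequences: square-integrable total mass, for
  -- the second-order calculus, and a square-integrable moment of order `p`, for the Taylor
  -- remainder.
  have hL : ∫⁻ m, signKernel m Set.univ ^ 2 ∂L < ∞ := by
    simpa using lintegral_signKernel_sq_lt_top hμ h_moment (F := fun _ => 1) measurable_const
      fun x => le_add_self
  have hmom : ∫⁻ m, (∫⁻ z, ‖z.1‖ₑ ^ p ∂signKernel m) ^ 2 ∂L < ∞ :=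
    lintegral_signKernel_sq_lt_top hμ h_moment (F := fun x => ‖x‖ₑ ^ p)
      (measurable_id.enorm.pow_const p) fun x => le_self_add
  have hfit : ∀ q < p, ∃ c, ∀ᵐ m ∂L, momentTensor q m = c := fun q hq =>
    (ae_map_momentTensor_iff hμ q).2 (h_fit q hq)
  have hnonfit : ¬ ∃ c, ∀ᵐ m ∂L, momentTensor p m = c := fun h =>
    h_nonfit ((ae_map_momentTensor_iff hμ p).1 h)
  have hfin := hK_ind.ae_lintegral_totalVariation_lt_top hΦ hΦ_stat hΦ_sq hK hL
  obtain ⟨ν, hν, hO⟩ := hΦ_unif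
  have hB := hK_ind.isBartlettMeasure hΦ hΦ_stat hΦ_sq hK hL hν
  have hγ := diagMeasure_unitCube_pos hΦ hΦ_ne hΦ_stat hΦ_sq
  have hc : 0 < (diagMeasure (P.map (countingProcess hΦ))).real (unitCube d) *
      ((2 * Real.pi) ^ d)⁻¹ := by positivity
  obtain ⟨C, hC, hV⟩ := exists_transformVariance_le hL hmom hfit
  refine ⟨hfin, isRandomSignedMeasure_destination hΦ hK hfin,
    hK_ind.isStationaryRandom_destination hΦ hΦ_stat hK hfin,
    fun T hT hTK => isInvariantRandom_destination hΦ hT hTK, ?_,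
    ⟨_, hB, clusterSpectralMeasure_isBigO hc.le hν.1 hC hV hO⟩,
    not_isBeyondUniform_of_momentTensor hc hL hmom hfit hnonfit hB⟩
  refine (lintegral_mono fun ω => pow_le_pow_left'
    (absVariation_destination_le hΦ hK ω (Metric.ball 0 1)) 2).trans_lt ?_
  exact hK_ind.lintegral_sq_lt_top hΦ hΦ_stat hΦ_sq hK hL Metric.isBounded_ball
    Metric.isOpen_ball.measurableSet
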